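/- Let $k$ be a field of characteristic zero, $M$ a topological space and $A$ a sheaf of commutative unital $k$-algebras on $M$. Let $f$ be a Poisson bracket on $A$, i.e. a family of skew-symmetric $k$-bilinear maps $f\colon A(U)\times A(U)\to A(U)$, compatible with restrictions, satisfying the Leibniz rule $f(ab,c)=a f(b,c)+b f(a,c)$ and the Jacobi identity. Let $E\subset \mathrm{Der}_k(A)$ be the subsheaf of $A$-modules generated by the derivations $f(a,\cdot)$, and let $\varphi\colon E\times E\to A$ be the (well defined) $A$-bilinear skew-symmetric form with $\varphi(f(a,\cdot),f(b,\cdot))=f(a,b)$. Suppose that $f$ is locally free, i.e. $E$ is a locally free sheaf of $A$-modules of finite rank, and nonsingular, i.e. the morphism $E\to E^*=\mathcal{H}om_A(E,A)$, $x\mapsto\varphi(x,\cdot)$, is an isomorphism of sheaves. Let $\mathrm{sp}(E)$ be the sheaf of $A$-linear endomorphisms $Q$ of $E$ with $\varphi(Qx,y)+\varphi(x,Qy)=0$, and let $\mathcal{T}$ be the sheaf of closed $\mathrm{sp}(E)$-valued $1$-forms, i.e. of those sections $z\mapsto s_z$ of $\mathrm{sp}(E)\otimes_A E^*=\mathcal{H}om_A(E,\mathrm{sp}(E))$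 for which $$\varphi(s_xy-s_yx,z)+\varphi(s_yz-s_zy,x)+\varphi(s_zx-s_xz,y)=0\qquad\text{for all } x,y,z\in E.$$ Suppose that $H^1(M,\mathcal{T})=0$. Then there exists a quantization of $A$ by $f$: there is a family of $k[[\hbar]]$-bilinear products $*$ on the modules $A(U)[[\hbar]]$ ($U\subset M$ open), compatible with restrictions, which are associative with unit $1$ and satisfy $$a*b\equiv ab+\hbar f(a,b)\pmod{\hbar^2}\qquad\text{for all } a,b\in A(U).$$ Thus $A_\hbar=(A[[\hbar]],*)$ is a sheaf of associative unital $k[[\hbar]]$-algebras with $A_\hbar/\hbar A_\hbar=A$ and with first-order term $f$. -/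

import Mathlib

open CategoryTheory Opposite TopologicalSpace

universe u

namespace SheafQuantization

section Gluing

variable {M : TopCat.{u}}

/-- Unique gluing for a presheaf of sets on `M`, given by its sections `X` and restrictions `r`. -/
def HasGluing (X : Opens M → Type u) (r : ∀ U V : Opens M, V ≤ U → X U → X V) : Prop :=
  ∀ (V : Opens M) (ι : Type u) (U : ι → Opens M) (hU : ∀ i, U i ≤ V) (_ : V ≤ iSup U)
    (s : ∀ i, X (U i)),
    (∀ i j, r (U i) (U i ⊓ U j) inf_le_left (s i) = r (U j) (U i ⊓ U j) inf_le_right (s j)) →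
    ∃! t : X V, ∀ i, r V (U i) (hU i) t = s i

theorem HasGluing.ext {X : Opens M → Type u} {r : ∀ U V : Opens M, V ≤ U → X U → X V}
    (hX : HasGluing X r)
    (hr : ∀ U V W (h : V ≤ U) (h' : W ≤ V) x, r V W h' (r U V h x) = r U W (h'.trans h) x)
    {V : Opens M} {ι : Type u} {U : ι → Opens M} (hU : ∀ i, U i ≤ V) (hc : V ≤ iSup U)
    {x y : X V} (h : ∀ i, r V (U i) (hU i) x = r V (U i) (hU i) y) : x = y := by
  obtain ⟨t, -, ht⟩ := hX V ι U hU hc (fun i => r V (U i) (hU i) x)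
    (fun i j => by rw [hr, hr])
  rw [ht x (fun i => rfl), ht y (fun i => (h i).symm)]

theorem inf_le_iSup_inf {V W : Opens M} (hW : W ≤ V) {ι : Type u} {U : ι → Opens M}
    (hc : V ≤ iSup U) : W ≤ iSup (fun i => W ⊓ U i) := by
  rw [← inf_iSup_eq]
  exact le_inf le_rfl (hW.trans hc)

/-- Morphisms of presheaves into a sheaf can be glued. -/
theorem HasGluing.glueHom {X Y : Opens M → Type u} {rX : ∀ U V : Opens M, V ≤ U → X U → X V}
    {rY : ∀ U V : Opens M, V ≤ U → Y U → Y V}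
    (hrX : ∀ U V W (h : V ≤ U) (h' : W ≤ V) x, rX V W h' (rX U V h x) = rX U W (h'.trans h) x)
    (hrY : ∀ U V W (h : V ≤ U) (h' : W ≤ V) x, rY V W h' (rY U V h x) = rY U W (h'.trans h) x)
    (hY : HasGluing Y rY) {V : Opens M} {ι : Type u} {U : ι → Opens M} (hU : ∀ i, U i ≤ V)
    (hc : V ≤ iSup U) (g : ∀ i W, W ≤ U i → X W → Y W)
    (nat : ∀ i W W' (h : W ≤ U i) (h' : W' ≤ W) x,
      rY W W' h' (g i W h x) = g i W' (h'.trans h) (rX W W' h' x))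
    (cpt : ∀ i j W (hi : W ≤ U i) (hj : W ≤ U j) x, g i W hi x = g j W hj x) :
    ∃ t : ∀ W, W ≤ V → X W → Y W,
      (∀ W W' (h : W ≤ V) (h' : W' ≤ W) x,
        rY W W' h' (t W h x) = t W' (h'.trans h) (rX W W' h' x)) ∧
      ∀ i W (h : W ≤ U i) x, t W (h.trans (hU i)) x = g i W h x := by
  have key : ∀ W, W ≤ V → ∀ x : X W, ∃ y : Y W, ∀ i,
      rY W (W ⊓ U i) inf_le_left y = g i (W ⊓ U i) inf_le_right (rX W (W ⊓ U i) inf_le_left x) := by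
    intro W hW x
    obtain ⟨y, hy, -⟩ := hY W ι (fun i => W ⊓ U i) (fun i => inf_le_left)
      (inf_le_iSup_inf hW hc)
      (fun i => g i (W ⊓ U i) inf_le_right (rX W (W ⊓ U i) inf_le_left x))
      (fun i j => by
        rw [nat, nat, hrX, hrX]
        exact cpt i j _ _ _ _)
    exact ⟨y, hy⟩
  choose t ht using key
  refine ⟨t, ?_, ?_⟩
  · intro W W' h h' x
    refine hY.ext hrY (fun i => (inf_le_left : W' ⊓ U i ≤ W'))
      (inf_le_iSup_inf (h'.trans h) hc) (fun i => ?_)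
    rw [ht, hrX, hrY, ← hrY W (W ⊓ U i) (W' ⊓ U i) inf_le_left (inf_le_inf_right _ h'), ht, nat,
      hrX]
  · intro i W h x
    refine hY.ext hrY (fun i => (inf_le_left : W ⊓ U i ≤ W))
      (inf_le_iSup_inf (h.trans (hU i)) hc) (fun j => ?_)
    rw [ht, nat]
    exact cpt j i _ _ _ _

end Gluing

noncomputable section

variable {k : Type u} [Field k] {M : TopCat.{u}} (A : TopCat.Sheaf (CommAlgCat.{u} k) M)

/-- The algebra of sections of `A` over `U`. -/
def Sec (U : Opens M) : Type u := A.presheaf.obj (op U)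

instance (U : Opens M) : CommRing (Sec A U) :=
  inferInstanceAs (CommRing (A.presheaf.obj (op U)))

instance (U : Opens M) : Algebra k (Sec A U) :=
  inferInstanceAs (Algebra k (A.presheaf.obj (op U)))

/-- Restriction of sections of `A`. -/
def res {U V : Opens M} (h : V ≤ U) : Sec A U →ₐ[k] Sec A V :=
  (A.presheaf.map (homOfLE h).op).hom

@[simp]
theorem res_res {U V W : Opens M} (h : V ≤ U) (h' : W ≤ V) (a : Sec A U) :
    res A h' (res A h a) = res A (h'.trans h) a := by
  have : A.presheaf.map (homOfLE (h'.trans h)).op =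
      A.presheaf.map (homOfLE h).op ≫ A.presheaf.map (homOfLE h').op := by
    rw [← A.presheaf.map_comp]; rfl
  unfold res
  rw [this]; rfl

@[simp]
theorem res_self {U : Opens M} (a : Sec A U) : res A (le_refl U) a = a := by
  have : A.presheaf.map (homOfLE (le_refl U)).op = 𝟙 _ := A.presheaf.map_id _
  unfold res
  rw [this]; rfl

theorem sec_hasGluing : HasGluing (Sec A) (fun _ _ h => res A h) := by
  have h1 : TopCat.Presheaf.IsSheaf
      (A.presheaf ⋙ coyoneda.obj (op (CommAlgCat.of k (Polynomial k)))) :=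
    (isSheaf_iff_isSheaf_of_type _ _).2 (A.property (CommAlgCat.of k (Polynomial k)))
  have ev : ∀ (U : Opens M) (a : Sec A U), ∃ p : CommAlgCat.of k (Polynomial k) ⟶
      A.presheaf.obj (op U), p.hom Polynomial.X = a :=
    fun U a => ⟨CommAlgCat.ofHom (Polynomial.aeval a), Polynomial.aeval_X a⟩
  have inj : ∀ (U : Opens M) (p q : CommAlgCat.of k (Polynomial k) ⟶ A.presheaf.obj (op U)),
      p.hom Polynomial.X = q.hom Polynomial.X → p = q := fun U p q h =>
    CommAlgCat.hom_ext (Polynomial.algHom_ext h)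
  intro V ι U hU hc s hs
  obtain rfl : V = iSup U := le_antisymm hc (iSup_le hU)
  choose p hp using fun i => ev (U i) (s i)
  obtain ⟨t, ht, htu⟩ := h1.isSheafUniqueGluing_types (U := U) p (fun i j => inj _ _ _ (by
    have := hs i j
    rw [← hp i, ← hp j] at this
    exact this))
  refine ⟨t.hom Polynomial.X, fun i => ?_, fun y hy => ?_⟩
  · rw [← hp i, ← ht i]; rfl
  · obtain ⟨q, rfl⟩ := ev _ y
    rw [htu q (fun i => inj _ _ _ ((hy i).trans (hp i).symm))]

theorem sec_ext {U : Opens M} {ι : Type u} {V : ι → Opens M} (hV : ∀ i, V i ≤ U)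
    (hc : U ≤ iSup V) {a b : Sec A U} (h : ∀ i, res A (hV i) a = res A (hV i) b) : a = b :=
  (sec_hasGluing A).ext (fun _ _ _ h h' x => res_res A h h' x) hV hc h

/-- Sections over `U` of the sheaf `Der(A)`: the `k`-linear derivations of the sheaf `A|_U`. -/
structure DerSec (U : Opens M) where
  /-- the component on sections over `V` -/
  app : ∀ V : Opens M, V ≤ U → Derivation k (Sec A V) (Sec A V)
  res_app : ∀ (V W : Opens M) (hV : V ≤ U) (hW : W ≤ V) (a : Sec A V),
    res A hW (app V hV a) = app W (hW.trans hV) (res A hW a)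

variable {A}

theorem DerSec.ext' {U : Opens M} {D D' : DerSec A U}
    (h : ∀ V (hV : V ≤ U) b, D.1 V hV b = D'.1 V hV b) : D = D' := by
  obtain ⟨D, _⟩ := D
  obtain ⟨D', _⟩ := D'
  obtain rfl : D = D' := funext fun V => funext fun hV => Derivation.ext (h V hV)
  rfl

instance (U : Opens M) : Zero (DerSec A U) :=
  ⟨⟨fun _ _ => 0, by intro V W hV hW a; simp⟩⟩

instance (U : Opens M) : Add (DerSec A U) :=
  ⟨fun D D' => ⟨fun V hV => D.1 V hV + D'.1 V hV, by
    intro V W hV hW a; simp [D.2 V W hV hW a, D'.2 V W hV hW a]⟩⟩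

instance (U : Opens M) : Neg (DerSec A U) :=
  ⟨fun D => ⟨fun V hV => - D.1 V hV, by intro V W hV hW a; simp [D.2 V W hV hW a]⟩⟩

instance (U : Opens M) : SMul (Sec A U) (DerSec A U) where
  smul a D := ⟨fun V hV => res A hV a • D.1 V hV, by
    intro V W hV hW b
    simp [D.2 V W hV hW b]⟩

theorem DerSec.zero_apply {U V : Opens M} (hV : V ≤ U) (b : Sec A V) :
    (0 : DerSec A U).1 V hV b = 0 := rfl

theorem DerSec.add_apply {U : Opens M} (D D' : DerSec A U) {V : Opens M} (hV : V ≤ U)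
    (b : Sec A V) : (D + D').1 V hV b = D.1 V hV b + D'.1 V hV b := rfl

theorem DerSec.neg_apply {U : Opens M} (D : DerSec A U) {V : Opens M} (hV : V ≤ U)
    (b : Sec A V) : (-D).1 V hV b = - D.1 V hV b := rfl

theorem DerSec.smul_apply {U : Opens M} (a : Sec A U) (D : DerSec A U) {V : Opens M} (hV : V ≤ U)
    (b : Sec A V) : (a • D).1 V hV b = res A hV a * D.1 V hV b := rfl

instance (U : Opens M) : AddCommGroup (DerSec A U) where
  add_assoc D D' D'' := DerSec.ext' fun V hV b => by
    simp only [DerSec.add_apply, add_assoc]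
  zero_add D := DerSec.ext' fun V hV b => by
    simp only [DerSec.add_apply, DerSec.zero_apply, zero_add]
  add_zero D := DerSec.ext' fun V hV b => by
    simp only [DerSec.add_apply, DerSec.zero_apply, add_zero]
  add_comm D D' := DerSec.ext' fun V hV b => by
    simp only [DerSec.add_apply, add_comm]
  neg_add_cancel D := DerSec.ext' fun V hV b => by
    simp only [DerSec.add_apply, DerSec.neg_apply, DerSec.zero_apply, neg_add_cancel]
  nsmul := nsmulRec
  zsmul := zsmulRec

instance (U : Opens M) : Module (Sec A U) (DerSec A U) where
  one_smul D := DerSec.ext' fun V hV b => by rw [DerSec.smul_apply, map_one, one_mul]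
  mul_smul a a' D := DerSec.ext' fun V hV b => by
    rw [DerSec.smul_apply, DerSec.smul_apply, DerSec.smul_apply, map_mul, mul_assoc]
  smul_zero a := DerSec.ext' fun V hV b => by
    rw [DerSec.smul_apply, DerSec.zero_apply, mul_zero]
  zero_smul D := DerSec.ext' fun V hV b => by
    rw [DerSec.smul_apply, map_zero, zero_mul, DerSec.zero_apply]
  smul_add a D D' := DerSec.ext' fun V hV b => by
    rw [DerSec.smul_apply, DerSec.add_apply, DerSec.add_apply, DerSec.smul_apply,
      DerSec.smul_apply, mul_add]
  add_smul a a' D := DerSec.ext' fun V hV b => by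
    rw [DerSec.smul_apply, DerSec.add_apply, DerSec.smul_apply, DerSec.smul_apply, map_add, add_mul]

/-- Restriction of sections of `Der(A)`. -/
def DerSec.restrict {U V : Opens M} (h : V ≤ U) :
    DerSec A U →ₛₗ[(res A h : Sec A U →+* Sec A V)] DerSec A V where
  toFun D := ⟨fun W hW => D.1 W (hW.trans h), fun W W' hW hW' a => D.2 W W' (hW.trans h) hW' a⟩
  map_add' _ _ := rfl
  map_smul' a D := DerSec.ext' fun W hW b => by
    change res A (hW.trans h) a * _ = res A hW (res A h a) * _
    rw [res_res]

variable (A)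

theorem derSec_hasGluing :
    HasGluing (fun U => DerSec A U) (fun _ _ h => DerSec.restrict h) := by
  have hr : ∀ (U V W : Opens M) (h : V ≤ U) (h' : W ≤ V) (x : Sec A U),
      res A h' (res A h x) = res A (h'.trans h) x := fun _ _ _ h h' x => res_res A h h' x
  intro V ι U hU hc s hs
  obtain ⟨t, tn, ti⟩ := (sec_hasGluing A).glueHom hr hr hU hc
    (fun i W h a => (s i).1 W h a) (fun i W W' h h' x => (s i).2 W W' h h' x)
    (fun i j W hi hj x =>
      congrArg (fun D : DerSec A (U i ⊓ U j) => D.1 W (le_inf hi hj) x) (hs i j))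
  have loc : ∀ (W : Opens M) (hW : W ≤ V) (i : ι) (x : Sec A W),
      res A (inf_le_left : W ⊓ U i ≤ W) (t W hW x) =
        (s i).1 (W ⊓ U i) inf_le_right (res A inf_le_left x) := fun W hW i x => by
    rw [tn W (W ⊓ U i) hW inf_le_left x]; exact ti i _ inf_le_right _
  have ext : ∀ (W : Opens M) (_ : W ≤ V) (a b : Sec A W),
      (∀ i, res A (inf_le_left : W ⊓ U i ≤ W) a = res A inf_le_left b) → a = b :=
    fun W hW a b h => sec_ext A (fun i => inf_le_left) (inf_le_iSup_inf hW hc) h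
  let D : ∀ W : Opens M, W ≤ V → Derivation k (Sec A W) (Sec A W) := fun W hW =>
    Derivation.mk'
      { toFun := t W hW
        map_add' := fun x y => ext W hW _ _ fun i => by simp only [map_add, loc]
        map_smul' := fun c x => ext W hW _ _ fun i => by
          simp only [map_smul, loc, RingHom.id_apply]
          exact ((s i).1 (W ⊓ U i) inf_le_right).map_smul c _ }
      (fun a b => ext W hW _ _ fun i => by
        change res A _ (t W hW (a * b)) = res A _ (a • t W hW b + b • t W hW a)
        simp only [map_mul, map_add, loc, smul_eq_mul, Derivation.leibniz])
  refine ⟨⟨D, fun W W' h h' a => tn W W' h h' a⟩, fun i => ?_, fun D' hD' => ?_⟩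
  · exact DerSec.ext' fun W hW b => ti i W hW b
  · refine DerSec.ext' fun W hW b => ext W hW _ _ fun i => ?_
    change _ = res A _ (t W hW b)
    rw [loc, D'.2 W (W ⊓ U i) hW inf_le_left b, ← hD' i]
    rfl

/-- A Poisson bracket on the sheaf of `k`-algebras `A`. -/
structure PoissonBracket where
  /-- the bracket on sections over `U` -/
  br : ∀ U : Opens M, Sec A U →ₗ[k] Sec A U →ₗ[k] Sec A U
  br_res : ∀ {U V : Opens M} (h : V ≤ U) (a b : Sec A U),
    res A h (br U a b) = br V (res A h a) (res A h b)
  br_self : ∀ (U : Opens M) (a : Sec A U), br U a a = 0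
  leibniz : ∀ (U : Opens M) (a b c : Sec A U), br U (a * b) c = a * br U b c + b * br U a c
  jacobi : ∀ (U : Opens M) (a b c : Sec A U),
    br U (br U a b) c + br U (br U b c) a + br U (br U c a) b = 0

namespace PoissonBracket

variable {A} (f : PoissonBracket A)

theorem br_skew (U : Opens M) (a b : Sec A U) : f.br U a b = - f.br U b a := by
  have := f.br_self U (a + b)
  simp only [map_add, LinearMap.add_apply, f.br_self, zero_add, add_zero] at this
  exact eq_neg_of_add_eq_zero_right this

/-- The strong Hamiltonian derivation `f(b, ·)`. -/
def ham (U : Opens M) (b : Sec A U) : DerSec A U :=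
  ⟨fun V hV => Derivation.mk' (f.br V (res A hV b)) (fun x y => by
      rw [f.br_skew, f.leibniz, f.br_skew V y, f.br_skew V x]
      simp only [smul_eq_mul]
      ring),
    fun V W hV hW a => by
      change res A hW (f.br V (res A hV b) a) = f.br W _ _
      rw [f.br_res, res_res]⟩

theorem ham_apply {U V : Opens M} (b : Sec A U) (hV : V ≤ U) (c : Sec A V) :
    (f.ham U b).1 V hV c = f.br V (res A hV b) c := rfl

theorem restrict_ham {U V : Opens M} (h : V ≤ U) (b : Sec A U) :
    DerSec.restrict h (f.ham U b) = f.ham V (res A h b) :=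
  DerSec.ext' fun W hW c => by
    rw [ham_apply, res_res]; rfl

theorem restrict_mem_span {U V : Opens M} (h : V ≤ U) {D : DerSec A U}
    (hD : D ∈ Submodule.span (Sec A U) (Set.range (f.ham U))) :
    DerSec.restrict h D ∈ Submodule.span (Sec A V) (Set.range (f.ham V)) := by
  induction hD using Submodule.span_induction with
  | mem x hx =>
    obtain ⟨b, rfl⟩ := hx
    exact Submodule.subset_span ⟨res A h b, (f.restrict_ham h b).symm⟩
  | zero => rw [map_zero]; exact Submodule.zero_mem _
  | add x y _ _ hx hy => rw [map_add]; exact Submodule.add_mem _ hx hy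
  | smul a x _ hx => rw [map_smulₛₗ]; exact Submodule.smul_mem _ _ hx

/-- Sections over `U` of the sheaf `E` of weak Hamiltonian derivations: the subsheaf of `A`-modules
of `Der(A)` generated by the strong Hamiltonian derivations. -/
def E (U : Opens M) : Submodule (Sec A U) (DerSec A U) where
  carrier := {D | ∀ p ∈ U, ∃ (V : Opens M) (h : V ≤ U), p ∈ V ∧
    DerSec.restrict h D ∈ Submodule.span (Sec A V) (Set.range (f.ham V))}
  zero_mem' := fun p hp => ⟨U, le_rfl, hp, by rw [map_zero]; exact Submodule.zero_mem _⟩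
  add_mem' := by
    intro D D' hD hD' p hp
    obtain ⟨V, hV, hpV, h⟩ := hD p hp
    obtain ⟨V', hV', hpV', h'⟩ := hD' p hp
    refine ⟨V ⊓ V', inf_le_left.trans hV, ⟨hpV, hpV'⟩, ?_⟩
    rw [map_add]
    exact Submodule.add_mem _ (f.restrict_mem_span inf_le_left h)
      (f.restrict_mem_span inf_le_right h')
  smul_mem' := by
    intro a D hD p hp
    obtain ⟨V, hV, hpV, h⟩ := hD p hp
    refine ⟨V, hV, hpV, ?_⟩
    rw [map_smulₛₗ]
    exact Submodule.smul_mem _ _ h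

theorem ham_mem (U : Opens M) (b : Sec A U) : f.ham U b ∈ f.E U := fun _ hp =>
  ⟨U, le_rfl, hp, f.restrict_mem_span le_rfl (Submodule.subset_span ⟨b, rfl⟩)⟩

/-- Restriction of sections of `E`. -/
def resE {U V : Opens M} (h : V ≤ U) : f.E U →ₛₗ[(res A h : Sec A U →+* Sec A V)] f.E V where
  toFun x := ⟨DerSec.restrict h x.1, fun p hp => by
    obtain ⟨W, hW, hpW, hx⟩ := x.2 p (h hp)
    exact ⟨V ⊓ W, inf_le_left, ⟨hp, hpW⟩, f.restrict_mem_span (inf_le_right : V ⊓ W ≤ W) hx⟩⟩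
  map_add' _ _ := rfl
  map_smul' a x := Subtype.ext (map_smulₛₗ (DerSec.restrict h) a x.1)

theorem resE_resE {U V W : Opens M} (h : V ≤ U) (h' : W ≤ V) (x : f.E U) :
    f.resE h' (f.resE h x) = f.resE (h'.trans h) x := rfl

theorem e_hasGluing : HasGluing (fun U => f.E U) (fun _ _ h => f.resE h) := by
  intro V ι U hU hc s hs
  obtain ⟨D, hD, hDu⟩ := derSec_hasGluing A V ι U hU hc (fun i => (s i).1)
    (fun i j => congrArg Subtype.val (hs i j))
  refine ⟨⟨D, fun p hp => ?_⟩, fun i => Subtype.ext (hD i), fun y hy =>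
    Subtype.ext (hDu y.1 fun i => congrArg Subtype.val (hy i))⟩
  obtain ⟨i, hi⟩ := Opens.mem_iSup.1 (hc hp)
  obtain ⟨W, hW, hpW, h⟩ := (s i).2 p hi
  refine ⟨W, hW.trans (hU i), hpW, ?_⟩
  rw [← hD i] at h
  exact h

theorem e_ext {U : Opens M} {ι : Type u} {V : ι → Opens M} (hV : ∀ i, V i ≤ U)
    (hc : U ≤ iSup V) {x y : f.E U} (h : ∀ i, f.resE (hV i) x = f.resE (hV i) y) : x = y :=
  f.e_hasGluing.ext (fun _ _ _ _ _ _ => rfl) hV hc h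

/-- The finite sum `∑ cⱼ f(bⱼ, ·)` of strong Hamiltonian derivations, for `l = ∑ cⱼ [bⱼ]`. -/
def hamSum (U : Opens M) : (Sec A U →₀ Sec A U) →ₗ[Sec A U] DerSec A U :=
  Finsupp.linearCombination (Sec A U) (f.ham U)

/-- The finite sum `∑ cⱼ x(bⱼ)`, for `l = ∑ cⱼ [bⱼ]`. -/
def evalSum {U : Opens M} (x : DerSec A U) : (Sec A U →₀ Sec A U) →ₗ[Sec A U] Sec A U :=
  Finsupp.linearCombination (Sec A U) (fun b => x.1 U le_rfl b)

/-- `c` is the value of the form `φ` at `(x, y)`: wherever `y = ∑ cⱼ f(bⱼ, ·)`, one has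
`c = ∑ cⱼ x(bⱼ)`. -/
def IsFormValue {U : Opens M} (x y : f.E U) (c : Sec A U) : Prop :=
  ∀ (V : Opens M) (h : V ≤ U) (l : Sec A V →₀ Sec A V),
    f.hamSum V l = DerSec.restrict h y.1 → res A h c = evalSum (DerSec.restrict h x.1) l

/-- Restriction of formal sums. -/
def resSum {U V : Opens M} (h : V ≤ U) (l : Sec A U →₀ Sec A U) : Sec A V →₀ Sec A V :=
  l.sum fun b c => Finsupp.single (res A h b) (res A h c)

theorem hamSum_resSum {U V : Opens M} (h : V ≤ U) (l : Sec A U →₀ Sec A U) :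
    f.hamSum V (resSum h l) = DerSec.restrict h (f.hamSum U l) := by
  simp only [hamSum, resSum, Finsupp.linearCombination_apply, Finsupp.sum, map_sum, map_smulₛₗ,
    restrict_ham]
  refine Finset.sum_congr rfl fun b _ => ?_
  exact Finsupp.linearCombination_single (Sec A V) (res A h (l b)) (res A h b)

theorem evalSum_resSum {U V : Opens M} (h : V ≤ U) (x : DerSec A U) (l : Sec A U →₀ Sec A U) :
    evalSum (DerSec.restrict h x) (resSum h l) = res A h (evalSum x l) := by
  simp only [evalSum, resSum, Finsupp.linearCombination_apply, Finsupp.sum, map_sum, smul_eq_mul,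
    map_mul]
  refine Finset.sum_congr rfl fun b _ => ?_
  refine (Finsupp.linearCombination_single (Sec A V) (res A h (l b)) (res A h b)).trans ?_
  rw [x.2 U V le_rfl h b]
  rfl

theorem evalSum_hamSum {U : Opens M} (m l : Sec A U →₀ Sec A U) :
    evalSum (f.hamSum U m) l = - evalSum (f.hamSum U l) m := by
  have key : ∀ (m : Sec A U →₀ Sec A U) (b : Sec A U),
      (f.hamSum U m).1 U le_rfl b = m.sum fun a c => c * f.br U a b := by
    intro m b
    induction m using Finsupp.induction_linear with
    | zero => rw [map_zero, DerSec.zero_apply, Finsupp.sum_zero_index]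
    | add p q hp hq =>
      rw [map_add, DerSec.add_apply, hp, hq, Finsupp.sum_add_index'] <;> intros <;> simp [add_mul]
    | single a c =>
      rw [Finsupp.sum_single_index (by simp), hamSum, Finsupp.linearCombination_single,
        DerSec.smul_apply, ham_apply, res_self, res_self]
  simp only [evalSum, Finsupp.linearCombination_apply, key, Finsupp.sum, smul_eq_mul,
    Finset.mul_sum]
  rw [Finset.sum_comm, ← Finset.sum_neg_distrib]
  refine Finset.sum_congr rfl fun a _ => ?_
  rw [← Finset.sum_neg_distrib]
  refine Finset.sum_congr rfl fun b _ => ?_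
  rw [f.br_skew U a b]
  ring

theorem exists_hamSum {U : Opens M} (x : f.E U) (p : U) :
    ∃ (V : Opens M) (h : V ≤ U) (l : Sec A V →₀ Sec A V), p.1 ∈ V ∧
      f.hamSum V l = DerSec.restrict h x.1 := by
  obtain ⟨V, h, hp, hx⟩ := x.2 p.1 p.2
  obtain ⟨l, hl⟩ := (Finsupp.mem_span_range_iff_exists_finsupp).1 hx
  exact ⟨V, h, l, hp, hl⟩

theorem evalSum_congr {U V V' W : Opens M} (x y : f.E U) (h : V ≤ U) (h' : V' ≤ U) (hW : W ≤ V)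
    (hW' : W ≤ V') (l : Sec A V →₀ Sec A V) (l' : Sec A V' →₀ Sec A V')
    (hl : f.hamSum V l = DerSec.restrict h y.1) (hl' : f.hamSum V' l' = DerSec.restrict h' y.1) :
    res A hW (evalSum (DerSec.restrict h x.1) l) =
      res A hW' (evalSum (DerSec.restrict h' x.1) l') := by
  choose N hN m hp hm using fun p => f.exists_hamSum x p
  have cov : W ≤ iSup (fun p => W ⊓ N p) := fun q hq =>
    Opens.mem_iSup.2 ⟨⟨q, h (hW hq)⟩, hq, hp ⟨q, h (hW hq)⟩⟩
  refine sec_ext A (fun p => inf_le_left) cov fun p => ?_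
  rw [res_res, res_res, ← evalSum_resSum, ← evalSum_resSum]
  have e : ∀ hh : W ⊓ N p ≤ U, DerSec.restrict hh x.1 =
      f.hamSum _ (resSum (inf_le_right : W ⊓ N p ≤ N p) (m p)) := fun hh => by
    rw [hamSum_resSum, hm]; rfl
  change evalSum (DerSec.restrict ((inf_le_left.trans hW).trans h) x.1) _ =
    evalSum (DerSec.restrict ((inf_le_left.trans hW').trans h') x.1) _
  rw [e, evalSum_hamSum f (resSum _ (m p)) (resSum _ l),
    evalSum_hamSum f (resSum _ (m p)) (resSum _ l'), hamSum_resSum, hamSum_resSum, hl, hl']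
  rfl

theorem existsUnique_isFormValue {U : Opens M} (x y : f.E U) : ∃! c, f.IsFormValue x y c := by
  choose N hN m hp hm using fun p => f.exists_hamSum y p
  have cov : U ≤ iSup N := fun q hq => Opens.mem_iSup.2 ⟨⟨q, hq⟩, hp ⟨q, hq⟩⟩
  obtain ⟨c, hc, hcu⟩ := sec_hasGluing A U U N hN cov
    (fun p => evalSum (DerSec.restrict (hN p) x.1) (m p))
    (fun p q => f.evalSum_congr x y _ _ _ _ _ _ (hm p) (hm q))
  refine ⟨c, fun V h l hl => ?_, fun c' hc' => hcu c' fun p => hc' _ _ _ (hm p)⟩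
  refine sec_ext A (fun p => (inf_le_left : V ⊓ N p ≤ V)) (inf_le_iSup_inf h cov) fun p => ?_
  rw [res_res, ← res_res A (hN p) (inf_le_right : V ⊓ N p ≤ N p)]
  refine (congrArg (res A _) (hc p)).trans ?_
  exact f.evalSum_congr x y _ _ _ _ _ _ (hm p) hl

/-- The value of `φ` at `(x, y)`. -/
def formVal {U : Opens M} (x y : f.E U) : Sec A U := (f.existsUnique_isFormValue x y).choose

theorem formVal_spec {U : Opens M} (x y : f.E U) : f.IsFormValue x y (f.formVal x y) :=
  (f.existsUnique_isFormValue x y).choose_spec.1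

theorem formVal_eq {U : Opens M} {x y : f.E U} {c : Sec A U} (h : f.IsFormValue x y c) :
    f.formVal x y = c :=
  (f.existsUnique_isFormValue x y).unique (f.formVal_spec x y) h

/-- `φ(x, f(b, ·)) = x(b)`. -/
theorem formVal_ham {U : Opens M} (x : f.E U) (b : Sec A U) :
    f.formVal x ⟨f.ham U b, f.ham_mem U b⟩ = x.1.1 U le_rfl b := by
  have h1 := f.formVal_spec x ⟨f.ham U b, f.ham_mem U b⟩ U le_rfl (Finsupp.single b 1)
    (by rw [hamSum, Finsupp.linearCombination_single, one_smul]; rfl)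
  rw [res_self, evalSum, Finsupp.linearCombination_single, one_smul] at h1
  exact h1

theorem resE_formVal {U V : Opens M} (h : V ≤ U) (x y : f.E U) :
    res A h (f.formVal x y) = f.formVal (f.resE h x) (f.resE h y) := by
  refine (f.formVal_eq fun W hW l hl => ?_).symm
  rw [res_res]
  exact f.formVal_spec x y W (hW.trans h) l hl

theorem evalSum_add {U : Opens M} (x x' : DerSec A U) (l : Sec A U →₀ Sec A U) :
    evalSum (x + x') l = evalSum x l + evalSum x' l := by
  simp only [evalSum, Finsupp.linearCombination_apply, Finsupp.sum, ← Finset.sum_add_distrib]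
  exact Finset.sum_congr rfl fun b _ => by rw [DerSec.add_apply, smul_add]

theorem evalSum_smul {U : Opens M} (a : Sec A U) (x : DerSec A U) (l : Sec A U →₀ Sec A U) :
    evalSum (a • x) l = a * evalSum x l := by
  simp only [evalSum, Finsupp.linearCombination_apply, Finsupp.sum, smul_eq_mul, Finset.mul_sum]
  exact Finset.sum_congr rfl fun b _ => by rw [DerSec.smul_apply, res_self]; ring

theorem formVal_add_left {U : Opens M} (x x' y : f.E U) :
    f.formVal (x + x') y = f.formVal x y + f.formVal x' y :=
  f.formVal_eq fun V h l hl => by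
    rw [map_add, f.formVal_spec x y V h l hl, f.formVal_spec x' y V h l hl, ← evalSum_add]
    rfl

theorem formVal_smul_left {U : Opens M} (a : Sec A U) (x y : f.E U) :
    f.formVal (a • x) y = a * f.formVal x y :=
  f.formVal_eq fun V h l hl => by
    rw [map_mul, f.formVal_spec x y V h l hl, ← evalSum_smul]
    exact congrArg (fun z => evalSum z l) (map_smulₛₗ (DerSec.restrict h) a x.1).symm

theorem formVal_skew {U : Opens M} (x y : f.E U) : f.formVal x y = - f.formVal y x := by
  choose N hN m hp hm using fun p => f.exists_hamSum y p
  choose N' hN' m' hp' hm' using fun p => f.exists_hamSum x p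
  have cov : U ≤ iSup (fun p => N p ⊓ N' p) := fun q hq =>
    Opens.mem_iSup.2 ⟨⟨q, hq⟩, hp ⟨q, hq⟩, hp' ⟨q, hq⟩⟩
  refine sec_ext A (fun p => (inf_le_left : N p ⊓ N' p ≤ N p).trans (hN p)) cov fun p => ?_
  have e : f.hamSum _ (resSum (inf_le_left : N p ⊓ N' p ≤ N p) (m p)) =
      DerSec.restrict ((inf_le_left : N p ⊓ N' p ≤ N p).trans (hN p)) y.1 := by
    rw [hamSum_resSum, hm]; rfl
  have e' : f.hamSum _ (resSum (inf_le_right : N p ⊓ N' p ≤ N' p) (m' p)) =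
      DerSec.restrict ((inf_le_left : N p ⊓ N' p ≤ N p).trans (hN p)) x.1 := by
    rw [hamSum_resSum, hm']; rfl
  rw [map_neg, f.formVal_spec x y _ _ _ e, f.formVal_spec y x _ _ _ e', ← e, ← e', evalSum_hamSum]

/-- The `A`-bilinear form `φ : E × E → A` induced by the bracket,
`φ(∑ᵢ aᵢ f(xᵢ, ·), ∑ⱼ bⱼ f(yⱼ, ·)) = ∑ᵢⱼ aᵢ bⱼ f(xᵢ, yⱼ)`. -/
def form (U : Opens M) : f.E U →ₗ[Sec A U] f.E U →ₗ[Sec A U] Sec A U :=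
  LinearMap.mk₂ (Sec A U) f.formVal f.formVal_add_left f.formVal_smul_left
    (fun x y y' => by
      rw [f.formVal_skew, f.formVal_add_left, f.formVal_skew x y, f.formVal_skew x y', neg_add])
    (fun a x y => by
      rw [f.formVal_skew, f.formVal_smul_left, f.formVal_skew x y, smul_eq_mul, mul_neg])

theorem form_ham_ham (U : Opens M) (a b : Sec A U) :
    f.form U ⟨f.ham U a, f.ham_mem U a⟩ ⟨f.ham U b, f.ham_mem U b⟩ = f.br U a b := by
  refine (f.formVal_ham _ b).trans ?_
  rw [ham_apply, res_self]

theorem res_form {U V : Opens M} (h : V ≤ U) (x y : f.E U) :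
    res A h (f.form U x y) = f.form V (f.resE h x) (f.resE h y) :=
  f.resE_formVal h x y

/-- The bracket is locally free: every point has a neighbourhood `U` on which `E|_U` is isomorphic
to `(A|_U)ⁿ` for some finite `n`, that is, `E|_U` has a basis `e₁, …, eₙ`. -/
def IsLocallyFree : Prop :=
  ∀ p : M, ∃ (U : Opens M) (n : ℕ) (e : Fin n → f.E U), p ∈ U ∧
    ∀ (V : Opens M) (h : V ≤ U),
      Function.Bijective fun c : Fin n → Sec A V => ∑ i, c i • f.resE h (e i)

/-- Sections over `U` of the dual sheaf `E* = Hom_A(E, A)`: morphisms `E|_U → A|_U` of sheaves of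
`A|_U`-modules. -/
@[ext]
structure DualSec (U : Opens M) where
  /-- the component on sections over `V` -/
  toFun : ∀ V : Opens M, V ≤ U → f.E V →ₗ[Sec A V] Sec A V
  res_toFun : ∀ (V W : Opens M) (hV : V ≤ U) (hW : W ≤ V) (x : f.E V),
    res A hW (toFun V hV x) = toFun W (hW.trans hV) (f.resE hW x)

/-- The map `φ : E → E*`, `x ↦ φ(x, ·)`, on sections over `U`. -/
def toDual (U : Opens M) (x : f.E U) : f.DualSec U where
  toFun V hV := f.form V (f.resE hV x)
  res_toFun V W hV hW y := by rw [res_form]; rfl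

/-- The bracket is nonsingular: the morphism of sheaves `E → E*`, `x ↦ φ(x, ·)`, is an
isomorphism. -/
def IsNonsingular : Prop := ∀ U : Opens M, Function.Bijective (f.toDual U)

/-- Sections over `U` of the sheaf `𝒯` of closed `sp(E)`-valued 1-forms. A section of
`sp(E) ⊗ E* = Hom_A(E, sp(E))` (recall that `E` is locally free of finite rank) is written as
`(z, x) ↦ s_z(x)`; its image in `E ⊗ ∧²E*` is `(x, y) ↦ s_x(y) - s_y(x)`, and `d` maps it to the
3-form in `∧³E*` obtained by contracting with `φ` and summing cyclically. -/
structure ClosedSpSec (U : Opens M) where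
  /-- the component on sections over `V` -/
  app : ∀ V : Opens M, V ≤ U → f.E V →ₗ[Sec A V] f.E V →ₗ[Sec A V] f.E V
  res_app : ∀ (V W : Opens M) (hV : V ≤ U) (hW : W ≤ V) (z x : f.E V),
    f.resE hW (app V hV z x) = app W (hW.trans hV) (f.resE hW z) (f.resE hW x)
  symplectic : ∀ (V : Opens M) (hV : V ≤ U) (z x y : f.E V),
    f.form V (app V hV z x) y + f.form V x (app V hV z y) = 0
  closed : ∀ (V : Opens M) (hV : V ≤ U) (x y z : f.E V),
    f.form V (app V hV x y - app V hV y x) z + f.form V (app V hV y z - app V hV z y) x +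
      f.form V (app V hV z x - app V hV x z) y = 0

variable {f} in
theorem ClosedSpSec.ext' {U : Opens M} {s t : f.ClosedSpSec U}
    (h : ∀ V (hV : V ≤ U) x y, s.1 V hV x y = t.1 V hV x y) : s = t := by
  obtain ⟨s, _⟩ := s
  obtain ⟨t, _⟩ := t
  obtain rfl : s = t := funext fun V => funext fun hV => LinearMap.ext₂ (h V hV)
  rfl

instance (U : Opens M) : Zero (f.ClosedSpSec U) :=
  ⟨⟨fun _ _ => 0,
    fun V W hV hW z x => by
      rw [LinearMap.zero_apply, LinearMap.zero_apply, LinearMap.zero_apply, LinearMap.zero_apply,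
        map_zero],
    fun V hV z x y => by
      rw [LinearMap.zero_apply, LinearMap.zero_apply, LinearMap.zero_apply, map_zero, map_zero,
        LinearMap.zero_apply, add_zero],
    fun V hV x y z => by
      simp only [LinearMap.zero_apply, map_zero, sub_zero, add_zero]⟩⟩

instance (U : Opens M) : Add (f.ClosedSpSec U) :=
  ⟨fun s t => ⟨fun V hV => s.1 V hV + t.1 V hV,
    fun V W hV hW z x => by
      rw [LinearMap.add_apply, LinearMap.add_apply, LinearMap.add_apply, LinearMap.add_apply,
        map_add, s.2 V W hV hW, t.2 V W hV hW],
    fun V hV z x y => by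
      have h1 := s.3 V hV z x y
      have h2 := t.3 V hV z x y
      simp only [LinearMap.add_apply, map_add]
      linear_combination h1 + h2,
    fun V hV x y z => by
      have h1 := s.4 V hV x y z
      have h2 := t.4 V hV x y z
      simp only [LinearMap.add_apply, map_add, map_sub, LinearMap.sub_apply] at h1 h2 ⊢
      linear_combination h1 + h2⟩⟩

instance (U : Opens M) : Neg (f.ClosedSpSec U) :=
  ⟨fun s => ⟨fun V hV => - s.1 V hV,
    fun V W hV hW z x => by
      rw [LinearMap.neg_apply, LinearMap.neg_apply, LinearMap.neg_apply, LinearMap.neg_apply,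
        map_neg, s.2 V W hV hW],
    fun V hV z x y => by
      have h1 := s.3 V hV z x y
      simp only [LinearMap.neg_apply, map_neg]
      linear_combination - h1,
    fun V hV x y z => by
      have h1 := s.4 V hV x y z
      simp only [LinearMap.neg_apply, map_neg, map_sub, LinearMap.sub_apply] at h1 ⊢
      linear_combination - h1⟩⟩

instance (U : Opens M) : AddCommGroup (f.ClosedSpSec U) where
  add_assoc s t r := ClosedSpSec.ext' fun V hV x y =>
    add_assoc (s.1 V hV x y) (t.1 V hV x y) (r.1 V hV x y)
  zero_add s := ClosedSpSec.ext' fun V hV x y => zero_add (s.1 V hV x y)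
  add_zero s := ClosedSpSec.ext' fun V hV x y => add_zero (s.1 V hV x y)
  add_comm s t := ClosedSpSec.ext' fun V hV x y => add_comm (s.1 V hV x y) (t.1 V hV x y)
  neg_add_cancel s := ClosedSpSec.ext' fun V hV x y => neg_add_cancel (s.1 V hV x y)
  nsmul := nsmulRec
  zsmul := zsmulRec

/-- Restriction of sections of `𝒯`. -/
def resT {U V : Opens M} (h : V ≤ U) : f.ClosedSpSec U →+ f.ClosedSpSec V where
  toFun s := ⟨fun W hW => s.1 W (hW.trans h),
    fun W W' hW hW' => s.2 W W' (hW.trans h) hW', fun W hW => s.3 W (hW.trans h),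
    fun W hW => s.4 W (hW.trans h)⟩
  map_zero' := rfl
  map_add' _ _ := rfl

/-- The presheaf of abelian groups underlying `𝒯`. -/
def closedSpPresheaf : (Opens M)ᵒᵖ ⥤ AddCommGrpCat.{u} where
  obj U := AddCommGrpCat.of (f.ClosedSpSec U.unop)
  map h := AddCommGrpCat.ofHom (f.resT h.unop.le)
  map_id _ := rfl
  map_comp _ _ := rfl

theorem resE_pair {U V W : Opens M} (h : V ≤ U) (h' : W ≤ V) (x : f.E U × f.E U) :
    ((f.resE h' (f.resE h x.1), f.resE h' (f.resE h x.2)) : f.E W × f.E W) =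
      (f.resE (h'.trans h) x.1, f.resE (h'.trans h) x.2) := rfl

theorem glueBilinearAux {V : Opens M} {ι : Type u} {U : ι → Opens M} (hU : ∀ i, U i ≤ V)
    (hc : V ≤ iSup U) (g : ∀ i W, W ≤ U i → f.E W →ₗ[Sec A W] f.E W →ₗ[Sec A W] f.E W)
    (nat : ∀ i W W' (h : W ≤ U i) (h' : W' ≤ W) x y,
      f.resE h' (g i W h x y) = g i W' (h'.trans h) (f.resE h' x) (f.resE h' y))
    (cpt : ∀ i j W (hi : W ≤ U i) (hj : W ≤ U j) x y, g i W hi x y = g j W hj x y) :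
    ∃ t : ∀ W, W ≤ V → f.E W × f.E W → f.E W,
      (∀ W W' (h : W ≤ V) (h' : W' ≤ W) x,
        f.resE h' (t W h x) = t W' (h'.trans h) (f.resE h' x.1, f.resE h' x.2)) ∧
      ∀ i W (h : W ≤ U i) x, t W (h.trans (hU i)) x = g i W h x.1 x.2 := by
  have := HasGluing.glueHom (X := fun W => f.E W × f.E W) (Y := fun W => f.E W)
    (rX := fun _ _ h x => (f.resE h x.1, f.resE h x.2)) (rY := fun _ _ h => f.resE h)
    (fun _ _ _ h h' x => f.resE_pair h h' x)
    (fun _ _ _ h h' x => f.resE_resE h h' x) f.e_hasGluing hU hc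
    (fun i W h x => g i W h x.1 x.2) (fun i W W' h h' x => nat i W W' h h' x.1 x.2)
    (fun i j W hi hj x => cpt i j W hi hj x.1 x.2)
  exact this

/-- Compatible morphisms `E × E → E`, bilinear on each member of a cover, glue to a bilinear one. -/
theorem glueBilinear {V : Opens M} {ι : Type u} {U : ι → Opens M} (hU : ∀ i, U i ≤ V)
    (hc : V ≤ iSup U) (g : ∀ i W, W ≤ U i → f.E W →ₗ[Sec A W] f.E W →ₗ[Sec A W] f.E W)
    (nat : ∀ i W W' (h : W ≤ U i) (h' : W' ≤ W) x y,
      f.resE h' (g i W h x y) = g i W' (h'.trans h) (f.resE h' x) (f.resE h' y))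
    (cpt : ∀ i j W (hi : W ≤ U i) (hj : W ≤ U j) x y, g i W hi x y = g j W hj x y) :
    ∃ t : ∀ W, W ≤ V → f.E W →ₗ[Sec A W] f.E W →ₗ[Sec A W] f.E W,
      (∀ W W' (h : W ≤ V) (h' : W' ≤ W) x y,
        f.resE h' (t W h x y) = t W' (h'.trans h) (f.resE h' x) (f.resE h' y)) ∧
      ∀ i W (h : W ≤ U i) x y, t W (h.trans (hU i)) x y = g i W h x y := by
  obtain ⟨t, tn, ti⟩ := f.glueBilinearAux hU hc g nat cpt
  have loc : ∀ (W : Opens M) (hW : W ≤ V) (i : ι) (x y : f.E W),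
      f.resE (inf_le_left : W ⊓ U i ≤ W) (t W hW (x, y)) =
        g i (W ⊓ U i) inf_le_right (f.resE inf_le_left x) (f.resE inf_le_left y) :=
    fun W hW i x y => (tn W (W ⊓ U i) hW inf_le_left (x, y)).trans (ti i _ inf_le_right _)
  have ext : ∀ (W : Opens M) (_ : W ≤ V) (a b : f.E W),
      (∀ i, f.resE (inf_le_left : W ⊓ U i ≤ W) a = f.resE inf_le_left b) → a = b :=
    fun W hW a b h => f.e_ext (fun i => inf_le_left) (inf_le_iSup_inf hW hc) h
  refine ⟨fun W hW => LinearMap.mk₂ (Sec A W) (fun x y => t W hW (x, y)) ?_ ?_ ?_ ?_,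
    fun W W' h h' x y => tn W W' h h' (x, y), fun i W h x y => ti i W h (x, y)⟩
  · intro x x' y
    refine ext W hW _ _ fun i => ?_
    rw [map_add, loc, loc, loc, map_add, map_add, LinearMap.add_apply]
  · intro a x y
    refine ext W hW _ _ fun i => ?_
    rw [map_smulₛₗ, loc, loc, map_smulₛₗ, map_smul, LinearMap.smul_apply]
  · intro x y y'
    refine ext W hW _ _ fun i => ?_
    rw [map_add, loc, loc, loc, map_add, map_add]
  · intro a x y
    refine ext W hW _ _ fun i => ?_
    rw [map_smulₛₗ, loc, loc, map_smulₛₗ, map_smul]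

theorem closedSp_hasGluing : HasGluing (fun U => f.ClosedSpSec U) (fun _ _ h => f.resT h) := by
  intro V ι U hU hc s hs
  obtain ⟨T, Tn, Ti⟩ := f.glueBilinear hU hc (fun i W h => (s i).1 W h)
    (fun i => (s i).2)
    (fun i j W hi hj x y =>
      congrArg (fun D : f.ClosedSpSec (U i ⊓ U j) => D.1 W (le_inf hi hj) x y) (hs i j))
  have ext : ∀ (W : Opens M) (_ : W ≤ V) (a b : f.E W),
      (∀ i, f.resE (inf_le_left : W ⊓ U i ≤ W) a = f.resE inf_le_left b) → a = b :=
    fun W hW a b h => f.e_ext (fun i => inf_le_left) (inf_le_iSup_inf hW hc) h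
  have extA : ∀ (W : Opens M) (_ : W ≤ V) (a b : Sec A W),
      (∀ i, res A (inf_le_left : W ⊓ U i ≤ W) a = res A inf_le_left b) → a = b :=
    fun W hW a b h => sec_ext A (fun i => inf_le_left) (inf_le_iSup_inf hW hc) h
  have Tloc : ∀ (W : Opens M) (hW : W ≤ V) (i : ι) (x y : f.E W),
      f.resE (inf_le_left : W ⊓ U i ≤ W) (T W hW x y) =
        (s i).1 (W ⊓ U i) inf_le_right (f.resE inf_le_left x) (f.resE inf_le_left y) :=
    fun W hW i x y => (Tn W (W ⊓ U i) hW inf_le_left x y).trans (Ti i _ inf_le_right _ _)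
  have T2 : ∀ (W : Opens M) (hW : W ≤ V) (z x y : f.E W),
      f.form W (T W hW z x) y + f.form W x (T W hW z y) = 0 := by
    intro W hW z x y
    refine extA W hW _ _ fun i => ?_
    rw [map_add, res_form, res_form, Tloc, Tloc, map_zero]
    exact (s i).3 _ _ _ _ _
  have T3 : ∀ (W : Opens M) (hW : W ≤ V) (x y z : f.E W),
      f.form W (T W hW x y - T W hW y x) z + f.form W (T W hW y z - T W hW z y) x +
        f.form W (T W hW z x - T W hW x z) y = 0 := by
    intro W hW x y z
    refine extA W hW _ _ fun i => ?_
    have e : ∀ x y : f.E W, f.resE (inf_le_left : W ⊓ U i ≤ W) (T W hW x y - T W hW y x) =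
        (s i).1 (W ⊓ U i) inf_le_right (f.resE inf_le_left x) (f.resE inf_le_left y) -
          (s i).1 (W ⊓ U i) inf_le_right (f.resE inf_le_left y) (f.resE inf_le_left x) :=
      fun x y => by rw [map_sub, Tloc, Tloc]
    rw [map_add, map_add, res_form, res_form, res_form, e, e, e, map_zero]
    exact (s i).4 _ _ _ _ _
  refine ⟨⟨T, Tn, T2, T3⟩, fun i => ?_, fun T' hT' => ?_⟩
  · exact ClosedSpSec.ext' fun W hW x y => Ti i W hW x y
  · refine ClosedSpSec.ext' fun W hW x y => ext W hW _ _ fun i => ?_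
    refine (T'.2 W (W ⊓ U i) hW inf_le_left x y).trans (Eq.trans ?_ (Tloc W hW i x y).symm)
    exact congrArg (fun D : f.ClosedSpSec (U i) =>
      D.1 (W ⊓ U i) inf_le_right (f.resE inf_le_left x) (f.resE inf_le_left y)) (hT' i)

/-- The sheaf `𝒯` of closed `sp(E)`-valued 1-forms, as a sheaf of abelian groups. -/
def closedSp : Sheaf (Opens.grothendieckTopology M) AddCommGrpCat.{u} :=
  ⟨f.closedSpPresheaf, by
    refine (TopCat.Presheaf.isSheaf_iff_isSheafUniqueGluing f.closedSpPresheaf).2 ?_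
    intro ι U s hs
    exact f.closedSp_hasGluing (iSup U) ι U (fun i => le_iSup U i) le_rfl s hs⟩

end PoissonBracket

open PowerSeries in
/-- A quantization of the sheaf `A` by the Poisson bracket `f`: a deformation of `A` over `k[[ħ]]`
(an associative unital `k[[ħ]]`-algebra structure on the sheaf of `k[[ħ]]`-modules `A[[ħ]]` which
reduces modulo `ħ` to the multiplication of `A`) whose coefficient of `ħ` is `f`. -/
structure Quantization {A : TopCat.Sheaf (CommAlgCat.{u} k) M} (f : PoissonBracket A) where
  /-- the deformed multiplication on sections over `U` -/
  star : ∀ U : Opens M, (Sec A U)⟦X⟧ →ₗ[k⟦X⟧] (Sec A U)⟦X⟧ →ₗ[k⟦X⟧] (Sec A U)⟦X⟧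
  star_res : ∀ {U V : Opens M} (h : V ≤ U) (a b : (Sec A U)⟦X⟧),
    PowerSeries.map (res A h).toRingHom (star U a b) =
      star V (PowerSeries.map (res A h).toRingHom a) (PowerSeries.map (res A h).toRingHom b)
  star_assoc : ∀ (U : Opens M) (a b c : (Sec A U)⟦X⟧),
    star U (star U a b) c = star U a (star U b c)
  one_star : ∀ (U : Opens M) (a : (Sec A U)⟦X⟧), star U 1 a = a
  star_one : ∀ (U : Opens M) (a : (Sec A U)⟦X⟧), star U a 1 = a
  star_zeroth : ∀ (U : Opens M) (a b : (Sec A U)⟦X⟧),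
    PowerSeries.coeff 0 (star U a b) = PowerSeries.coeff 0 a * PowerSeries.coeff 0 b
  star_first : ∀ (U : Opens M) (a b : Sec A U),
    PowerSeries.coeff 1 (star U (PowerSeries.C a) (PowerSeries.C b)) = f.br U a b

end

end SheafQuantization

/-!
The proof is an algebraic version of Fedosov's construction of deformation quantizations.

Since `f` is locally free and nonsingular, `E` is a symplectic Lie algebroid: its sections form a
Lie algebra acting on functions (`PoissonBracket.lieE`, `PoissonBracket.anchor`), and the form `φ`
is closed (`PoissonBracket.form_closed`).

*The connection.* Over an open set where `E` has a basis there is a connection on `E` preserving `φ`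
(`IsFrame.exists_isConn`). Two of them differ by an `sp(E)`-valued 1-form, and every such form is
closed. Thus symplectic connections, relaxed to `c`-connections with `∇_x (a y) = c x(a) y + a ∇_x y`
for a function `c`, form a sheaf of groups which is an extension of `A` by `𝒯`. As `H¹(M, 𝒯) = 0`,
the global section `c = 1` of `A` lifts (`PoissonBracket.exists_symplectic_connection`). A multiple of
the torsion `φ(τ(x, y), z)`, symmetrized in `y` and `z`, is an `sp(E)`-valued 1-form. Subtracting it
makes the connection torsion-free, because the cyclic sum of the torsion is `dφ = 0`
(`PoissonBracket.exists_torsionFree`).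

*The star product.* Let `R` and `L` be the sections of `A` and `E` over an open set where `E` has a
basis (`SymplecticData`). The symmetric algebra of `L` carries the Moyal product, which makes it the
Weyl algebra of `L`; the connection extends to it by derivations `∇_x`, and the contractions
`δ_x = φ(x, ·)` are derivations as well. On formal series in `X`, with values in the Weyl algebra, one
looks for a connection `X ∇ - δ + X [ρ, ·]` with a linear `ρ` and with vanishing curvature. The Koszul
homotopy for `δ` turns the equation for `ρ` into a fixed point equation whose right-hand side is
divisible by `X`, so that it can be solved coefficient by coefficient (`rho`); by the Bianchi identity
the curvature of the solution is `X` times an operator applied to itself, hence zero (`omega_rho`). In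
the same way every formal series with coefficients in `R` is the series of constant terms of a unique
flat section (`exists_isFlat`, `IsFlat.ext`). Flat sections form an algebra, and this transports an
associative product to `R⟦X⟧` (`flatMul`). The parity automorphism, which changes the signs of `X` and
of `L`, shows that the product preserves even series; with `ħ = X ^ 2` this is the star product
(`SymplecticData.prod`). Its terms of order zero and one are computed from
`a + X h + …`, where `h` is the Hamiltonian vector of `a` (`coeff_one_flat`).

*Gluing.* The linear solution `ρ` and the flat sections are uniquely determined and do not depend on
the basis of `L`. Hence the construction is compatible with restriction (`SymplecticHom.map_prod`),
and the local star products glue (`PoissonBracket.exists_quantization`).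
-/

set_option linter.unusedSectionVars false
namespace SheafQuantization
open Finset.HasAntidiagonal (antidiagonal)

noncomputable section

/-! ### The Moyal product of a family of pairs of commuting derivations -/

section Moyal

variable {R P : Type*} [CommRing R] [CommRing P] [Algebra R P] {ι : Type*} [Fintype ι]
  (u v : ι → Derivation R P P) (q : ℕ → R)

/-- The terms `c_m` of the Moyal product `exp (∑ᵢ uᵢ ⊗ vᵢ)`: the bidifferential operator
`(1/m!) (∑ᵢ uᵢ ⊗ vᵢ)^m` followed by multiplication, where `q m` stands for `1 / (m + 1)`. -/
def moyalCoeff : ℕ → P →ₗ[R] P →ₗ[R] P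
  | 0 => LinearMap.mul R P
  | m + 1 => q m • ∑ i, (moyalCoeff m).compl₁₂ (u i : P →ₗ[R] P) (v i : P →ₗ[R] P)

@[simp]
theorem moyalCoeff_zero (a b : P) : moyalCoeff u v q 0 a b = a * b := rfl

theorem moyalCoeff_succ (m : ℕ) (a b : P) :
    moyalCoeff u v q (m + 1) a b = q m • ∑ i, moyalCoeff u v q m (u i a) (v i b) := by
  simp [moyalCoeff, LinearMap.sum_apply]

theorem succ_smul_moyalCoeff (hq : ∀ m : ℕ, ((m : R) + 1) * q m = 1) (m : ℕ) (a b : P) :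
    ((m : R) + 1) • moyalCoeff u v q (m + 1) a b =
      ∑ i, moyalCoeff u v q m (u i a) (v i b) := by
  rw [moyalCoeff_succ, smul_smul, hq, one_smul]

/-- A derivation commuting with all `uᵢ` and `vᵢ` is a derivation of each term of the Moyal
product. -/
theorem moyalCoeff_derivation (d : Derivation R P P) (hu : ∀ i a, d (u i a) = u i (d a))
    (hv : ∀ i a, d (v i a) = v i (d a)) (m : ℕ) (a b : P) :
    d (moyalCoeff u v q m a b) = moyalCoeff u v q m (d a) b + moyalCoeff u v q m a (d b) := by
  induction m generalizing a b with
  | zero =>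
    simp only [moyalCoeff_zero, Derivation.leibniz, smul_eq_mul]
    ring
  | succ m ih =>
    simp only [moyalCoeff_succ, Derivation.map_smul, map_sum, ih, Finset.sum_add_distrib, smul_add,
      hu, hv]

theorem sum_antidiagonal_succ_smul (F : ℕ → ℕ → P) (m : ℕ) :
    ((m : R) + 1) • ∑ x ∈ antidiagonal (m + 1), F x.1 x.2 =
      (∑ x ∈ antidiagonal m, ((x.1 : R) + 1) • F (x.1 + 1) x.2) +
        ∑ x ∈ antidiagonal m, ((x.2 : R) + 1) • F x.1 (x.2 + 1) := by
  have h : ((m : R) + 1) • ∑ x ∈ antidiagonal (m + 1), F x.1 x.2 =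
      (∑ x ∈ antidiagonal (m + 1), (x.1 : R) • F x.1 x.2) +
        ∑ x ∈ antidiagonal (m + 1), (x.2 : R) • F x.1 x.2 := by
    rw [Finset.smul_sum, ← Finset.sum_add_distrib]
    refine Finset.sum_congr rfl fun x hx => ?_
    rw [← add_smul]
    congr 1
    have := Finset.HasAntidiagonal.mem_antidiagonal.1 hx
    exact_mod_cast congrArg (Nat.cast : ℕ → R) this.symm
  rw [h]
  congr 1
  · rw [Finset.Nat.antidiagonal_succ, Finset.sum_cons, Finset.sum_map]
    simp
  · rw [Finset.Nat.antidiagonal_succ', Finset.sum_cons, Finset.sum_map]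
    simp

/-- Homogeneous form of the associativity of the Moyal product. Both sides, as functions of `m`,
satisfy the recursion `(m + 1) S (m + 1) = (∑ᵢ uᵢ ⊗ vᵢ ⊗ 1 + uᵢ ⊗ 1 ⊗ vᵢ + 1 ⊗ uᵢ ⊗ vᵢ) S m`. -/
theorem moyalCoeff_assoc (hq : ∀ m : ℕ, ((m : R) + 1) * q m = 1)
    (huu : ∀ i j a, u i (u j a) = u j (u i a)) (huv : ∀ i j a, u i (v j a) = v j (u i a))
    (hvv : ∀ i j a, v i (v j a) = v j (v i a)) (m : ℕ) (a b c : P) :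
    ∑ x ∈ antidiagonal m,
        moyalCoeff u v q x.1 (moyalCoeff u v q x.2 a b) c =
      ∑ x ∈ antidiagonal m,
        moyalCoeff u v q x.1 a (moyalCoeff u v q x.2 b c) := by
  induction m generalizing a b c with
  | zero => simp [mul_assoc]
  | succ m ih =>
    have hinj : ∀ x y : P, ((m : R) + 1) • x = ((m : R) + 1) • y → x = y := by
      intro x y h
      have := congrArg (q m • ·) h
      simpa only [smul_smul, mul_comm (q m), hq, one_smul] using this
    have hu : ∀ i m a b, u i (moyalCoeff u v q m a b) =
        moyalCoeff u v q m (u i a) b + moyalCoeff u v q m a (u i b) := fun i m a b =>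
      moyalCoeff_derivation u v q (u i) (fun j a => huu i j a) (fun j a => huv i j a) m a b
    have hv : ∀ i m a b, v i (moyalCoeff u v q m a b) =
        moyalCoeff u v q m (v i a) b + moyalCoeff u v q m a (v i b) := fun i m a b =>
      moyalCoeff_derivation u v q (v i) (fun j a => (huv j i a).symm) (fun j a => hvv i j a) m a b
    apply hinj
    rw [sum_antidiagonal_succ_smul
        (fun k l => moyalCoeff u v q k (moyalCoeff u v q l a b) c),
      sum_antidiagonal_succ_smul
        (fun k l => moyalCoeff u v q k a (moyalCoeff u v q l b c))]
    have e1 : ∀ k l : ℕ, ((l : R) + 1) •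
        moyalCoeff u v q k (moyalCoeff u v q (l + 1) a b) c =
        ∑ i, moyalCoeff u v q k (moyalCoeff u v q l (u i a) (v i b)) c := fun k l => by
      rw [← LinearMap.smul_apply, ← map_smul, succ_smul_moyalCoeff u v q hq, map_sum,
        LinearMap.sum_apply]
    have e2 : ∀ k l : ℕ, ((l : R) + 1) •
        moyalCoeff u v q k a (moyalCoeff u v q (l + 1) b c) =
        ∑ i, moyalCoeff u v q k a (moyalCoeff u v q l (u i b) (v i c)) := fun k l => by
      rw [← map_smul, succ_smul_moyalCoeff u v q hq, map_sum]
    simp only [e1, e2, succ_smul_moyalCoeff u v q hq, hu, hv, map_add, LinearMap.add_apply]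
    rw [Finset.sum_comm, Finset.sum_comm (s := antidiagonal m) (t := Finset.univ),
      Finset.sum_comm (s := antidiagonal m) (t := Finset.univ),
      Finset.sum_comm (s := antidiagonal m) (t := Finset.univ)]
    simp only [Finset.sum_add_distrib, ih]
    abel

/-- `a` is killed by any product of `N` of the derivations `uᵢ`, `vᵢ`. -/
def IsKilled : ℕ → P → Prop
  | 0, a => a = 0
  | N + 1, a => ∀ i, IsKilled N (u i a) ∧ IsKilled N (v i a)

variable {u v}

theorem IsKilled.zero (N : ℕ) : IsKilled u v N (0 : P) := by
  induction N with
  | zero => rfl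
  | succ N ih => intro i; simpa using ih

theorem IsKilled.add {N : ℕ} {a b : P} (ha : IsKilled u v N a) (hb : IsKilled u v N b) :
    IsKilled u v N (a + b) := by
  induction N generalizing a b with
  | zero => simp_all [IsKilled]
  | succ N ih =>
    intro i
    rw [map_add, map_add]
    exact ⟨ih (ha i).1 (hb i).1, ih (ha i).2 (hb i).2⟩

theorem IsKilled.smul {N : ℕ} {a : P} (r : R) (ha : IsKilled u v N a) :
    IsKilled u v N (r • a) := by
  induction N generalizing a with
  | zero => simp_all [IsKilled]
  | succ N ih =>
    intro i
    rw [Derivation.map_smul, Derivation.map_smul]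
    exact ⟨ih (ha i).1, ih (ha i).2⟩

theorem IsKilled.succ {N : ℕ} {a : P} (ha : IsKilled u v N a) : IsKilled u v (N + 1) a := by
  induction N generalizing a with
  | zero => rw [show a = 0 from ha]; exact .zero _
  | succ N ih => exact fun i => ⟨ih (ha i).1, ih (ha i).2⟩

theorem IsKilled.mono {N N' : ℕ} (h : N ≤ N') {a : P} (ha : IsKilled u v N a) :
    IsKilled u v N' a := by
  induction h with
  | refl => exact ha
  | step _ ih => exact ih.succ

/-- A factor with constant derivatives raises the order by at most one. -/
theorem IsKilled.mul {x : P} (hu : ∀ i, ∃ r : R, u i x = algebraMap R P r)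
    (hv : ∀ i, ∃ r : R, v i x = algebraMap R P r) {N : ℕ} {a : P} (ha : IsKilled u v N a) :
    IsKilled u v (N + 1) (a * x) := by
  induction N generalizing a with
  | zero => rw [show a = 0 from ha, zero_mul]; exact .zero _
  | succ N ih =>
    intro i
    obtain ⟨r, hr⟩ := hu i
    obtain ⟨t, ht⟩ := hv i
    constructor
    · rw [Derivation.leibniz, hr, smul_eq_mul, ← Algebra.commutes, ← Algebra.smul_def, smul_eq_mul,
        mul_comm x]
      exact (ha.smul r).add (ih (ha i).1)
    · rw [Derivation.leibniz, ht, smul_eq_mul, ← Algebra.commutes, ← Algebra.smul_def, smul_eq_mul,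
        mul_comm x]
      exact (ha.smul t).add (ih (ha i).2)

theorem IsKilled.moyalCoeff_left {N : ℕ} {a : P} (ha : IsKilled u v N a) {m : ℕ} (hm : N ≤ m)
    (b : P) : moyalCoeff u v q m a b = 0 := by
  induction N generalizing a b m with
  | zero => rw [show a = 0 from ha, map_zero, LinearMap.zero_apply]
  | succ N ih =>
    obtain ⟨m, rfl⟩ := Nat.exists_eq_add_of_le' (show 1 ≤ m by omega)
    rw [moyalCoeff_succ, Finset.sum_eq_zero fun i _ => ih (ha i).1 (by omega) _, smul_zero]

theorem IsKilled.moyalCoeff_right {N : ℕ} {b : P} (hb : IsKilled u v N b) {m : ℕ} (hm : N ≤ m)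
    (a : P) : moyalCoeff u v q m a b = 0 := by
  induction N generalizing a b m with
  | zero => rw [show b = 0 from hb, map_zero]
  | succ N ih =>
    obtain ⟨m, rfl⟩ := Nat.exists_eq_add_of_le' (show 1 ≤ m by omega)
    rw [moyalCoeff_succ, Finset.sum_eq_zero fun i _ => ih (hb i).2 (by omega) _, smul_zero]

variable (u v) (hk : ∀ a : P, ∃ N, IsKilled u v N a)

/-- The Moyal product `∑ₘ c_m(a, b)`; the sum is finite because every `a` is killed by all long
enough products of the derivations. -/
def moyal (a b : P) : P := ∑ m ∈ Finset.range (hk a).choose, moyalCoeff u v q m a b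

theorem moyal_eq {a : P} {N : ℕ} (ha : IsKilled u v N a) (b : P) :
    moyal u v q hk a b = ∑ m ∈ Finset.range N, moyalCoeff u v q m a b := by
  have key : ∀ N N' : ℕ, N ≤ N' → IsKilled u v N a →
      ∑ m ∈ Finset.range N, moyalCoeff u v q m a b =
        ∑ m ∈ Finset.range N', moyalCoeff u v q m a b := by
    intro N N' h ha
    refine Finset.sum_subset (by simpa using h) fun m _ hm => ha.moyalCoeff_left q ?_ b
    simpa using hm
  have h0 := (hk a).choose_spec
  rcases le_total N (hk a).choose with h | h
  · exact (key _ _ h ha).symm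
  · exact key _ _ h h0

theorem moyal_add_left (a a' b : P) :
    moyal u v q hk (a + a') b = moyal u v q hk a b + moyal u v q hk a' b := by
  obtain ⟨N, hN⟩ := hk a
  obtain ⟨N', hN'⟩ := hk a'
  have h := hN.mono (le_max_left N N')
  have h' := hN'.mono (le_max_right N N')
  rw [moyal_eq u v q hk h, moyal_eq u v q hk h', moyal_eq u v q hk (h.add h'),
    ← Finset.sum_add_distrib]
  simp

theorem moyal_add_right (a b b' : P) :
    moyal u v q hk a (b + b') = moyal u v q hk a b + moyal u v q hk a b' := by
  simp [moyal, Finset.sum_add_distrib]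

theorem moyal_smul_right (r : R) (a b : P) :
    moyal u v q hk a (r • b) = r • moyal u v q hk a b := by
  simp [moyal, Finset.smul_sum]

theorem moyal_smul_left (r : R) (a b : P) :
    moyal u v q hk (r • a) b = r • moyal u v q hk a b := by
  obtain ⟨N, hN⟩ := hk a
  rw [moyal_eq u v q hk hN, moyal_eq u v q hk (hN.smul r)]
  simp [Finset.smul_sum]

theorem moyal_one_left (b : P) : moyal u v q hk 1 b = b := by
  rw [moyal_eq u v q hk (N := 1) (fun i => by simp [IsKilled])]
  simp

theorem moyal_one_right (a : P) : moyal u v q hk a 1 = a := by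
  obtain ⟨N, hN⟩ := hk a
  have h1 : IsKilled u v 1 (1 : P) := fun i => by simp [IsKilled]
  rw [moyal_eq u v q hk hN.succ, Finset.sum_range_succ', Finset.sum_eq_zero fun m _ =>
    h1.moyalCoeff_right q (Nat.le_add_left 1 m) a]
  simp

theorem moyal_assoc (hq : ∀ m : ℕ, ((m : R) + 1) * q m = 1)
    (huu : ∀ i j a, u i (u j a) = u j (u i a)) (huv : ∀ i j a, u i (v j a) = v j (u i a))
    (hvv : ∀ i j a, v i (v j a) = v j (v i a)) (a b c : P) :
    moyal u v q hk (moyal u v q hk a b) c = moyal u v q hk a (moyal u v q hk b c) := by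
  obtain ⟨Na, ha⟩ := hk a
  obtain ⟨Nb, hb⟩ := hk b
  obtain ⟨Nc, hc⟩ := hk c
  obtain ⟨Nab, hab⟩ := hk (moyal u v q hk a b)
  set N := max (max Na Nb) (max Nc Nab) with hN
  have hle : Na ≤ N ∧ Nb ≤ N ∧ Nc ≤ N ∧ Nab ≤ N := by omega
  -- Both sides are sums over a square, and only the part with `x.1 + x.2 < 2 * N` contributes.
  have sq : ∀ F : ℕ → ℕ → P, (∀ k l, N ≤ k → F k l = 0) → (∀ k l, N ≤ l → F k l = 0) →
      ∑ k ∈ Finset.range N, ∑ l ∈ Finset.range N, F k l =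
        ∑ m ∈ Finset.range (2 * N), ∑ x ∈ antidiagonal m, F x.1 x.2 := by
    intro F h1 h2
    rw [← Finset.sum_product', ← Finset.sum_fiberwise_of_maps_to (g := fun x : ℕ × ℕ => x.1 + x.2)
      (t := Finset.range (2 * N)) (fun x hx => by
        simp only [Finset.mem_product, Finset.mem_range] at hx ⊢; omega)]
    refine Finset.sum_congr rfl fun m _ => Finset.sum_subset (fun x hx => ?_) fun x hx hx' => ?_
    · exact Finset.HasAntidiagonal.mem_antidiagonal.2 (Finset.mem_filter.1 hx).2
    · have := Finset.HasAntidiagonal.mem_antidiagonal.1 hx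
      simp only [Finset.mem_filter, Finset.mem_product, Finset.mem_range, this, and_true] at hx'
      rcases le_or_gt N x.1 with h | h
      · exact h1 _ _ h
      · exact h2 _ _ (by omega)
  have haN := ha.mono hle.1
  have hbN := hb.mono hle.2.1
  have hcN := hc.mono hle.2.2.1
  have el : moyal u v q hk (moyal u v q hk a b) c = ∑ k ∈ Finset.range N, ∑ l ∈ Finset.range N,
      moyalCoeff u v q k (moyalCoeff u v q l a b) c := by
    rw [moyal_eq u v q hk (hab.mono hle.2.2.2), moyal_eq u v q hk haN]
    simp only [map_sum, LinearMap.sum_apply]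
  have er : moyal u v q hk a (moyal u v q hk b c) = ∑ k ∈ Finset.range N, ∑ l ∈ Finset.range N,
      moyalCoeff u v q k a (moyalCoeff u v q l b c) := by
    rw [moyal_eq u v q hk haN, moyal_eq u v q hk hbN]
    simp only [map_sum]
  rw [el, er, sq _ (fun k l h => hcN.moyalCoeff_right q h _)
      (fun k l h => by rw [haN.moyalCoeff_left q h, map_zero, LinearMap.zero_apply]),
    sq _ (fun k l h => haN.moyalCoeff_left q h _)
      (fun k l h => by rw [hbN.moyalCoeff_left q h, map_zero])]
  exact Finset.sum_congr rfl fun m _ => moyalCoeff_assoc u v q hq huu huv hvv m a b c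

end Moyal
end
end SheafQuantization

namespace SheafQuantization
noncomputable section

/-! ### Symplectic Lie–Rinehart algebras with a torsion-free symplectic connection -/

/-- A Lie–Rinehart algebra `L` over `R`, free of finite rank as a module, with a symplectic form
and a torsion-free symplectic connection. Freeness and nondegeneracy are recorded together by two
families `e`, `e'` dual to each other under the form. As the connection is torsion-free, the Lie
bracket is not a separate datum: it is `[x, y] = ∇_x y - ∇_y x`. -/
structure SymplecticData (k R L : Type*) [Field k] [CommRing R] [Algebra k R] [AddCommGroup L]
    [Module R L] where
  /-- the rank -/
  n : ℕ
  /-- the basis -/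
  e : Fin n → L
  /-- the dual basis -/
  e' : Fin n → L
  /-- the symplectic form -/
  form : L →ₗ[R] L →ₗ[R] R
  form_skew : ∀ x y, form x y = - form y x
  form_e_e' : ∀ i j, form (e i) (e' j) = if i = j then 1 else 0
  sum_form : ∀ x, ∑ i, form x (e' i) • e i = x
  /-- the action of `L` on `R` by derivations -/
  anchor : L →ₗ[R] Derivation k R R
  /-- the connection -/
  conn : L → L → L
  conn_add_left : ∀ x x' y, conn (x + x') y = conn x y + conn x' y
  conn_smul_left : ∀ (a : R) x y, conn (a • x) y = a • conn x y
  conn_add_right : ∀ x y y', conn x (y + y') = conn x y + conn x y'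
  conn_leibniz : ∀ (a : R) x y, conn x (a • y) = anchor x a • y + a • conn x y
  conn_form : ∀ x y z, anchor x (form y z) = form (conn x y) z + form y (conn x z)
  anchor_bracket : ∀ x y a, anchor x (anchor y a) - anchor y (anchor x a) =
    anchor (conn x y - conn y x) a
  jacobi : ∀ x y z,
    (conn (conn x y - conn y x) z - conn z (conn x y - conn y x)) +
    (conn (conn y z - conn z y) x - conn x (conn y z - conn z y)) +
    (conn (conn z x - conn x z) y - conn y (conn z x - conn x z)) = 0

variable (k R : Type*) [Field k] [CommRing R] [Algebra k R] in
/-- The scalar `1 / (m + 1)` as an element of a `k`-algebra. -/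
def invSucc (m : ℕ) : R := algebraMap k R ((m : k) + 1)⁻¹

theorem succ_mul_invSucc (k R : Type*) [Field k] [CharZero k] [CommRing R] [Algebra k R] (m : ℕ) :
    ((m : R) + 1) * invSucc k R m = 1 := by
  have h : ((m : k) + 1) ≠ 0 := by exact_mod_cast Nat.succ_ne_zero m
  have h1 : ((m : R) + 1) = algebraMap k R ((m : k) + 1) := by simp
  rw [invSucc, h1, ← map_mul, mul_inv_cancel₀ h, map_one]

namespace SymplecticData

variable {k R L : Type*} [Field k] [CommRing R] [Algebra k R] [AddCommGroup L] [Module R L]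
  (D : SymplecticData k R L)

/-- The Lie bracket of `L`. -/
def br (x y : L) : L := D.conn x y - D.conn y x

theorem conn_zero_left (y : L) : D.conn 0 y = 0 := by
  simpa using D.conn_smul_left 0 0 y

theorem conn_zero_right (x : L) : D.conn x 0 = 0 := by
  simpa using D.conn_add_right x 0 0

theorem conn_neg_left (x y : L) : D.conn (-x) y = - D.conn x y := by
  simpa using D.conn_smul_left (-1) x y

theorem conn_neg_right (x y : L) : D.conn x (-y) = - D.conn x y := by
  have := D.conn_add_right x y (-y)
  rw [add_neg_cancel, conn_zero_right] at this
  exact (neg_eq_of_add_eq_zero_right this.symm).symm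

theorem conn_sub_left (x x' y : L) : D.conn (x - x') y = D.conn x y - D.conn x' y := by
  rw [sub_eq_add_neg, conn_add_left, conn_neg_left, sub_eq_add_neg]

theorem conn_sub_right (x y y' : L) : D.conn x (y - y') = D.conn x y - D.conn x y' := by
  rw [sub_eq_add_neg, conn_add_right, conn_neg_right, sub_eq_add_neg]

theorem conn_sum_right {ι : Type*} (s : Finset ι) (x : L) (y : ι → L) :
    D.conn x (∑ i ∈ s, y i) = ∑ i ∈ s, D.conn x (y i) :=
  map_sum (⟨⟨D.conn x, D.conn_zero_right x⟩, D.conn_add_right x⟩ : L →+ L) y s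

theorem sum_form' (x : L) : ∑ i, D.form (D.e i) x • D.e' i = x := by
  have h : ∀ y, (∀ i, D.form (D.e i) y = 0) → y = 0 := by
    intro y hy
    have hy' : ∀ z, D.form z y = 0 := by
      intro z
      rw [← D.sum_form z, map_sum, LinearMap.sum_apply]
      refine Finset.sum_eq_zero fun i _ => ?_
      rw [map_smul, LinearMap.smul_apply, hy, smul_zero]
    rw [← D.sum_form y]
    refine Finset.sum_eq_zero fun i _ => ?_
    rw [D.form_skew, hy', neg_zero, zero_smul]
  rw [← sub_eq_zero]
  refine h _ fun j => ?_
  rw [map_sub, map_sum]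
  simp [D.form_e_e']

/-- The canonical element `∑ᵢ eᵢ ⊗ e'ᵢ` of `L ⊗ L` may be computed with any family and its dual
generating `L`. -/
theorem sum_canonical {M : Type*} [AddCommGroup M] [Module R M] (B : L →ₗ[R] L →ₗ[R] M)
    {ι : Type*} [Fintype ι] (a a' : ι → L) (h : ∀ x, ∑ i, D.form x (a' i) • a i = x) :
    ∑ i, B (a i) (a' i) = ∑ i, B (D.e i) (D.e' i) := by
  have : ∀ i, B (D.e i) (D.e' i) = ∑ j, B (a j) (D.form (D.e i) (a' j) • D.e' i) := by
    intro i
    conv_lhs => rw [← h (D.e i)]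
    simp [LinearMap.sum_apply]
  rw [Finset.sum_congr rfl fun i _ => this i, Finset.sum_comm]
  refine Finset.sum_congr rfl fun j _ => ?_
  rw [← map_sum, D.sum_form']

/-- The canonical element is parallel, because the connection preserves the form. -/
theorem sum_canonical_conn {M : Type*} [AddCommGroup M] [Module R M] (B : L →ₗ[R] L →ₗ[R] M)
    (x : L) :
    ∑ i, (B (D.conn x (D.e i)) (D.e' i) + B (D.e i) (D.conn x (D.e' i))) = 0 := by
  have h1 : ∀ i, B (D.conn x (D.e i)) (D.e' i) =
      ∑ j, D.form (D.conn x (D.e i)) (D.e' j) • B (D.e j) (D.e' i) := by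
    intro i
    conv_lhs => rw [← D.sum_form (D.conn x (D.e i))]
    simp [LinearMap.sum_apply]
  have h2 : ∀ i, B (D.e i) (D.conn x (D.e' i)) =
      ∑ j, D.form (D.e j) (D.conn x (D.e' i)) • B (D.e i) (D.e' j) := by
    intro i
    conv_lhs => rw [← D.sum_form' (D.conn x (D.e' i))]
    simp
  rw [Finset.sum_add_distrib, Finset.sum_congr rfl fun i _ => h1 i,
    Finset.sum_congr rfl fun i _ => h2 i, Finset.sum_comm, ← Finset.sum_add_distrib]
  refine Finset.sum_eq_zero fun i _ => ?_
  rw [← Finset.sum_add_distrib]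
  refine Finset.sum_eq_zero fun j _ => ?_
  rw [← add_smul, ← D.conn_form, D.form_e_e']
  split_ifs <;> simp

/-- The algebra of polynomials on the basis `e`, that is, the symmetric algebra of `L`. -/
abbrev Poly : Type _ := MvPolynomial (Fin D.n) R

/-- The inclusion of `L` into its symmetric algebra. -/
def incl : L →ₗ[R] D.Poly :=
  ∑ i, (LinearMap.toSpanSingleton R D.Poly (MvPolynomial.X i)).comp (D.form.flip (D.e' i))

theorem incl_apply (x : L) : D.incl x = ∑ i, D.form x (D.e' i) • (MvPolynomial.X i : D.Poly) := by
  simp [incl, LinearMap.sum_apply]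

theorem incl_e (i : Fin D.n) : D.incl (D.e i) = MvPolynomial.X i := by
  simp [incl_apply, D.form_e_e']

/-- The derivation `δ_x` of the symmetric algebra with `δ_x y = form x y`, for `x` and `y` in `L`. -/
def delta : L →ₗ[R] Derivation R D.Poly D.Poly where
  toFun x := MvPolynomial.mkDerivation R fun i => MvPolynomial.C (D.form x (D.e i))
  map_add' x y := MvPolynomial.derivation_ext fun i => by
    simp
  map_smul' r x := MvPolynomial.derivation_ext fun i => by
    simp [MvPolynomial.smul_eq_C_mul]

theorem delta_X (x : L) (i : Fin D.n) :
    D.delta x (MvPolynomial.X i) = MvPolynomial.C (D.form x (D.e i)) := by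
  simp [delta]

theorem delta_C (x : L) (r : R) : D.delta x (MvPolynomial.C r) = 0 :=
  MvPolynomial.derivation_C _ _

theorem delta_incl (x y : L) : D.delta x (D.incl y) = MvPolynomial.C (D.form x y) := by
  rw [incl_apply, map_sum]
  conv_rhs => rw [← D.sum_form y, map_sum, map_sum]
  refine Finset.sum_congr rfl fun i _ => ?_
  rw [Derivation.map_smul, delta_X, MvPolynomial.smul_eq_C_mul, ← map_mul, map_smul, smul_eq_mul]

theorem delta_comm (x y : L) (p : D.Poly) :
    D.delta x (D.delta y p) = D.delta y (D.delta x p) := by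
  have : ⁅D.delta x, D.delta y⁆ = 0 := MvPolynomial.derivation_ext fun i => by
    rw [Derivation.commutator_apply, delta_X, delta_X, delta_C, delta_C, sub_zero,
      Derivation.zero_apply]
  have h := DFunLike.congr_fun this p
  rw [Derivation.commutator_apply, Derivation.zero_apply, sub_eq_zero] at h
  exact h

/-- `δ_x p` as a function of `x`. -/
def deltaAt (p : D.Poly) : L →ₗ[R] D.Poly where
  toFun x := D.delta x p
  map_add' x y := by simp
  map_smul' r x := by simp

/-- Additive operators on polynomials agree if they agree on constants and are compatible with
multiplication by variables. -/
theorem poly_induction {motive : D.Poly → Prop} (hC : ∀ r, motive (MvPolynomial.C r))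
    (hadd : ∀ p q, motive p → motive q → motive (p + q))
    (hmul : ∀ p x, motive p → motive (p * D.incl x)) (p : D.Poly) : motive p := by
  refine MvPolynomial.induction_on p hC hadd fun p i hp => ?_
  rw [← D.incl_e]
  exact hmul p _ hp

theorem isKilled (p : D.Poly) :
    ∃ N, IsKilled (fun i => D.delta (D.e i)) (fun i => D.delta (D.e' i)) N p := by
  induction p using D.poly_induction with
  | hC r => exact ⟨1, fun i => by simp [IsKilled]⟩
  | hadd p q hp hq =>
    obtain ⟨N, hN⟩ := hp
    obtain ⟨N', hN'⟩ := hq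
    exact ⟨_, (hN.mono (le_max_left N N')).add (hN'.mono (le_max_right N N'))⟩
  | hmul p x hp =>
    obtain ⟨N, hN⟩ := hp
    exact ⟨N + 1, hN.mul (fun i => ⟨_, D.delta_incl _ _⟩) (fun i => ⟨_, D.delta_incl _ _⟩)⟩

/-! ### The covariant derivative on the symmetric algebra -/

/-- The ring homomorphism `p ↦ p + ε ∇_x p` into the dual numbers over the symmetric algebra. -/
def nablaHom (x : L) : D.Poly →+* TrivSqZeroExt D.Poly D.Poly :=
  MvPolynomial.eval₂Hom
    { toFun := fun r => TrivSqZeroExt.inl (MvPolynomial.C r) +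
        TrivSqZeroExt.inr (MvPolynomial.C (D.anchor x r))
      map_one' := by ext <;> simp
      map_zero' := by ext <;> simp
      map_add' := fun r t => by ext <;> simp
      map_mul' := fun r t => by ext <;> simp [mul_comm] }
    (fun i => TrivSqZeroExt.inl (MvPolynomial.X i) +
      TrivSqZeroExt.inr (D.incl (D.conn x (D.e i))))

theorem fst_nablaHom (x : L) (p : D.Poly) : (D.nablaHom x p).fst = p := by
  have : (TrivSqZeroExt.fstHom D.Poly D.Poly D.Poly : _ →+* D.Poly).comp (D.nablaHom x) =
      RingHom.id _ := by
    refine MvPolynomial.ringHom_ext (fun r => ?_) fun i => ?_ <;> simp [nablaHom]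
  exact RingHom.congr_fun this p

/-- The covariant derivative `∇_x` on the symmetric algebra of `L`. -/
def nabla (x : L) : D.Poly →+ D.Poly where
  toFun p := (D.nablaHom x p).snd
  map_zero' := by simp
  map_add' p q := by simp

theorem nabla_mul (x : L) (p q : D.Poly) :
    D.nabla x (p * q) = D.nabla x p * q + p * D.nabla x q := by
  change (D.nablaHom x (p * q)).snd = _
  rw [map_mul, TrivSqZeroExt.snd_mul, fst_nablaHom, fst_nablaHom, add_comm]
  simp [nabla, mul_comm]

theorem nabla_C (x : L) (r : R) : D.nabla x (MvPolynomial.C r) = MvPolynomial.C (D.anchor x r) := by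
  simp [nabla, nablaHom]

theorem nabla_smul (x : L) (r : R) (p : D.Poly) :
    D.nabla x (r • p) = D.anchor x r • p + r • D.nabla x p := by
  rw [MvPolynomial.smul_eq_C_mul, nabla_mul, nabla_C, MvPolynomial.smul_eq_C_mul,
    MvPolynomial.smul_eq_C_mul]

theorem nabla_incl (x y : L) : D.nabla x (D.incl y) = D.incl (D.conn x y) := by
  have hX : ∀ i, D.nabla x (MvPolynomial.X i) = D.incl (D.conn x (D.e i)) := fun i => by
    simp [nabla, nablaHom]
  conv_rhs => rw [← D.sum_form y, conn_sum_right]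
  rw [incl_apply]
  simp only [map_sum, nabla_smul, hX, conn_leibniz, map_add, map_smul, incl_e]

theorem nabla_add_left (x y : L) (p : D.Poly) :
    D.nabla (x + y) p = D.nabla x p + D.nabla y p := by
  induction p using D.poly_induction with
  | hC r => simp [nabla_C]
  | hadd p q hp hq => rw [map_add, map_add, map_add, hp, hq]; abel
  | hmul p z hp => 
    simp only [nabla_mul, nabla_incl, conn_add_left, map_add, hp]
    ring

theorem nabla_smul_left (r : R) (x : L) (p : D.Poly) :
    D.nabla (r • x) p = r • D.nabla x p := by
  induction p using D.poly_induction with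
  | hC r => simp [nabla_C, MvPolynomial.smul_eq_C_mul]
  | hadd p q hp hq => rw [map_add, map_add, hp, hq, smul_add]
  | hmul p z hp => 
    simp only [nabla_mul, nabla_incl, conn_smul_left, map_smul, hp, smul_add, smul_mul_assoc,
      mul_smul_comm]

theorem nabla_delta (x y : L) (p : D.Poly) :
    D.nabla x (D.delta y p) = D.delta y (D.nabla x p) + D.delta (D.conn x y) p := by
  induction p using D.poly_induction with
  | hC r => simp [nabla_C]
  | hadd p q hp hq => simp only [map_add, hp, hq]; abel
  | hmul p z hp =>
    simp only [nabla_mul, nabla_incl, delta_incl, map_add, hp, Derivation.leibniz, smul_eq_mul,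
      nabla_C, D.conn_form]
    ring

/-! ### The Euler operator and the homotopy operators -/

/-- The Euler operator of the symmetric algebra. -/
def euler : Derivation R D.Poly D.Poly := MvPolynomial.mkDerivation R MvPolynomial.X

theorem euler_incl (x : L) : D.euler (D.incl x) = D.incl x := by
  simp [incl_apply, euler]

theorem derivation_sum_apply {ι : Type*} (s : Finset ι)
    (d : ι → Derivation R D.Poly D.Poly) (p : D.Poly) : (∑ i ∈ s, d i) p = ∑ i ∈ s, d i p :=
  map_sum (⟨⟨fun d => d p, rfl⟩, fun _ _ => rfl⟩ : Derivation R D.Poly D.Poly →+ D.Poly) d s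

theorem sum_incl_mul_delta (p : D.Poly) :
    ∑ i, D.incl (D.e' i) * D.delta (D.e i) p = D.euler p := by
  have : ∑ i, D.incl (D.e' i) • D.delta (D.e i) = D.euler :=
    MvPolynomial.derivation_ext fun j => by
      rw [← D.incl_e, euler_incl, derivation_sum_apply]
      conv_rhs => rw [← D.sum_form' (D.e j), map_sum]
      refine Finset.sum_congr rfl fun i _ => ?_
      rw [Derivation.smul_apply, delta_incl, map_smul, MvPolynomial.smul_eq_C_mul, smul_eq_mul,
        mul_comm]
  rw [← this, derivation_sum_apply]
  rfl

theorem delta_euler (x : L) (p : D.Poly) :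
    D.delta x (D.euler p) = D.euler (D.delta x p) + D.delta x p := by
  have : ⁅D.delta x, D.euler⁆ = D.delta x := MvPolynomial.derivation_ext fun i => by
    rw [Derivation.commutator_apply, ← D.incl_e, euler_incl, delta_incl]
    simp [euler]
  have h := DFunLike.congr_fun this p
  rw [Derivation.commutator_apply, sub_eq_iff_eq_add'] at h
  exact h

theorem euler_monomial (m : Fin D.n →₀ ℕ) (r : R) :
    D.euler (MvPolynomial.monomial m r) = (m.degree : R) • MvPolynomial.monomial m r := by
  have h : D.euler = ∑ i, (MvPolynomial.X i : D.Poly) • MvPolynomial.pderiv i :=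
    MvPolynomial.derivation_ext fun j => by
      rw [derivation_sum_apply, Finset.sum_eq_single j]
      · simp [euler]
      · intro i _ hij
        simp [MvPolynomial.pderiv_X_of_ne hij.symm]
      · simp
  rw [h, derivation_sum_apply, Finsupp.degree_eq_sum, Nat.cast_sum, Finset.sum_smul]
  refine Finset.sum_congr rfl fun i _ => ?_
  rw [Derivation.smul_apply, smul_eq_mul, MvPolynomial.X_mul_pderiv_monomial, Nat.cast_smul_eq_nsmul]

/-- The operator `J_c = (N + c + 1)⁻¹`, where `N` is the Euler operator. -/
def invEuler (c : ℕ) : D.Poly →ₗ[R] D.Poly :=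
  (MvPolynomial.basisMonomials (Fin D.n) R).constr R
    fun m => MvPolynomial.monomial m (invSucc k R (m.degree + c))

theorem invEuler_monomial (c : ℕ) (m : Fin D.n →₀ ℕ) (r : R) :
    D.invEuler c (MvPolynomial.monomial m r) =
      invSucc k R (m.degree + c) • MvPolynomial.monomial m r := by
  have h := (MvPolynomial.basisMonomials (Fin D.n) R).constr_basis R
    (fun m => (MvPolynomial.monomial m (invSucc k R (m.degree + c)) : D.Poly)) m
  rw [MvPolynomial.coe_basisMonomials] at h
  have h1 : (MvPolynomial.monomial m r : D.Poly) = r • MvPolynomial.monomial m 1 := by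
    rw [MvPolynomial.smul_monomial, smul_eq_mul, mul_one]
  rw [h1, map_smul, smul_comm]
  congr 1
  refine h.trans ?_
  rw [MvPolynomial.smul_monomial, smul_eq_mul, mul_one]

section CharZero

variable [CharZero k]

theorem euler_invEuler (c : ℕ) (p : D.Poly) :
    D.euler (D.invEuler c p) + ((c : R) + 1) • D.invEuler c p = p := by
  induction p using MvPolynomial.induction_on' with
  | monomial m r =>
    rw [invEuler_monomial, Derivation.map_smul, euler_monomial, smul_comm, ← add_smul, smul_smul]
    have := succ_mul_invSucc k R (m.degree + c)
    push_cast at this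
    rw [← add_assoc, this, one_smul]
  | add p q hp hq =>
    conv_rhs => rw [← hp, ← hq]
    simp only [map_add, smul_add]
    abel

theorem invEuler_euler (c : ℕ) (p : D.Poly) :
    D.invEuler c (D.euler p + ((c : R) + 1) • p) = p := by
  induction p using MvPolynomial.induction_on' with
  | monomial m r =>
    rw [euler_monomial, ← add_smul, map_smul, invEuler_monomial, smul_smul]
    have := succ_mul_invSucc k R (m.degree + c)
    push_cast at this
    rw [← add_assoc, this, one_smul]
  | add p q hp hq =>
    conv_rhs => rw [← hp, ← hq]
    rw [← map_add]
    congr 1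
    simp only [map_add, smul_add]
    abel

theorem delta_invEuler (c : ℕ) (x : L) (p : D.Poly) :
    D.delta x (D.invEuler c p) = D.invEuler (c + 1) (D.delta x p) := by
  have h : D.delta x p = D.euler (D.delta x (D.invEuler c p)) +
      (((c + 1 : ℕ) : R) + 1) • D.delta x (D.invEuler c p) := by
    conv_lhs => rw [← D.euler_invEuler c p]
    rw [map_add, delta_euler, Derivation.map_smul]
    push_cast
    module
  rw [h, invEuler_euler]

/-- The operator `(vᵢ) ↦ ∑ᵢ e'ᵢ J_c vᵢ`, from which the homotopies of the Koszul complex are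
built. -/
def homotopy (c : ℕ) : (Fin D.n → D.Poly) →ₗ[R] D.Poly :=
  ∑ i, (LinearMap.mulLeft R (D.incl (D.e' i))).comp ((D.invEuler c).comp (LinearMap.proj i))

omit [CharZero k] in
theorem homotopy_apply (c : ℕ) (v : Fin D.n → D.Poly) :
    D.homotopy c v = ∑ i, D.incl (D.e' i) * D.invEuler c (v i) := by
  simp [homotopy, LinearMap.sum_apply]

omit [CharZero k] in
theorem constantCoeff_homotopy (c : ℕ) (v : Fin D.n → D.Poly) :
    MvPolynomial.constantCoeff (D.homotopy c v) = 0 := by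
  have : ∀ x, MvPolynomial.constantCoeff (D.incl x) = 0 := fun x => by
    simp [incl_apply, MvPolynomial.smul_eq_C_mul]
  simp [homotopy_apply, this]

/-- A polynomial is determined by its constant term and its derivatives. -/
theorem homotopy_delta (p : D.Poly) :
    D.homotopy 0 (fun i => D.delta (D.e i) p) =
      p - MvPolynomial.C (MvPolynomial.constantCoeff p) := by
  induction p using MvPolynomial.induction_on' with
  | monomial m r =>
    rcases Nat.eq_zero_or_pos m.degree with h0 | h0
    · obtain rfl := (Finsupp.degree_eq_zero_iff m).1 h0
      have : (fun i => D.delta (D.e i) (MvPolynomial.monomial 0 r)) = 0 :=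
        funext fun i => D.delta_C _ r
      rw [this, map_zero, ← MvPolynomial.C_apply, MvPolynomial.constantCoeff_C, sub_self]
    · obtain ⟨d, hd⟩ := Nat.exists_eq_add_of_le' h0
      set p : D.Poly := MvPolynomial.monomial m r with hp
      have hN : D.euler p = ((d : R) + 1) • p := by
        rw [hp, euler_monomial, hd]
        push_cast
        rfl
      have hJ : ∀ x, D.invEuler 0 (D.delta x p) = invSucc k R d • D.delta x p := fun x => by
        have h1 := D.delta_euler x p
        have h2 := D.invEuler_euler 0 (D.delta x p)
        rw [Nat.cast_zero, zero_add, one_smul, ← h1, hN, Derivation.map_smul, map_smul] at h2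
        conv_rhs => rw [← h2, smul_smul, mul_comm, succ_mul_invSucc, one_smul]
      have h0 : m ≠ 0 := by rintro rfl; simp at h0
      rw [homotopy_apply, hp, MvPolynomial.constantCoeff_monomial, if_neg h0, ← hp, map_zero,
        sub_zero]
      simp only [hJ, mul_smul_comm]
      rw [← Finset.smul_sum, sum_incl_mul_delta, hN, smul_smul, mul_comm, succ_mul_invSucc, one_smul]
  | add p q hp hq =>
    have : (fun i => D.delta (D.e i) (p + q)) =
      (fun i => D.delta (D.e i) p) + (fun i => D.delta (D.e i) q) := by ext1; simp
    rw [this, map_add, hp, hq]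
    simp only [map_add]
    abel

/-- The derivatives of `∑ᵢ e'ᵢ J_c Zᵢ`, for a 1-form `Z`. -/
theorem delta_homotopy (c : ℕ) (Z : L →ₗ[R] D.Poly) (x : L) :
    D.delta x (D.homotopy c fun i => Z (D.e i)) =
      D.invEuler c (Z x) + D.homotopy (c + 1) fun i => D.delta x (Z (D.e i)) := by
  have h : D.invEuler c (Z x) =
      ∑ i, D.form x (D.e' i) • D.invEuler c (Z (D.e i)) := by
    conv_lhs => rw [← D.sum_form x]
    simp
  rw [homotopy_apply, homotopy_apply, h, map_sum, ← Finset.sum_add_distrib]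
  refine Finset.sum_congr rfl fun i _ => ?_
  rw [Derivation.leibniz, delta_incl, delta_invEuler, smul_eq_mul, smul_eq_mul,
    MvPolynomial.smul_eq_C_mul]
  ring

theorem homotopy_delta_succ (c : ℕ) (p : D.Poly) :
    D.homotopy (c + 1) (fun i => D.delta (D.e i) p) = p - ((c : R) + 1) • D.invEuler c p := by
  conv_rhs => enter [1]; rw [← D.euler_invEuler c p]
  rw [add_sub_cancel_right, ← sum_incl_mul_delta, homotopy_apply]
  simp only [delta_invEuler]

/-- The homotopy formula for 1-forms. -/
theorem delta_homotopy_one (Z : L →ₗ[R] D.Poly) (x : L) :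
    D.delta x (D.homotopy 0 fun i => Z (D.e i)) =
      Z x - D.homotopy 1 fun i => D.delta (D.e i) (Z x) - D.delta x (Z (D.e i)) := by
  have h : (fun i => D.delta (D.e i) (Z x) - D.delta x (Z (D.e i))) =
    (fun i => D.delta (D.e i) (Z x)) - fun i => D.delta x (Z (D.e i)) := rfl
  rw [h, map_sub, delta_homotopy, homotopy_delta_succ]
  simp only [Nat.cast_zero, zero_add, one_smul]
  abel

/-- The homotopy formula for 2-forms. -/
theorem delta_homotopy_two (Z : L →ₗ[R] L →ₗ[R] D.Poly) (hZ : ∀ x y, Z x y = - Z y x) (x y : L) :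
    D.delta x (D.homotopy 1 fun i => Z (D.e i) y) - D.delta y (D.homotopy 1 fun i => Z (D.e i) x) =
      Z x y - D.homotopy 2 fun i => D.delta (D.e i) (Z x y) + D.delta x (Z y (D.e i)) +
        D.delta y (Z (D.e i) x) := by
  have h : (fun i => D.delta (D.e i) (Z x y) + D.delta x (Z y (D.e i)) + D.delta y (Z (D.e i) x)) =
      (fun i => D.delta (D.e i) (Z x y)) - (fun i => D.delta x (Z (D.e i) y)) +
        fun i => D.delta y (Z (D.e i) x) := by
    ext1 i
    simp only [Pi.add_apply, Pi.sub_apply]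
    rw [hZ y (D.e i), map_neg, sub_eq_add_neg]
  have h1 := D.delta_homotopy 1 (Z.flip y) x
  have h2 := D.delta_homotopy 1 (Z.flip x) y
  simp only [LinearMap.flip_apply] at h1 h2
  rw [h, map_add, map_sub, h1, h2, homotopy_delta_succ, hZ y x, map_neg]
  push_cast
  module

end CharZero

end SymplecticData
end
end SheafQuantization

namespace SheafQuantization
noncomputable section

namespace SymplecticData

variable {k R L : Type*} [Field k] [CommRing R] [Algebra k R] [AddCommGroup L] [Module R L]
  (D : SymplecticData k R L)

/-! ### The Weyl algebra -/

/-- The terms of the Moyal product defined by the symplectic form. -/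
def star (m : ℕ) : D.Poly →ₗ[R] D.Poly →ₗ[R] D.Poly :=
  moyalCoeff (fun i => D.delta (D.e i)) (fun i => D.delta (D.e' i)) (invSucc k R) m

theorem star_zero (a b : D.Poly) : D.star 0 a b = a * b := rfl

theorem star_succ (m : ℕ) (a b : D.Poly) :
    D.star (m + 1) a b =
      invSucc k R m • ∑ i, D.star m (D.delta (D.e i) a) (D.delta (D.e' i) b) :=
  moyalCoeff_succ _ _ _ _ _ _

/-- The bilinear map `(x, y) ↦ c_m(δ_x a, δ_y b)`. -/
def starDelta (m : ℕ) (a b : D.Poly) : L →ₗ[R] L →ₗ[R] D.Poly :=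
  (D.star m).compl₁₂ (D.deltaAt a) (D.deltaAt b)

theorem starDelta_apply (m : ℕ) (a b : D.Poly) (x y : L) :
    D.starDelta m a b x y = D.star m (D.delta x a) (D.delta y b) := rfl

theorem star_one_eq (a b : D.Poly) :
    D.star 1 a b = ∑ i, D.delta (D.e i) a * D.delta (D.e' i) b := by
  rw [star_succ]
  simp [invSucc, star_zero]

theorem star_swap (m : ℕ) (a b : D.Poly) : D.star m a b = (-1 : R) ^ m • D.star m b a := by
  induction m generalizing a b with
  | zero => simp [star_zero, mul_comm]
  | succ m ih =>
    have h := D.sum_canonical (D.starDelta m b a) D.e' (fun i => - D.e i) (fun x => by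
      conv_rhs => rw [← D.sum_form' x]
      refine Finset.sum_congr rfl fun i _ => ?_
      rw [map_neg, D.form_skew, neg_neg])
    simp only [map_neg, starDelta_apply, Finset.sum_neg_distrib] at h
    rw [star_succ, star_succ, ← h, Finset.sum_congr rfl fun i _ => ih _ _, ← Finset.smul_sum,
      smul_neg, pow_succ, smul_comm]
    simp

theorem anchor_invSucc (x : L) (m : ℕ) : D.anchor x (invSucc k R m) = 0 :=
  Derivation.map_algebraMap _ _

/-- The connection preserves the Moyal product because it preserves the symplectic form. -/
theorem nabla_star (x : L) (m : ℕ) (a b : D.Poly) :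
    D.nabla x (D.star m a b) = D.star m (D.nabla x a) b + D.star m a (D.nabla x b) := by
  induction m generalizing a b with
  | zero => exact D.nabla_mul x a b
  | succ m ih =>
    have h := D.sum_canonical_conn (D.starDelta m a b) x
    simp only [starDelta_apply] at h
    rw [star_succ, star_succ, star_succ, nabla_smul, anchor_invSucc, zero_smul, zero_add, map_sum,
      ← smul_add]
    congr 1
    simp only [ih, nabla_delta, map_add, LinearMap.add_apply]
    rw [← add_zero (_ + ∑ i, _), ← h]
    simp only [Finset.sum_add_distrib]
    abel

/-- The Weyl algebra of the symplectic module `L`: the symmetric algebra with the Moyal product. -/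
def Weyl : Type _ := D.Poly

instance : AddCommGroup D.Weyl := inferInstanceAs (AddCommGroup D.Poly)

instance : Module R D.Weyl := inferInstanceAs (Module R D.Poly)

/-- The Moyal product. -/
def wmul (a b : D.Poly) : D.Poly := moyal _ _ (invSucc k R) D.isKilled a b

theorem wmul_eq {M : ℕ} {a b : D.Poly} (h : ∀ m, M ≤ m → D.star m a b = 0) :
    D.wmul a b = ∑ m ∈ Finset.range M, D.star m a b := by
  obtain ⟨N, hN⟩ := D.isKilled a
  rw [wmul, moyal_eq _ _ _ _ (hN.mono (le_max_left N M))]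
  symm
  refine Finset.sum_subset (by simp) fun m _ hm => h m ?_
  simpa using hm

theorem wmul_eq_of_isKilled {M : ℕ} {a : D.Poly} (b : D.Poly)
    (h : IsKilled (fun i => D.delta (D.e i)) (fun i => D.delta (D.e' i)) M a) :
    D.wmul a b = ∑ m ∈ Finset.range M, D.star m a b :=
  moyal_eq _ _ _ _ h b

theorem wmul_derivation (d : D.Poly →+ D.Poly)
    (hd : ∀ m a b, d (D.star m a b) = D.star m (d a) b + D.star m a (d b)) (a b : D.Poly) :
    d (D.wmul a b) = D.wmul (d a) b + D.wmul a (d b) := by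
  obtain ⟨N, hN⟩ := D.isKilled a
  obtain ⟨N', hN'⟩ := D.isKilled (d a)
  have h := hN.mono (le_max_left N N')
  have h' := hN'.mono (le_max_right N N')
  rw [D.wmul_eq_of_isKilled _ h, D.wmul_eq_of_isKilled _ h', D.wmul_eq_of_isKilled _ h, map_sum,
    ← Finset.sum_add_distrib]
  exact Finset.sum_congr rfl fun m _ => hd m a b

variable [CharZero k]

theorem wmul_add (a b c : D.Poly) : D.wmul a (b + c) = D.wmul a b + D.wmul a c :=
  moyal_add_right _ _ _ _ a b c

theorem add_wmul (a b c : D.Poly) : D.wmul (a + b) c = D.wmul a c + D.wmul b c :=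
  moyal_add_left _ _ _ _ a b c

theorem wmul_assoc (a b c : D.Poly) : D.wmul (D.wmul a b) c = D.wmul a (D.wmul b c) :=
  moyal_assoc _ _ _ _ (succ_mul_invSucc k R) (fun _ _ => D.delta_comm _ _)
    (fun _ _ => D.delta_comm _ _) (fun _ _ => D.delta_comm _ _) a b c

theorem smul_wmul (r : R) (a b : D.Poly) : D.wmul (r • a) b = r • D.wmul a b :=
  moyal_smul_left _ _ _ _ r a b

theorem wmul_smul (r : R) (a b : D.Poly) : D.wmul a (r • b) = r • D.wmul a b :=
  moyal_smul_right _ _ _ _ r a b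

instance : Ring D.Weyl :=
  { (inferInstance : AddCommGroup D.Weyl) with
    mul := D.wmul
    one := (1 : D.Poly)
    left_distrib := D.wmul_add
    right_distrib := D.add_wmul
    zero_mul := fun a => by
      have := D.add_wmul 0 0 a
      rw [add_zero] at this
      exact left_eq_add.1 this
    mul_zero := fun a => by
      have := D.wmul_add a 0 0
      rw [add_zero] at this
      exact left_eq_add.1 this
    mul_assoc := D.wmul_assoc
    one_mul := fun a => moyal_one_left (P := D.Poly) _ _ _ D.isKilled a
    mul_one := fun a => moyal_one_right (P := D.Poly) _ _ _ D.isKilled a }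

instance : Algebra R D.Weyl :=
  Algebra.ofModule D.smul_wmul D.wmul_smul

theorem weyl_algebraMap (r : R) : algebraMap R D.Weyl r = (MvPolynomial.C r : D.Poly) := by
  rw [Algebra.algebraMap_eq_smul_one]
  exact (MvPolynomial.C_eq_smul_one).symm

/-- `L` as a submodule of the Weyl algebra. -/
def wincl : L →ₗ[R] D.Weyl := D.incl

/-- The derivation `δ_x` of the Weyl algebra. -/
def wdelta (x : L) : D.Weyl →ₗ[R] D.Weyl := (D.delta x : D.Poly →ₗ[R] D.Poly)

/-- The covariant derivative on the Weyl algebra. -/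
def wnabla (x : L) : D.Weyl →+ D.Weyl := D.nabla x

/-- The projection onto the constant term. -/
def wconst : D.Weyl →ₗ[R] R := MvPolynomial.lcoeff R (0 : Fin D.n →₀ ℕ)

/-- The homotopy operators as operators on the Weyl algebra. -/
def whomotopy (c : ℕ) : (Fin D.n → D.Weyl) →ₗ[R] D.Weyl := D.homotopy c

theorem wconst_algebraMap (r : R) : D.wconst (algebraMap R D.Weyl r) = r := by
  rw [weyl_algebraMap]
  exact MvPolynomial.constantCoeff_C _ _

theorem wconst_homotopy (c : ℕ) (v : Fin D.n → D.Weyl) : D.wconst (D.whomotopy c v) = 0 :=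
  D.constantCoeff_homotopy c v

theorem wconst_incl (x : L) : D.wconst (D.wincl x) = 0 := by
  change MvPolynomial.constantCoeff (D.incl x) = 0
  simp [incl_apply, MvPolynomial.smul_eq_C_mul]

theorem wdelta_mul (x : L) (a b : D.Weyl) :
    D.wdelta x (a * b) = D.wdelta x a * b + a * D.wdelta x b :=
  D.wmul_derivation ((D.delta x : D.Poly →ₗ[R] D.Poly) : D.Poly →+ D.Poly)
    (fun m a b => moyalCoeff_derivation _ _ _ _ (fun _ _ => D.delta_comm _ _ _)
      (fun _ _ => D.delta_comm _ _ _) m a b) a b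

theorem wdelta_add (x y : L) (a : D.Weyl) : D.wdelta (x + y) a = D.wdelta x a + D.wdelta y a :=
  (D.deltaAt a).map_add x y

theorem wdelta_smul (r : R) (x : L) (a : D.Weyl) : D.wdelta (r • x) a = r • D.wdelta x a :=
  (D.deltaAt a).map_smul r x

theorem wdelta_comm (x y : L) (a : D.Weyl) :
    D.wdelta x (D.wdelta y a) = D.wdelta y (D.wdelta x a) := D.delta_comm x y a

theorem wdelta_algebraMap (x : L) (r : R) : D.wdelta x (algebraMap R D.Weyl r) = 0 := by
  rw [weyl_algebraMap]
  exact D.delta_C x r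

theorem wdelta_incl (x y : L) :
    D.wdelta x (D.wincl y) = algebraMap R D.Weyl (D.form x y) := by
  rw [weyl_algebraMap]
  exact D.delta_incl x y

theorem wnabla_mul (x : L) (a b : D.Weyl) :
    D.wnabla x (a * b) = D.wnabla x a * b + a * D.wnabla x b :=
  D.wmul_derivation (D.nabla x) (D.nabla_star x) a b

theorem wnabla_smul (x : L) (r : R) (a : D.Weyl) :
    D.wnabla x (r • a) = D.anchor x r • a + r • D.wnabla x a := D.nabla_smul x r a

theorem wnabla_add_left (x y : L) (a : D.Weyl) :
    D.wnabla (x + y) a = D.wnabla x a + D.wnabla y a := D.nabla_add_left x y a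

theorem wnabla_smul_left (r : R) (x : L) (a : D.Weyl) :
    D.wnabla (r • x) a = r • D.wnabla x a := D.nabla_smul_left r x a

theorem wnabla_algebraMap (x : L) (r : R) :
    D.wnabla x (algebraMap R D.Weyl r) = algebraMap R D.Weyl (D.anchor x r) := by
  rw [weyl_algebraMap, weyl_algebraMap]
  exact D.nabla_C x r

theorem wnabla_delta (x y : L) (a : D.Weyl) :
    D.wnabla x (D.wdelta y a) = D.wdelta y (D.wnabla x a) + D.wdelta (D.conn x y) a :=
  D.nabla_delta x y a

/-- The product of the Weyl algebra when one factor is in `L`. -/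
theorem wincl_mul (x : L) (a : D.Poly) :
    D.wmul (D.incl x) a = D.incl x * a + D.delta x a := by
  have h : IsKilled (fun i => D.delta (D.e i)) (fun i => D.delta (D.e' i)) 2 (D.incl x) :=
    fun i => ⟨fun j => by simp [delta_incl, IsKilled], fun j => by simp [delta_incl, IsKilled]⟩
  rw [D.wmul_eq_of_isKilled _ h, Finset.sum_range_succ, Finset.sum_range_one, star_zero,
    star_one_eq]
  congr 1
  conv_rhs => rw [← D.sum_form' x, map_sum, derivation_sum_apply]
  refine Finset.sum_congr rfl fun i _ => ?_
  rw [delta_incl, ← MvPolynomial.smul_eq_C_mul, map_smul, Derivation.smul_apply]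

/-- The inner derivation of a polynomial of degree two is, up to the factor `2`, its Hamiltonian
vector field. -/
theorem wmul_sub_wmul_of_isKilled_three {q : D.Poly}
    (hq : IsKilled (fun i => D.delta (D.e i)) (fun i => D.delta (D.e' i)) 3 q) (a : D.Poly) :
    D.wmul q a - D.wmul a q = (2 : R) • D.star 1 q a := by
  rw [D.wmul_eq_of_isKilled _ hq, D.wmul_eq (M := 3) (fun m hm => hq.moyalCoeff_right _ hm a)]
  simp only [Finset.sum_range_succ, Finset.sum_range_zero, zero_add]
  rw [D.star_swap 0 a q, D.star_swap 1 a q, D.star_swap 2 a q]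
  module

/-! ### The curvature -/

/-- The curvature of the connection. -/
def curv (x y : L) : L →ₗ[R] L where
  toFun z := D.conn x (D.conn y z) - D.conn y (D.conn x z) - D.conn (D.br x y) z
  map_add' z z' := by simp only [conn_add_right]; abel
  map_smul' r z := by
    have h := D.anchor_bracket x y r
    simp only [conn_leibniz, conn_add_right, br, ← h, RingHom.id_apply]
    module

theorem curv_apply (x y z : L) : D.curv x y z =
    D.conn x (D.conn y z) - D.conn y (D.conn x z) - D.conn (D.br x y) z := rfl

theorem br_add_left (x x' y : L) : D.br (x + x') y = D.br x y + D.br x' y := by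
  simp only [br, conn_add_left, conn_add_right]; abel

theorem br_skew (x y : L) : D.br x y = - D.br y x := by simp [br]

theorem br_smul_left (r : R) (x y : L) :
    D.br (r • x) y = r • D.br x y - D.anchor y r • x := by
  simp only [br, conn_smul_left, conn_leibniz]; module

theorem curv_skew (x y : L) : D.curv x y = - D.curv y x := by
  ext z
  rw [LinearMap.neg_apply, curv_apply, curv_apply, br_skew, conn_neg_left]
  abel

theorem curv_add_left (x x' y : L) : D.curv (x + x') y = D.curv x y + D.curv x' y := by
  ext z
  simp only [LinearMap.add_apply, curv_apply, br_add_left, conn_add_left, conn_add_right]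
  abel

theorem curv_smul_left (r : R) (x y : L) : D.curv (r • x) y = r • D.curv x y := by
  ext z
  simp only [LinearMap.smul_apply, curv_apply, br_smul_left, conn_smul_left, conn_leibniz,
    conn_sub_left]
  module

theorem curv_form (x y u v : L) :
    D.form (D.curv x y u) v + D.form u (D.curv x y v) = 0 := by
  have h := D.anchor_bracket x y (D.form u v)
  have h3 := D.conn_form (D.br x y) u v
  simp only [br] at h3
  rw [h3] at h
  simp only [D.conn_form, map_add] at h
  simp only [curv_apply, map_sub, LinearMap.sub_apply, br]
  linear_combination h

/-- The differential Bianchi identity, as an identity between operators. -/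
theorem curv_bianchi (x y z u : L) :
    (D.conn x (D.curv y z u) - D.curv y z (D.conn x u) - D.curv (D.br x y) z u) +
    (D.conn y (D.curv z x u) - D.curv z x (D.conn y u) - D.curv (D.br y z) x u) +
    (D.conn z (D.curv x y u) - D.curv x y (D.conn z u) - D.curv (D.br z x) y u) = 0 := by
  have h := congrArg (fun w => D.conn w u) (D.jacobi x y z)
  have hb : ∀ x y z, D.conn (D.br (D.br x y) z) u =
      D.conn (D.conn (D.conn x y - D.conn y x) z - D.conn z (D.conn x y - D.conn y x)) u :=
    fun _ _ _ => rfl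
  simp only [conn_add_left, ← hb, conn_zero_left] at h
  simp only [curv_apply, conn_sub_right]
  rw [← sub_eq_zero.2 h]
  abel

/-- The scalar `-1/4`. -/
def negQuarter (k R : Type*) [Field k] [CommRing R] [Algebra k R] : R := algebraMap k R (-4⁻¹)

/-- The quadratic polynomial whose inner derivation is the extension of `Q`, for `Q` in the
symplectic Lie algebra of `L`. -/
def quad (Q : L →ₗ[R] L) : D.Poly :=
  negQuarter k R • ∑ i, D.incl (D.e' i) * D.incl (Q (D.e i))

theorem isKilled_quad (Q : L →ₗ[R] L) :
    IsKilled (fun i => D.delta (D.e i)) (fun i => D.delta (D.e' i)) 3 (D.quad Q) := by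
  have h2 : ∀ x, IsKilled (fun i => D.delta (D.e i)) (fun i => D.delta (D.e' i)) 2 (D.incl x) :=
    fun x i => ⟨fun j => by simp [delta_incl, IsKilled], fun j => by simp [delta_incl, IsKilled]⟩
  refine IsKilled.smul _ ?_
  refine Finset.sum_induction _ _ (fun _ _ => IsKilled.add) (.zero _) fun i _ => ?_
  exact (h2 _).mul (fun i => ⟨_, D.delta_incl _ _⟩) (fun i => ⟨_, D.delta_incl _ _⟩)

theorem delta_quad (Q : L →ₗ[R] L) (hQ : ∀ u v, D.form (Q u) v + D.form u (Q v) = 0) (z : L) :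
    D.delta z (D.quad Q) = (2 * negQuarter k R) • D.incl (Q z) := by
  have h1 : ∑ i, D.form z (D.e' i) • D.incl (Q (D.e i)) = D.incl (Q z) := by
    conv_rhs => rw [← D.sum_form z]
    simp
  have h2 : ∑ i, D.form z (Q (D.e i)) • D.incl (D.e' i) = D.incl (Q z) := by
    conv_rhs => rw [← D.sum_form' (Q z), map_sum]
    refine Finset.sum_congr rfl fun i _ => ?_
    rw [map_smul, D.form_skew (D.e i), ← eq_neg_of_add_eq_zero_right (hQ z (D.e i))]
  rw [quad, Derivation.map_smul, map_sum, mul_smul, two_smul, ← smul_add]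
  congr 1
  conv_rhs => enter [1]; rw [← h1]
  conv_rhs => enter [2]; rw [← h2]
  rw [← Finset.sum_add_distrib]
  refine Finset.sum_congr rfl fun i _ => ?_
  simp only [Derivation.leibniz, delta_incl, smul_eq_mul, MvPolynomial.smul_eq_C_mul]
  ring

theorem star_one_quad (Q : L →ₗ[R] L) (hQ : ∀ u v, D.form (Q u) v + D.form u (Q v) = 0)
    (K : D.Poly →+ D.Poly) (hC : ∀ r, K (MvPolynomial.C r) = 0)
    (hmul : ∀ p q, K (p * q) = K p * q + p * K q) (hK : ∀ z, K (D.incl z) = D.incl (Q z))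
    (p : D.Poly) : (2 : R) • D.star 1 (D.quad Q) p = K p := by
  induction p using D.poly_induction with
  | hC r => simp [star_one_eq, hC]
  | hadd p q hp hq => rw [map_add, map_add, smul_add, hp, hq]
  | hmul p z hp =>
    have hz : (2 : R) • D.star 1 (D.quad Q) (D.incl z) = D.incl (Q z) := by
      have h4 : (2 * (2 * negQuarter k R)) = (-1 : R) := by
        have : (2 : R) = algebraMap k R 2 := (map_ofNat (algebraMap k R) 2).symm
        rw [negQuarter, this, ← map_mul, ← map_mul]
        have h : (2 * (2 * -4⁻¹) : k) = -1 := by norm_num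
        rw [h, map_neg, map_one]
      have h1 : ∑ i, D.form (D.e' i) z • D.incl (Q (D.e i)) = - D.incl (Q z) := by
        conv_rhs => rw [← D.sum_form z]
        rw [map_sum, map_sum, ← Finset.sum_neg_distrib]
        refine Finset.sum_congr rfl fun i _ => ?_
        rw [D.form_skew, neg_smul, map_smul, map_smul]
      simp only [star_one_eq, D.delta_quad Q hQ, delta_incl]
      rw [Finset.sum_congr rfl fun i _ => by
        rw [mul_comm, ← MvPolynomial.smul_eq_C_mul, smul_comm], ← Finset.smul_sum, h1, smul_smul,
        h4]
      simp
    rw [hmul, hK, ← hz, ← hp, star_one_eq, star_one_eq, star_one_eq]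
    simp only [Derivation.leibniz, smul_eq_mul, mul_add, Finset.sum_add_distrib, smul_add,
      MvPolynomial.smul_eq_C_mul, Finset.mul_sum, Finset.sum_mul]
    rw [add_comm]
    congr 1 <;> refine Finset.sum_congr rfl fun i _ => ?_ <;> ring

omit [CharZero k] in
theorem nabla_quad (x : L) (Q Q' : L →ₗ[R] L) (h : ∀ u, Q' u = D.conn x (Q u) - Q (D.conn x u)) :
    D.nabla x (D.quad Q) = D.quad Q' := by
  have hc := D.sum_canonical_conn
    ((LinearMap.mul R D.Poly).compl₁₂ (D.incl ∘ₗ Q) D.incl) x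
  simp only [LinearMap.compl₁₂_apply, LinearMap.comp_apply, LinearMap.mul_apply'] at hc
  rw [quad, quad, nabla_smul, map_sum]
  have h0 : D.anchor x (negQuarter k R) = 0 := Derivation.map_algebraMap _ _
  rw [h0, zero_smul, zero_add]
  congr 1
  rw [← sub_eq_zero, ← hc, ← Finset.sum_sub_distrib]
  refine Finset.sum_congr rfl fun i _ => ?_
  rw [nabla_mul, nabla_incl, nabla_incl, h, map_sub]
  ring

omit [CharZero k] in
theorem quad_add (Q Q' : L →ₗ[R] L) : D.quad (Q + Q') = D.quad Q + D.quad Q' := by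
  rw [quad, quad, quad, ← smul_add, ← Finset.sum_add_distrib]
  simp [mul_add]

omit [CharZero k] in
theorem quad_smul (r : R) (Q : L →ₗ[R] L) : D.quad (r • Q) = r • D.quad Q := by
  rw [quad, quad, smul_comm, Finset.smul_sum (r := r)]
  simp

/-- The curvature of the connection as a quadratic polynomial. -/
def wcurv (x y : L) : D.Weyl := D.quad (D.curv x y)

theorem wcurv_add_left (x x' y : L) : D.wcurv (x + x') y = D.wcurv x y + D.wcurv x' y := by
  unfold wcurv
  rw [curv_add_left]
  exact D.quad_add _ _

theorem wcurv_smul_left (r : R) (x y : L) : D.wcurv (r • x) y = r • D.wcurv x y := by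
  unfold wcurv
  rw [curv_smul_left]
  exact D.quad_smul _ _

theorem wcurv_skew (x y : L) : D.wcurv x y = - D.wcurv y x := by
  rw [← neg_one_smul R (D.wcurv y x)]
  unfold wcurv
  rw [curv_skew, ← neg_one_smul R (D.curv y x)]
  exact D.quad_smul _ _

/-- The curvature of the connection on the Weyl algebra is inner. -/
theorem wnabla_commutator (x y : L) (a : D.Weyl) :
    D.wnabla x (D.wnabla y a) - D.wnabla y (D.wnabla x a) - D.wnabla (D.br x y) a =
      D.wcurv x y * a - a * D.wcurv x y := by
  refine Eq.trans ?_ (D.wmul_sub_wmul_of_isKilled_three (D.isKilled_quad (D.curv x y)) a).symm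
  refine (D.star_one_quad (D.curv x y) (D.curv_form x y)
    ((D.nabla x).comp (D.nabla y) - (D.nabla y).comp (D.nabla x) - D.nabla (D.br x y))
    (fun r => ?_) (fun p q => ?_) (fun z => ?_) a).symm
  · simp only [AddMonoidHom.sub_apply, AddMonoidHom.comp_apply, nabla_C, ← map_sub]
    rw [D.anchor_bracket, br, sub_self, map_zero]
  · simp only [AddMonoidHom.sub_apply, AddMonoidHom.comp_apply, nabla_mul, map_add]
    ring
  · simp only [AddMonoidHom.sub_apply, AddMonoidHom.comp_apply, nabla_incl, ← map_sub]
    rfl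

theorem wcurv_bianchi (x y z : L) :
    (D.wnabla x (D.wcurv y z) - D.wcurv (D.br x y) z) +
    (D.wnabla y (D.wcurv z x) - D.wcurv (D.br y z) x) +
    (D.wnabla z (D.wcurv x y) - D.wcurv (D.br z x) y) = 0 := by
  have key : ∀ x y z, ∃ Q : L →ₗ[R] L,
      (∀ u, Q u = D.conn x (D.curv y z u) - D.curv y z (D.conn x u)) ∧
      D.nabla x (D.quad (D.curv y z)) = D.quad Q := by
    intro x y z
    let Q : L →ₗ[R] L :=
      { toFun := fun u => D.conn x (D.curv y z u) - D.curv y z (D.conn x u)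
        map_add' := fun u v => by simp only [map_add, conn_add_right]; abel
        map_smul' := fun r u => by
          simp only [map_smul, conn_leibniz, map_add, RingHom.id_apply]
          module }
    exact ⟨Q, fun u => rfl, D.nabla_quad x _ Q fun u => rfl⟩
  obtain ⟨Q₁, h₁, e₁⟩ := key x y z
  obtain ⟨Q₂, h₂, e₂⟩ := key y z x
  obtain ⟨Q₃, h₃, e₃⟩ := key z x y
  have hQ : Q₁ + Q₂ + Q₃ = D.curv (D.br x y) z + D.curv (D.br y z) x + D.curv (D.br z x) y := by
    ext u
    have := D.curv_bianchi x y z u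
    rw [← sub_eq_zero]
    simp only [LinearMap.add_apply, h₁, h₂, h₃]
    rw [← this]
    abel
  have h := congrArg D.quad hQ
  simp only [quad_add, ← e₁, ← e₂, ← e₃] at h
  rw [← sub_eq_zero] at h
  refine Eq.trans ?_ h
  have : ∀ a b c a' b' c' : D.Poly, a - a' + (b - b') + (c - c') = a + b + c - (a' + b' + c') :=
    fun _ _ _ _ _ _ => by abel
  exact this _ _ _ _ _ _

/-! ### The Koszul complex of the Weyl algebra -/

theorem whomotopy_delta (a : D.Weyl) :
    D.whomotopy 0 (fun i => D.wdelta (D.e i) a) = a - algebraMap R D.Weyl (D.wconst a) := by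
  rw [weyl_algebraMap]
  exact D.homotopy_delta a

theorem wdelta_homotopy_one (Z : L → D.Weyl) (hadd : ∀ x y, Z (x + y) = Z x + Z y)
    (hsmul : ∀ (r : R) x, Z (r • x) = r • Z x) (x : L) :
    D.wdelta x (D.whomotopy 0 fun i => Z (D.e i)) =
      Z x - D.whomotopy 1 fun i => D.wdelta (D.e i) (Z x) - D.wdelta x (Z (D.e i)) :=
  D.delta_homotopy_one ⟨⟨Z, hadd⟩, hsmul⟩ x

theorem wdelta_homotopy_two (Z : L → L → D.Weyl) (hadd : ∀ x x' y, Z (x + x') y = Z x y + Z x' y)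
    (hsmul : ∀ (r : R) x y, Z (r • x) y = r • Z x y) (hZ : ∀ x y, Z x y = - Z y x) (x y : L) :
    D.wdelta x (D.whomotopy 1 fun i => Z (D.e i) y) -
        D.wdelta y (D.whomotopy 1 fun i => Z (D.e i) x) =
      Z x y - D.whomotopy 2 fun i => D.wdelta (D.e i) (Z x y) + D.wdelta x (Z y (D.e i)) +
        D.wdelta y (Z (D.e i) x) :=
  D.delta_homotopy_two
    (LinearMap.mk₂ R (Z : L → L → D.Poly) hadd hsmul
      (fun x y y' => by
        rw [hZ x (y + y'), hadd, hZ x y, hZ x y']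
        exact neg_add _ _)
      (fun r x y => by
        rw [hZ x (r • y), hsmul, hZ x y]
        exact (smul_neg _ _).symm)) hZ x y

end SymplecticData
end
end SheafQuantization

namespace SheafQuantization
noncomputable section

/-! ### Operators on power series acting coefficientwise -/

section Coeffwise

open PowerSeries

variable {A B : Type*} [Semiring A] [Semiring B]

/-- The additive map between power series which applies `g` to each coefficient. -/
def coeffwise (g : A →+ B) : A⟦X⟧ →+ B⟦X⟧ where
  toFun w := PowerSeries.mk fun d => g (coeff d w)
  map_zero' := by ext; simp
  map_add' v w := by ext; simp

@[simp]
theorem coeff_coeffwise (g : A →+ B) (w : A⟦X⟧) (d : ℕ) :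
    coeff d (coeffwise g w) = g (coeff d w) := by
  simp [coeffwise]

theorem coeffwise_X_mul (g : A →+ B) (w : A⟦X⟧) :
    coeffwise g (X * w) = X * coeffwise g w := by
  ext d
  cases d <;> simp [coeff_zero_X_mul, coeff_succ_X_mul]

theorem coeffwise_mul (g : A →+ A) (hg : ∀ a b, g (a * b) = g a * b + a * g b) (v w : A⟦X⟧) :
    coeffwise g (v * w) = coeffwise g v * w + v * coeffwise g w := by
  ext d
  simp [coeff_mul, hg, Finset.sum_add_distrib]

/-- Two power series agree modulo `X ^ d`. -/
def Agree (d : ℕ) (v w : A⟦X⟧) : Prop := ∀ i < d, coeff i v = coeff i w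

namespace Agree

variable {d : ℕ} {v w v' w' : A⟦X⟧}

theorem rfl : Agree d v v := fun _ _ => Eq.refl _

theorem add (h : Agree d v w) (h' : Agree d v' w') : Agree d (v + v') (w + w') := fun i hi => by
  rw [map_add, map_add, h i hi, h' i hi]

theorem mul (h : Agree d v w) (h' : Agree d v' w') : Agree d (v * v') (w * w') := fun i hi => by
  rw [coeff_mul, coeff_mul]
  refine Finset.sum_congr (Eq.refl _) fun x hx => ?_
  have := Finset.HasAntidiagonal.mem_antidiagonal.1 hx
  rw [h _ (by omega), h' _ (by omega)]

theorem map (h : Agree d v w) (g : A →+ B) : Agree d (coeffwise g v) (coeffwise g w) :=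
  fun i hi => by rw [coeff_coeffwise, coeff_coeffwise, h i hi]

theorem X_mul (h : Agree d v w) : Agree (d + 1) (X * v) (X * w) := fun i hi => by
  cases i with
  | zero => rw [coeff_zero_X_mul, coeff_zero_X_mul]
  | succ i => rw [coeff_succ_X_mul, coeff_succ_X_mul, h i (by omega)]

theorem sum {ι : Type*} (s : Finset ι) {f g : ι → A⟦X⟧} (h : ∀ i, Agree d (f i) (g i)) :
    Agree d (∑ i ∈ s, f i) (∑ i ∈ s, g i) := fun i hi => by
  rw [map_sum, map_sum]
  exact Finset.sum_congr (Eq.refl _) fun j _ => h j i hi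

theorem eq (h : ∀ d, Agree d v w) : v = w := PowerSeries.ext fun i => h (i + 1) i (by omega)

theorem sub {A : Type*} [Ring A] {v w v' w' : A⟦X⟧} (h : Agree d v w) (h' : Agree d v' w') :
    Agree d (v - v') (w - w') := fun i hi => by
  rw [map_sub, map_sub, h i hi, h' i hi]

end Agree

/-- An operator on sequences each of whose values depends only on earlier terms has a fixed
point. -/
theorem exists_fixed_of_causal {T : Type*} [Nonempty T] (F : (ℕ → T) → ℕ → T)
    (hF : ∀ s t d, (∀ i < d, s i = t i) → F s d = F t d) : ∃ s, ∀ d, F s d = s d := by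
  classical
  let g : (d : ℕ) → ((i : ℕ) → i < d → T) → T := fun d prev =>
    F (fun i => if h : i < d then prev i h else Classical.arbitrary T) d
  refine ⟨fun d => Nat.strongRec g d, fun d => ?_⟩
  dsimp only
  rw [Nat.strongRec_eq]
  exact hF _ _ _ fun i hi => by simp [hi]

end Coeffwise

namespace SymplecticData

open PowerSeries

variable {k R L : Type*} [Field k] [CommRing R] [Algebra k R] [AddCommGroup L] [Module R L]
  (D : SymplecticData k R L) [CharZero k]

/-! ### The flat connection on formal series in the Weyl algebra -/

/-- The covariant derivative on formal series. -/
def nab (x : L) : D.Weyl⟦X⟧ →+ D.Weyl⟦X⟧ := coeffwise (D.wnabla x)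

/-- The derivation `δ_x` on formal series. -/
def del (x : L) : D.Weyl⟦X⟧ →+ D.Weyl⟦X⟧ := coeffwise (D.wdelta x : D.Weyl →+ D.Weyl)

/-- The constant terms, with respect to the variables of the Weyl algebra, of a formal series. -/
def con : D.Weyl⟦X⟧ →+ R⟦X⟧ := coeffwise (D.wconst : D.Weyl →+ R)

/-- Formal series of scalars as formal series in the Weyl algebra. -/
def scal : R⟦X⟧ →+* D.Weyl⟦X⟧ := PowerSeries.map (algebraMap R D.Weyl)

/-- The homotopy operators on formal series. -/
def hom (c : ℕ) : (Fin D.n → D.Weyl⟦X⟧) →+ D.Weyl⟦X⟧ where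
  toFun v := PowerSeries.mk fun d => D.whomotopy c fun i => coeff d (v i)
  map_zero' := by
    ext d
    have : (fun _ : Fin D.n => (0 : D.Weyl)) = 0 := rfl
    simp [this]
  map_add' v w := by
    ext d
    simp only [Pi.add_apply, map_add, coeff_mk]
    rw [← map_add]
    rfl

theorem coeff_hom (c d : ℕ) (v : Fin D.n → D.Weyl⟦X⟧) :
    coeff d (D.hom c v) = D.whomotopy c fun i => coeff d (v i) := by
  simp [hom]

/-- The curvature as a constant series. -/
def crv (x y : L) : D.Weyl⟦X⟧ := C (D.wcurv x y)

theorem hom_X_mul (c : ℕ) (v : Fin D.n → D.Weyl⟦X⟧) :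
    D.hom c (fun i => X * v i) = X * D.hom c v := by
  ext d
  cases d with
  | zero =>
    have : (fun _ : Fin D.n => (0 : D.Weyl)) = 0 := rfl
    simp [coeff_hom, coeff_zero_X_mul, this]
  | succ d => simp [coeff_hom, coeff_succ_X_mul]

theorem hom_smul (c : ℕ) (r : R) (v : Fin D.n → D.Weyl⟦X⟧) :
    D.hom c (fun i => r • v i) = r • D.hom c v := by
  ext d
  rw [PowerSeries.coeff_smul, coeff_hom, coeff_hom, ← map_smul]
  simp only [PowerSeries.coeff_smul]
  rfl

theorem agree_hom (c : ℕ) {d : ℕ} {v w : Fin D.n → D.Weyl⟦X⟧} (h : ∀ i, Agree d (v i) (w i)) :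
    Agree d (D.hom c v) (D.hom c w) := fun j hj => by
  rw [coeff_hom, coeff_hom, funext fun i => h i j hj]

theorem con_hom (c : ℕ) (v : Fin D.n → D.Weyl⟦X⟧) : D.con (D.hom c v) = 0 := by
  ext d
  simp [con, coeff_hom, wconst_homotopy]

theorem con_scal (a : R⟦X⟧) : D.con (D.scal a) = a := by
  ext d
  simp [con, scal, wconst_algebraMap]

theorem scal_commute (a : R⟦X⟧) (w : D.Weyl⟦X⟧) : D.scal a * w = w * D.scal a := by
  ext d
  rw [coeff_mul, coeff_mul, ← Finset.Nat.sum_antidiagonal_swap]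
  refine Finset.sum_congr rfl fun x _ => ?_
  simp only [scal, coeff_map, Prod.fst_swap, Prod.snd_swap]
  exact Algebra.commutes _ _

theorem con_scal_mul (a : R⟦X⟧) (w : D.Weyl⟦X⟧) : D.con (D.scal a * w) = a * D.con w := by
  ext d
  simp only [con, scal, coeff_coeffwise, coeff_mul, coeff_map, map_sum, ← Algebra.smul_def]
  simp

theorem del_scal (x : L) (a : R⟦X⟧) : D.del x (D.scal a) = 0 := by
  ext d
  simp [del, scal, wdelta_algebraMap]

theorem nab_scal (x : L) (c : k⟦X⟧) : D.nab x (D.scal (PowerSeries.map (algebraMap k R) c)) = 0 := by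
  ext d
  simp [nab, scal, wnabla_algebraMap]

theorem nab_mul (x : L) (v w : D.Weyl⟦X⟧) : D.nab x (v * w) = D.nab x v * w + v * D.nab x w :=
  coeffwise_mul _ (D.wnabla_mul x) v w

theorem del_mul (x : L) (v w : D.Weyl⟦X⟧) : D.del x (v * w) = D.del x v * w + v * D.del x w :=
  coeffwise_mul _ (D.wdelta_mul x) v w

theorem nab_X_mul (x : L) (w : D.Weyl⟦X⟧) : D.nab x (X * w) = X * D.nab x w :=
  coeffwise_X_mul _ w

theorem del_X_mul (x : L) (w : D.Weyl⟦X⟧) : D.del x (X * w) = X * D.del x w :=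
  coeffwise_X_mul _ w

theorem nab_add_left (x y : L) (w : D.Weyl⟦X⟧) : D.nab (x + y) w = D.nab x w + D.nab y w := by
  ext d; simp [nab, wnabla_add_left]

theorem nab_smul_left (r : R) (x : L) (w : D.Weyl⟦X⟧) : D.nab (r • x) w = r • D.nab x w := by
  ext d; simp [nab, wnabla_smul_left]

theorem nab_smul (x : L) (r : R) (w : D.Weyl⟦X⟧) :
    D.nab x (r • w) = D.anchor x r • w + r • D.nab x w := by
  ext d; simp [nab, wnabla_smul]

theorem del_add_left (x y : L) (w : D.Weyl⟦X⟧) : D.del (x + y) w = D.del x w + D.del y w := by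
  ext d; simp [del, wdelta_add]

theorem del_smul_left (r : R) (x : L) (w : D.Weyl⟦X⟧) : D.del (r • x) w = r • D.del x w := by
  ext d; simp [del, wdelta_smul]

theorem del_comm (x y : L) (w : D.Weyl⟦X⟧) : D.del x (D.del y w) = D.del y (D.del x w) := by
  ext d; simp [del, wdelta_comm D x y]

theorem nab_del (x y : L) (w : D.Weyl⟦X⟧) :
    D.nab x (D.del y w) = D.del y (D.nab x w) + D.del (D.conn x y) w := by
  ext d; simp [nab, del, wnabla_delta]

theorem nab_nab (x y : L) (w : D.Weyl⟦X⟧) :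
    D.nab x (D.nab y w) - D.nab y (D.nab x w) - D.nab (D.br x y) w =
      D.crv x y * w - w * D.crv x y := by
  ext d
  simpa [nab, crv, coeff_C_mul, coeff_mul_C] using D.wnabla_commutator x y (coeff d w)

theorem crv_add_left (x x' y : L) : D.crv (x + x') y = D.crv x y + D.crv x' y := by
  simp [crv, wcurv_add_left]

theorem crv_smul_left (r : R) (x y : L) : D.crv (r • x) y = r • D.crv x y := by
  rw [crv, wcurv_smul_left, crv]
  ext d
  simp [coeff_C]

theorem crv_skew (x y : L) : D.crv x y = - D.crv y x := by
  rw [crv, wcurv_skew, crv, map_neg]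

theorem crv_bianchi (x y z : L) :
    (D.nab x (D.crv y z) - D.crv (D.br x y) z) + (D.nab y (D.crv z x) - D.crv (D.br y z) x) +
    (D.nab z (D.crv x y) - D.crv (D.br z x) y) = 0 := by
  have hC : ∀ x (a : D.Weyl), D.nab x (C a) = C (D.wnabla x a) := fun x a => by
    ext d
    simp only [nab, coeff_coeffwise, coeff_C]
    split_ifs <;> simp
  simp only [crv, hC, ← map_sub, ← map_add, wcurv_bianchi, map_zero]

/-- The algebraic Bianchi identity. -/
theorem del_crv (x y z : L) :
    D.del x (D.crv y z) + D.del y (D.crv z x) + D.del z (D.crv x y) = 0 := by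
  have hC : ∀ x y z, D.del x (D.crv y z) =
      C ((2 * negQuarter k R) • D.wincl (D.curv y z x)) := fun x y z => by
    ext d
    have h : D.wdelta x (D.wcurv y z) = (2 * negQuarter k R) • D.wincl (D.curv y z x) :=
      D.delta_quad (D.curv y z) (D.curv_form y z) x
    simp only [del, crv, coeff_coeffwise, coeff_C, ← h]
    split_ifs <;> simp
  have hb : D.curv y z x + D.curv z x y + D.curv x y z = 0 := by
    have h := D.jacobi x y z
    simp only [conn_sub_right] at h
    simp only [curv_apply, br]
    rw [← neg_eq_zero, ← h]
    abel
  rw [hC, hC, hC, ← map_add, ← map_add, ← smul_add, ← smul_add, ← map_add, ← map_add, hb, map_zero,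
    smul_zero, map_zero]

theorem hom_del (w : D.Weyl⟦X⟧) :
    D.hom 0 (fun i => D.del (D.e i) w) = w - D.scal (D.con w) := by
  ext d
  have := D.whomotopy_delta (coeff d w)
  simpa [coeff_hom, del, scal, con] using this

theorem del_hom_one (Z : L → D.Weyl⟦X⟧) (hadd : ∀ x y, Z (x + y) = Z x + Z y)
    (hsmul : ∀ (r : R) x, Z (r • x) = r • Z x) (x : L) :
    D.del x (D.hom 0 fun i => Z (D.e i)) =
      Z x - D.hom 1 fun i => D.del (D.e i) (Z x) - D.del x (Z (D.e i)) := by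
  ext d
  have := D.wdelta_homotopy_one (fun x => coeff d (Z x)) (fun x y => by rw [hadd, map_add])
    (fun r x => by rw [hsmul, PowerSeries.coeff_smul]) x
  simpa [coeff_hom, del] using this

theorem del_hom_two (Z : L → L → D.Weyl⟦X⟧) (hadd : ∀ x x' y, Z (x + x') y = Z x y + Z x' y)
    (hsmul : ∀ (r : R) x y, Z (r • x) y = r • Z x y) (hZ : ∀ x y, Z x y = - Z y x) (x y : L) :
    D.del x (D.hom 1 fun i => Z (D.e i) y) - D.del y (D.hom 1 fun i => Z (D.e i) x) =
      Z x y - D.hom 2 fun i => D.del (D.e i) (Z x y) + D.del x (Z y (D.e i)) +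
        D.del y (Z (D.e i) x) := by
  ext d
  have := D.wdelta_homotopy_two (fun x y => coeff d (Z x y))
    (fun x x' y => by rw [hadd, map_add])
    (fun r x y => by rw [hsmul, PowerSeries.coeff_smul])
    (fun x y => by rw [hZ x y, map_neg]) x y
  simpa [coeff_hom, del] using this

end SymplecticData
end
end SheafQuantization

namespace SheafQuantization
noncomputable section

namespace SymplecticData

open PowerSeries

variable {k R L : Type*} [Field k] [CommRing R] [Algebra k R] [AddCommGroup L] [Module R L]
  (D : SymplecticData k R L) [CharZero k]

/-- The quadratic expression `Rm + ∇ρ + ½[ρ, ρ]` in the 1-form `ρ`, as a 2-form. -/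
def quadCurv (ρ : L → D.Weyl⟦X⟧) (x y : L) : D.Weyl⟦X⟧ :=
  D.crv x y + (D.nab x (ρ y) - D.nab y (ρ x) - ρ (D.br x y)) + (ρ x * ρ y - ρ y * ρ x)

/-- The Koszul differential of a 1-form. -/
def koszul (ρ : L → D.Weyl⟦X⟧) (x y : L) : D.Weyl⟦X⟧ := D.del x (ρ y) - D.del y (ρ x)

/-- The curvature of the connection `X ∇ - δ + X [ρ, ·]`, divided by `X`. -/
def omega (ρ : L → D.Weyl⟦X⟧) (x y : L) : D.Weyl⟦X⟧ := X * D.quadCurv ρ x y - D.koszul ρ x y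

/-- The exterior derivative of the 2-form `Z` with respect to `∇ + [ρ, ·]`. -/
def extDeriv (ρ : L → D.Weyl⟦X⟧) (Z : L → L → D.Weyl⟦X⟧) (x y z : L) : D.Weyl⟦X⟧ :=
  (D.nab x (Z y z) - Z (D.br x y) z + (ρ x * Z y z - Z y z * ρ x)) +
  (D.nab y (Z z x) - Z (D.br y z) x + (ρ y * Z z x - Z z x * ρ y)) +
  (D.nab z (Z x y) - Z (D.br z x) y + (ρ z * Z x y - Z x y * ρ z))

theorem br_jacobi (x y z : L) :
    D.br (D.br x y) z + D.br (D.br y z) x + D.br (D.br z x) y = 0 := D.jacobi x y z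

section Bianchi

variable (ρ : L → D.Weyl⟦X⟧) (hadd : ∀ x y, ρ (x + y) = ρ x + ρ y)

include hadd

theorem extDeriv_quadCurv (x y z : L) : D.extDeriv ρ (D.quadCurv ρ) x y z = 0 := by
  have h0 : ρ 0 = 0 := by simpa using hadd 0 0
  have h1 := D.nab_nab x y (ρ z)
  have h2 := D.nab_nab y z (ρ x)
  have h3 := D.nab_nab z x (ρ y)
  have h4 := D.crv_bianchi x y z
  have h5 := congrArg ρ (D.br_jacobi x y z)
  rw [hadd, hadd, h0] at h5
  rw [← sub_eq_zero] at h1 h2 h3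
  have key : D.extDeriv ρ (D.quadCurv ρ) x y z =
      (D.nab x (D.nab y (ρ z)) - D.nab y (D.nab x (ρ z)) - D.nab (D.br x y) (ρ z) -
        (D.crv x y * ρ z - ρ z * D.crv x y)) +
      (D.nab y (D.nab z (ρ x)) - D.nab z (D.nab y (ρ x)) - D.nab (D.br y z) (ρ x) -
        (D.crv y z * ρ x - ρ x * D.crv y z)) +
      (D.nab z (D.nab x (ρ y)) - D.nab x (D.nab z (ρ y)) - D.nab (D.br z x) (ρ y) -
        (D.crv z x * ρ y - ρ y * D.crv z x)) +
      ((D.nab x (D.crv y z) - D.crv (D.br x y) z) + (D.nab y (D.crv z x) - D.crv (D.br y z) x) +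
        (D.nab z (D.crv x y) - D.crv (D.br z x) y)) +
      (ρ (D.br (D.br x y) z) + ρ (D.br (D.br y z) x) + ρ (D.br (D.br z x) y)) := by
    simp only [extDeriv, quadCurv, map_add, map_sub, nab_mul]
    noncomm_ring
  rw [key, h1, h2, h3, h4, h5]
  simp

theorem koszul_quadCurv (x y z : L) :
    D.del x (D.quadCurv ρ y z) + D.del y (D.quadCurv ρ z x) + D.del z (D.quadCurv ρ x y) +
      D.extDeriv ρ (D.koszul ρ) x y z = 0 := by
  have h1 := D.del_crv x y z
  have e : ∀ x y, D.del (D.conn x y) = D.del (D.br x y) + D.del (D.conn y x) := fun x y => by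
    ext1 w
    rw [AddMonoidHom.add_apply, ← D.del_add_left, br, sub_add_cancel]
  have key : D.del x (D.quadCurv ρ y z) + D.del y (D.quadCurv ρ z x) +
      D.del z (D.quadCurv ρ x y) + D.extDeriv ρ (D.koszul ρ) x y z =
      D.del x (D.crv y z) + D.del y (D.crv z x) + D.del z (D.crv x y) := by
    simp only [extDeriv, koszul, quadCurv, map_add, map_sub, del_mul, nab_del, e x y, e y z,
      e z x, AddMonoidHom.add_apply]
    noncomm_ring
  rw [key, h1]

theorem koszul_koszul (x y z : L) :
    D.del x (D.koszul ρ y z) + D.del y (D.koszul ρ z x) + D.del z (D.koszul ρ x y) = 0 := by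
  simp only [koszul, map_sub, D.del_comm y x, D.del_comm z x, D.del_comm z y]
  abel

/-- The Bianchi identity for the connection `X ∇ - δ + X [ρ, ·]`. -/
theorem bianchi (x y z : L) :
    D.del x (D.omega ρ y z) + D.del y (D.omega ρ z x) + D.del z (D.omega ρ x y) =
      X * D.extDeriv ρ (D.omega ρ) x y z := by
  have h1 := D.extDeriv_quadCurv ρ hadd x y z
  have h2 := D.koszul_quadCurv ρ hadd x y z
  have h3 := D.koszul_koszul ρ hadd x y z
  have e : D.extDeriv ρ (D.omega ρ) x y z =
      X * D.extDeriv ρ (D.quadCurv ρ) x y z - D.extDeriv ρ (D.koszul ρ) x y z := by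
    have hX : ∀ v w : D.Weyl⟦X⟧, v * (X * w) = X * (v * w) := fun v w => by
      rw [← mul_assoc, ← (commute_X v).eq.symm, mul_assoc]
    simp only [extDeriv, omega, map_sub, nab_X_mul, mul_sub, sub_mul, hX, mul_add, mul_assoc]
    abel
  rw [e, h1, mul_zero, zero_sub, ← eq_neg_of_add_eq_zero_left h2]
  simp only [omega, map_sub, del_X_mul, mul_add]
  rw [← sub_eq_zero, ← neg_eq_zero, ← h3]
  abel

end Bianchi

/-- The 1-form with given components. -/
def ofComponents (s : Fin D.n → D.Weyl⟦X⟧) (x : L) : D.Weyl⟦X⟧ := ∑ i, D.form x (D.e' i) • s i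

theorem ofComponents_add (s : Fin D.n → D.Weyl⟦X⟧) (x y : L) :
    D.ofComponents s (x + y) = D.ofComponents s x + D.ofComponents s y := by
  simp [ofComponents, add_smul, Finset.sum_add_distrib]

theorem ofComponents_smul (s : Fin D.n → D.Weyl⟦X⟧) (r : R) (x : L) :
    D.ofComponents s (r • x) = r • D.ofComponents s x := by
  simp [ofComponents, mul_smul, Finset.smul_sum]

theorem ofComponents_e (s : Fin D.n → D.Weyl⟦X⟧) (i : Fin D.n) :
    D.ofComponents s (D.e i) = s i := by
  simp [ofComponents, D.form_e_e']

theorem eq_of_eq_e {N : Type*} [AddCommGroup N] [Module R N] {f g : L → N}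
    (hf : ∀ x y, f (x + y) = f x + f y) (hf' : ∀ (r : R) x, f (r • x) = r • f x)
    (hg : ∀ x y, g (x + y) = g x + g y) (hg' : ∀ (r : R) x, g (r • x) = r • g x)
    (h : ∀ i, f (D.e i) = g (D.e i)) (x : L) : f x = g x := by
  let F : L →ₗ[R] N := ⟨⟨f, hf⟩, hf'⟩
  let G : L →ₗ[R] N := ⟨⟨g, hg⟩, hg'⟩
  change F x = G x
  rw [← D.sum_form x, map_sum, map_sum]
  refine Finset.sum_congr rfl fun i _ => ?_
  rw [map_smul, map_smul]
  exact congrArg _ (h i)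

section Linear

variable {ρ : L → D.Weyl⟦X⟧} (hadd : ∀ x y, ρ (x + y) = ρ x + ρ y)
  (hsmul : ∀ (r : R) x, ρ (r • x) = r • ρ x)

include hadd

theorem form_neg (x : L) : ρ (-x) = - ρ x := by
  have h0 : ρ 0 = 0 := by simpa using hadd 0 0
  have h := hadd (-x) x
  rw [neg_add_cancel, h0] at h
  exact eq_neg_of_add_eq_zero_left h.symm

theorem quadCurv_skew (x y : L) : D.quadCurv ρ x y = - D.quadCurv ρ y x := by
  rw [quadCurv, quadCurv, crv_skew, br_skew, D.form_neg hadd]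
  abel

theorem quadCurv_add (x x' y : L) :
    D.quadCurv ρ (x + x') y = D.quadCurv ρ x y + D.quadCurv ρ x' y := by
  simp only [quadCurv, crv_add_left, nab_add_left, hadd, map_add, br_add_left, add_mul, mul_add]
  abel

include hsmul

theorem quadCurv_smul (r : R) (x y : L) :
    D.quadCurv ρ (r • x) y = r • D.quadCurv ρ x y := by
  have hs : ∀ x y, ρ (x - y) = ρ x - ρ y := fun x y => by
    rw [sub_eq_add_neg, hadd, D.form_neg hadd, sub_eq_add_neg]
  simp only [quadCurv, crv_smul_left, nab_smul_left, hsmul, nab_smul, br_smul_left, hs, smul_add,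
    smul_sub, smul_mul_assoc, mul_smul_comm]
  abel

end Linear

/-- Existence of the connection form: a solution of the fixed point equation of Fedosov. -/
theorem exists_fedosov_fixed : ∃ ρ : L → D.Weyl⟦X⟧, (∀ x y, ρ (x + y) = ρ x + ρ y) ∧
    (∀ (r : R) x, ρ (r • x) = r • ρ x) ∧
    ∀ x, ρ x = X * D.hom 1 fun i => D.quadCurv ρ (D.e i) x := by
  let mkS : (ℕ → Fin D.n → D.Weyl) → Fin D.n → D.Weyl⟦X⟧ := fun s i => PowerSeries.mk fun d => s d i
  let F : (ℕ → Fin D.n → D.Weyl) → ℕ → Fin D.n → D.Weyl := fun s d j =>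
    coeff d (X * D.hom 1 fun i => D.quadCurv (D.ofComponents (mkS s)) (D.e i) (D.e j))
  obtain ⟨s, hs⟩ := exists_fixed_of_causal F (by
    intro s t d h
    have h1 : ∀ i, Agree d (mkS s i) (mkS t i) := fun i j hj => by
      simp only [mkS, coeff_mk, h j hj]
    have h2 : ∀ x, Agree d (D.ofComponents (mkS s) x) (D.ofComponents (mkS t) x) := fun x =>
      Agree.sum _ fun i j hj => by rw [PowerSeries.coeff_smul, PowerSeries.coeff_smul, h1 i j hj]
    funext j
    refine (Agree.X_mul (d := d) (D.agree_hom 1 fun i => ?_)) d (by omega)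
    exact (Agree.rfl.add ((((h2 _).map _).sub ((h2 _).map _)).sub (h2 _))).add
      (((h2 _).mul (h2 _)).sub ((h2 _).mul (h2 _))))
  set ρ := D.ofComponents (mkS s) with hρ
  have ha := D.ofComponents_add (mkS s)
  have hm := D.ofComponents_smul (mkS s)
  refine ⟨ρ, ha, hm, D.eq_of_eq_e ha hm ?_ ?_ fun j => ?_⟩
  · intro x y
    rw [← mul_add, ← map_add]
    congr 2
    funext i
    rw [D.quadCurv_skew ha, D.quadCurv_add ha, D.quadCurv_skew ha x, D.quadCurv_skew ha y, neg_add,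
      neg_neg, neg_neg]
    rfl
  · intro r x
    have e : (fun i => D.quadCurv ρ (D.e i) (r • x)) = fun i => r • D.quadCurv ρ (D.e i) x := by
      funext i
      rw [D.quadCurv_skew ha, D.quadCurv_smul ha hm, D.quadCurv_skew ha x, smul_neg, neg_neg]
    rw [e, hom_smul, mul_smul_comm]
  · rw [hρ, ofComponents_e]
    ext d
    have := congrFun (hs d) j
    rw [coeff_mk, ← this]

/-- The connection form of the flat connection on formal series in the Weyl algebra. -/
def rho : L → D.Weyl⟦X⟧ := D.exists_fedosov_fixed.choose

theorem rho_add (x y : L) : D.rho (x + y) = D.rho x + D.rho y :=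
  D.exists_fedosov_fixed.choose_spec.1 x y

theorem rho_smul (r : R) (x : L) : D.rho (r • x) = r • D.rho x :=
  D.exists_fedosov_fixed.choose_spec.2.1 r x

theorem rho_eq (x : L) : D.rho x = X * D.hom 1 fun i => D.quadCurv D.rho (D.e i) x :=
  D.exists_fedosov_fixed.choose_spec.2.2 x

/-- The connection is flat. The homotopy formula and the Bianchi identity express its curvature
through `X` times an operator applied to the curvature itself, so that all coefficients vanish. -/
theorem omega_rho (x y : L) : D.omega D.rho x y = 0 := by
  have h : ∀ x y, D.omega D.rho x y = X * D.hom 2 fun i =>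
      D.extDeriv D.rho (D.omega D.rho) (D.e i) x y := by
    intro x y
    have hd : ∀ i, X * (D.del (D.e i) (D.quadCurv D.rho x y) + D.del x (D.quadCurv D.rho y (D.e i)) +
        D.del y (D.quadCurv D.rho (D.e i) x)) =
        X * D.extDeriv D.rho (D.omega D.rho) (D.e i) x y := fun i => by
      rw [← D.bianchi D.rho D.rho_add]
      have := D.koszul_koszul D.rho D.rho_add (D.e i) x y
      simp only [omega, map_sub, del_X_mul, mul_add]
      rw [← sub_eq_zero, ← this]
      abel
    have hk : D.koszul D.rho x y = X * (D.quadCurv D.rho x y - D.hom 2 fun i =>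
        D.del (D.e i) (D.quadCurv D.rho x y) + D.del x (D.quadCurv D.rho y (D.e i)) +
        D.del y (D.quadCurv D.rho (D.e i) x)) := by
      rw [koszul, D.rho_eq x, D.rho_eq y, del_X_mul, del_X_mul, ← mul_sub,
        D.del_hom_two _ (D.quadCurv_add D.rho_add) (D.quadCurv_smul D.rho_add D.rho_smul)
          (D.quadCurv_skew D.rho_add)]
    rw [omega, hk, mul_sub, sub_sub_cancel, ← hom_X_mul, ← hom_X_mul]
    exact congrArg (D.hom 2) (funext hd)
  have key : ∀ d x y, Agree d (D.omega D.rho x y) 0 := by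
    intro d
    induction d with
    | zero => exact fun _ _ i hi => absurd hi (by omega)
    | succ d ih =>
      intro x y
      have h0 : X * D.hom 2 (fun _ => (0 : D.Weyl⟦X⟧)) = 0 := by
        rw [show (fun _ : Fin D.n => (0 : D.Weyl⟦X⟧)) = 0 from rfl, map_zero, mul_zero]
      rw [h x y, ← h0]
      refine Agree.X_mul (D.agree_hom 2 fun i => ?_)
      have e : ∀ x y z, Agree d (D.nab x (D.omega D.rho y z) - D.omega D.rho (D.br x y) z +
          (D.rho x * D.omega D.rho y z - D.omega D.rho y z * D.rho x)) 0 := fun x y z => by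
        have : D.nab x 0 - 0 + (D.rho x * 0 - 0 * D.rho x) = 0 := by simp
        rw [← this]
        exact (((ih y z).map _).sub (ih _ z)).add
          ((Agree.rfl.mul (ih y z)).sub ((ih y z).mul Agree.rfl))
      have := ((e (D.e i) x y).add (e x y (D.e i))).add (e y (D.e i) x)
      rwa [add_zero, add_zero] at this
  exact Agree.eq fun d => key d x y

theorem koszul_rho (x y : L) : D.koszul D.rho x y = X * D.quadCurv D.rho x y :=
  (sub_eq_zero.1 (D.omega_rho x y)).symm

/-! ### Flat sections -/

/-- The covariant derivative `∇_x w + [ρ_x, w]`. -/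
def cov (x : L) : D.Weyl⟦X⟧ →+ D.Weyl⟦X⟧ :=
  D.nab x + AddMonoidHom.mulLeft (D.rho x) - AddMonoidHom.mulRight (D.rho x)

theorem cov_apply (x : L) (w : D.Weyl⟦X⟧) :
    D.cov x w = D.nab x w + D.rho x * w - w * D.rho x := rfl

theorem cov_mul (x : L) (v w : D.Weyl⟦X⟧) : D.cov x (v * w) = D.cov x v * w + v * D.cov x w := by
  simp only [cov_apply, nab_mul]
  noncomm_ring

theorem cov_X_mul (x : L) (w : D.Weyl⟦X⟧) : D.cov x (X * w) = X * D.cov x w := by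
  have hX : D.rho x * (X * w) = X * (D.rho x * w) := by
    rw [← mul_assoc, ← (commute_X _).eq.symm, mul_assoc]
  rw [cov_apply, cov_apply, nab_X_mul, hX, mul_sub, mul_add, mul_assoc]

theorem cov_add_left (x y : L) (w : D.Weyl⟦X⟧) : D.cov (x + y) w = D.cov x w + D.cov y w := by
  simp only [cov_apply, nab_add_left, rho_add]
  noncomm_ring

theorem cov_smul_left (r : R) (x : L) (w : D.Weyl⟦X⟧) : D.cov (r • x) w = r • D.cov x w := by
  simp only [cov_apply, nab_smul_left, rho_smul, smul_mul_assoc, mul_smul_comm, smul_add, smul_sub]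

theorem agree_cov (x : L) {d : ℕ} {v w : D.Weyl⟦X⟧} (h : Agree d v w) :
    Agree d (D.cov x v) (D.cov x w) :=
  ((h.map _).add (Agree.rfl.mul h)).sub (h.mul Agree.rfl)

/-- A formal series in the Weyl algebra is flat if it is annihilated by the flat connection. -/
def IsFlat (w : D.Weyl⟦X⟧) : Prop := ∀ x, D.del x w = X * D.cov x w

variable {D} in
theorem IsFlat.mul {v w : D.Weyl⟦X⟧} (hv : D.IsFlat v) (hw : D.IsFlat w) : D.IsFlat (v * w) := by
  intro x
  rw [del_mul, hv x, hw x, cov_mul, mul_add, mul_assoc, ← mul_assoc v, ← (commute_X v).eq.symm,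
    mul_assoc]

variable {D} in
theorem IsFlat.sub {v w : D.Weyl⟦X⟧} (hv : D.IsFlat v) (hw : D.IsFlat w) : D.IsFlat (v - w) := by
  intro x
  rw [map_sub, map_sub, hv x, hw x, mul_sub]

variable {D} in
theorem IsFlat.add {v w : D.Weyl⟦X⟧} (hv : D.IsFlat v) (hw : D.IsFlat w) : D.IsFlat (v + w) := by
  intro x
  rw [map_add, map_add, hv x, hw x, mul_add]

/-- Formal series of constants are flat. -/
theorem isFlat_scal (c : k⟦X⟧) : D.IsFlat (D.scal (PowerSeries.map (algebraMap k R) c)) := by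
  intro x
  rw [del_scal, cov_apply, nab_scal, zero_add, ← scal_commute, sub_self, mul_zero]

/-- A flat section is determined by its constant terms. -/
theorem IsFlat.eq_zero {w : D.Weyl⟦X⟧} (hw : D.IsFlat w) (h0 : D.con w = 0) : w = 0 := by
  have h : w = X * D.hom 0 fun i => D.cov (D.e i) w := by
    have := D.hom_del w
    rw [h0, map_zero, sub_zero, funext fun i => hw (D.e i), hom_X_mul] at this
    exact this.symm
  have key : ∀ d, Agree d w 0 := by
    intro d
    induction d with
    | zero => exact fun i hi => absurd hi (by omega)
    | succ d ih =>
      have h0 : X * D.hom 0 (fun i => D.cov (D.e i) 0) = 0 := by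
        simp only [map_zero]
        rw [show (fun _ : Fin D.n => (0 : D.Weyl⟦X⟧)) = 0 from rfl, map_zero, mul_zero]
      rw [h, ← h0]
      exact Agree.X_mul (D.agree_hom 0 fun i => D.agree_cov _ ih)
  exact Agree.eq key

theorem IsFlat.ext {v w : D.Weyl⟦X⟧} (hv : D.IsFlat v) (hw : D.IsFlat w)
    (h : D.con v = D.con w) : v = w :=
  sub_eq_zero.1 ((hv.sub hw).eq_zero D (by rw [map_sub, h, sub_self]))

/-- The connection `X cov - δ` is flat. -/
theorem cov_commutator (x y : L) (w : D.Weyl⟦X⟧) :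
    X * (D.cov x (D.cov y w) - D.cov y (D.cov x w) - D.cov (D.br x y) w) =
      (D.cov x (D.del y w) - D.del y (D.cov x w)) - (D.cov y (D.del x w) - D.del x (D.cov y w)) -
        D.del (D.br x y) w := by
  have h1 : D.cov x (D.cov y w) - D.cov y (D.cov x w) - D.cov (D.br x y) w =
      D.quadCurv D.rho x y * w - w * D.quadCurv D.rho x y := by
    have := D.nab_nab x y w
    rw [← sub_eq_zero] at this ⊢
    rw [← this]
    simp only [cov_apply, quadCurv, map_add, map_sub, nab_mul]
    noncomm_ring
  have h2 : (D.cov x (D.del y w) - D.del y (D.cov x w)) -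
      (D.cov y (D.del x w) - D.del x (D.cov y w)) - D.del (D.br x y) w =
      D.koszul D.rho x y * w - w * D.koszul D.rho x y := by
    have e : D.del (D.conn x y) w = D.del (D.br x y) w + D.del (D.conn y x) w := by
      rw [← D.del_add_left, br, sub_add_cancel]
    simp only [cov_apply, koszul, map_add, map_sub, del_mul, nab_del, e]
    noncomm_ring
  rw [h1, h2, koszul_rho, mul_sub, mul_assoc, ← mul_assoc w, ← (commute_X w).eq.symm, mul_assoc]

/-- Every formal series of scalars is the series of constant terms of a flat section. -/
theorem exists_isFlat (a : R⟦X⟧) : ∃ w, D.IsFlat w ∧ D.con w = a := by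
  let F : (ℕ → D.Weyl) → ℕ → D.Weyl := fun s d =>
    coeff d (D.scal a + X * D.hom 0 fun i => D.cov (D.e i) (PowerSeries.mk s))
  obtain ⟨s, hs⟩ := exists_fixed_of_causal F (by
    intro s t d h
    have h1 : Agree d (PowerSeries.mk s) (PowerSeries.mk t) := fun j hj => by
      simp only [coeff_mk, h j hj]
    exact (Agree.rfl.add (Agree.X_mul (D.agree_hom 0 fun i => D.agree_cov _ h1))) d (by omega))
  set w := PowerSeries.mk s with hw
  have hfix : w = D.scal a + X * D.hom 0 fun i => D.cov (D.e i) w := by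
    ext d
    rw [hw, coeff_mk, ← hs d]
  refine ⟨w, ?_, ?_⟩
  · -- `Q x` is the failure of flatness; it equals `X` times an operator applied to `Q`.
    let Q : L → D.Weyl⟦X⟧ := fun x => X * D.cov x w - D.del x w
    have hdel : ∀ x, D.del x w = X * (D.cov x w - D.hom 1 fun i =>
        D.del (D.e i) (D.cov x w) - D.del x (D.cov (D.e i) w)) := fun x => by
      conv_lhs => rw [hfix]
      rw [map_add, del_scal, zero_add, del_X_mul,
        D.del_hom_one (fun x => D.cov x w) (fun x y => D.cov_add_left x y w)
          (fun r x => D.cov_smul_left r x w)]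
    have hQ : ∀ x, Q x = X * D.hom 1 fun i =>
        D.cov (D.e i) (Q x) - D.cov x (Q (D.e i)) - Q (D.br (D.e i) x) := fun x => by
      have e : ∀ i, X * (D.del (D.e i) (D.cov x w) - D.del x (D.cov (D.e i) w)) =
          X * (D.cov (D.e i) (Q x) - D.cov x (Q (D.e i)) - Q (D.br (D.e i) x)) := fun i => by
        have := D.cov_commutator (D.e i) x w
        congr 1
        simp only [Q, map_sub, cov_X_mul]
        simp only [mul_sub] at this
        rw [← sub_eq_zero] at this ⊢
        rw [← neg_eq_zero, ← this]
        abel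
      change X * D.cov x w - D.del x w = _
      rw [hdel, mul_sub, sub_sub_cancel, ← hom_X_mul, ← hom_X_mul]
      exact congrArg (D.hom 1) (funext e)
    have key : ∀ d x, Agree d (Q x) 0 := by
      intro d
      induction d with
      | zero => exact fun _ i hi => absurd hi (by omega)
      | succ d ih =>
        intro x
        have h0 : X * D.hom 1 (fun i => D.cov (D.e i) 0 - D.cov x 0 - 0) = 0 := by
          simp only [map_zero, sub_self]
          rw [show (fun _ : Fin D.n => (0 : D.Weyl⟦X⟧)) = 0 from rfl, map_zero, mul_zero]
        rw [hQ x, ← h0]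
        exact Agree.X_mul (D.agree_hom 1 fun i =>
          ((D.agree_cov _ (ih x)).sub (D.agree_cov _ (ih _))).sub (ih _))
    intro x
    exact (sub_eq_zero.1 (Agree.eq fun d => key d x)).symm
  · rw [hfix, map_add, con_scal]
    have : D.con (X * D.hom 0 fun i => D.cov (D.e i) w) =
        X * D.con (D.hom 0 fun i => D.cov (D.e i) w) := coeffwise_X_mul _ _
    rw [this, con_hom, mul_zero, add_zero]

/-- The flat section with given constant terms. -/
def flat (a : R⟦X⟧) : D.Weyl⟦X⟧ := (D.exists_isFlat a).choose

theorem isFlat_flat (a : R⟦X⟧) : D.IsFlat (D.flat a) := (D.exists_isFlat a).choose_spec.1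

theorem con_flat (a : R⟦X⟧) : D.con (D.flat a) = a := (D.exists_isFlat a).choose_spec.2

theorem flat_con {w : D.Weyl⟦X⟧} (hw : D.IsFlat w) : D.flat (D.con w) = w :=
  (D.isFlat_flat _).ext D hw (D.con_flat _)

theorem flat_add (a b : R⟦X⟧) : D.flat (a + b) = D.flat a + D.flat b :=
  (D.isFlat_flat _).ext D ((D.isFlat_flat a).add (D.isFlat_flat b)) (by
    rw [map_add, con_flat, con_flat, con_flat])

theorem flat_const (c : k⟦X⟧) : D.flat (PowerSeries.map (algebraMap k R) c) =
    D.scal (PowerSeries.map (algebraMap k R) c) :=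
  (D.isFlat_flat _).ext D (D.isFlat_scal c) (by rw [con_flat, con_scal])

theorem flat_const_mul (c : k⟦X⟧) (a : R⟦X⟧) :
    D.flat (PowerSeries.map (algebraMap k R) c * a) =
      D.scal (PowerSeries.map (algebraMap k R) c) * D.flat a :=
  (D.isFlat_flat _).ext D ((D.isFlat_scal c).mul (D.isFlat_flat a)) (by
    rw [con_flat, con_scal_mul, con_flat])

theorem flat_one : D.flat 1 = 1 := by
  have := D.flat_const 1
  rwa [map_one, map_one] at this

end SymplecticData
end
end SheafQuantization

namespace SheafQuantization
noncomputable section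

/-! ### Functoriality -/

open PowerSeries

theorem map_invSucc {k R R' : Type*} [Field k] [CommRing R] [Algebra k R] [CommRing R']
    [Algebra k R'] (h : R →ₐ[k] R') (m : ℕ) : h (invSucc k R m) = invSucc k R' m :=
  h.commutes _

/-- A morphism of symplectic Lie–Rinehart algebras with connection, over a morphism `h` of base
rings. The image of the basis is required to generate the target, with the image of the dual basis
as its dual. The sign `η` is auxiliary: the induced map of symmetric algebras multiplies `L` by
`η`, so that for `η = -1` the identity of `L` induces the parity automorphism. -/
structure SymplecticHom {k R L R' L' : Type*} [Field k] [CommRing R] [Algebra k R]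
    [AddCommGroup L] [Module R L] [CommRing R'] [Algebra k R'] [AddCommGroup L'] [Module R' L']
    (D : SymplecticData k R L) (D' : SymplecticData k R' L') where
  /-- the map of base rings -/
  h : R →ₐ[k] R'
  /-- the map of modules -/
  s : L → L'
  /-- the sign -/
  η : ℤ
  sign : η * η = 1
  map_add : ∀ x y, s (x + y) = s x + s y
  map_smul : ∀ (r : R) x, s (r • x) = h r • s x
  map_form : ∀ x y, D'.form (s x) (s y) = h (D.form x y)
  map_conn : ∀ x y, D'.conn (s x) (s y) = s (D.conn x y)
  map_anchor : ∀ x a, D'.anchor (s x) (h a) = h (D.anchor x a)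
  generates : ∀ x, ∑ i, D'.form x (s (D.e' i)) • s (D.e i) = x

namespace SymplecticHom

variable {k R L R' L' : Type*} [Field k] [CommRing R] [Algebra k R]
  [AddCommGroup L] [Module R L] [CommRing R'] [Algebra k R'] [AddCommGroup L'] [Module R' L']
  {D : SymplecticData k R L} {D' : SymplecticData k R' L'} (F : SymplecticHom D D')

theorem sign_sign {N : Type*} [AddCommGroup N] (a : N) : F.η • F.η • a = a := by
  rw [smul_smul, F.sign, one_smul]

/-- `s` as an additive map. -/
def sAdd : L →+ L' := AddMonoidHom.mk' F.s F.map_add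

theorem map_sub (x y : L) : F.s (x - y) = F.s x - F.s y := F.sAdd.map_sub x y

theorem map_br (x y : L) : D'.br (F.s x) (F.s y) = F.s (D.br x y) := by
  rw [SymplecticData.br, F.map_conn, F.map_conn, ← F.map_sub]
  rfl

/-- The induced homomorphism of symmetric algebras. -/
def poly : D.Poly →+* D'.Poly :=
  MvPolynomial.eval₂Hom (MvPolynomial.C.comp (F.h : R →+* R')) fun i => F.η • D'.incl (F.s (D.e i))

theorem poly_C (r : R) : F.poly (MvPolynomial.C r) = MvPolynomial.C (F.h r) := by
  simp [poly]

theorem poly_smul (r : R) (p : D.Poly) : F.poly (r • p) = F.h r • F.poly p := by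
  rw [MvPolynomial.smul_eq_C_mul, map_mul, poly_C, MvPolynomial.smul_eq_C_mul]

theorem poly_incl (x : L) : F.poly (D.incl x) = F.η • D'.incl (F.s x) := by
  have h1 : F.s x = ∑ i, F.h (D.form x (D.e' i)) • F.s (D.e i) := by
    conv_lhs => rw [← D.sum_form x]
    refine (map_sum F.sAdd _ _).trans (Finset.sum_congr rfl fun i _ => F.map_smul _ _)
  rw [D.incl_apply, h1, _root_.map_sum, _root_.map_sum, Finset.smul_sum]
  refine Finset.sum_congr rfl fun i _ => ?_
  rw [poly_smul, _root_.map_smul, smul_comm F.η]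
  simp [poly]

theorem poly_delta (x : L) (p : D.Poly) :
    F.poly (D.delta x p) = F.η • D'.delta (F.s x) (F.poly p) := by
  induction p using D.poly_induction with
  | hC r => simp [poly_C]
  | hadd p q hp hq => simp only [_root_.map_add, hp, hq, smul_add]
  | hmul p y hp =>
    simp only [Derivation.leibniz, D.delta_incl, smul_eq_mul, _root_.map_add, _root_.map_mul,
      poly_C, hp, poly_incl, D'.delta_incl, F.map_form, smul_add,
      _root_.map_zsmul, mul_smul_comm, smul_mul_assoc, F.sign_sign]

theorem poly_nabla (x : L) (p : D.Poly) :
    F.poly (D.nabla x p) = D'.nabla (F.s x) (F.poly p) := by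
  induction p using D.poly_induction with
  | hC r => rw [D.nabla_C, poly_C, poly_C, D'.nabla_C, F.map_anchor]
  | hadd p q hp hq => simp only [_root_.map_add, hp, hq]
  | hmul p y hp =>
    simp only [D.nabla_mul, D.nabla_incl, _root_.map_add, _root_.map_mul, poly_incl, hp,
      D'.nabla_mul, _root_.map_zsmul, D'.nabla_incl, F.map_conn]

theorem sum_canonical {M : Type*} [AddCommGroup M] [Module R' M] (B : L' →ₗ[R'] L' →ₗ[R'] M) :
    ∑ i, B (F.s (D.e i)) (F.s (D.e' i)) = ∑ i, B (D'.e i) (D'.e' i) :=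
  D'.sum_canonical B _ _ F.generates

theorem poly_star (m : ℕ) (a b : D.Poly) :
    F.poly (D.star m a b) = D'.star m (F.poly a) (F.poly b) := by
  induction m generalizing a b with
  | zero => exact _root_.map_mul F.poly a b
  | succ m ih =>
    rw [D.star_succ, D'.star_succ, poly_smul, map_invSucc, _root_.map_sum]
    congr 1
    refine Eq.trans ?_ (F.sum_canonical (D'.starDelta m (F.poly a) (F.poly b)))
    refine Finset.sum_congr rfl fun i _ => ?_
    rw [ih, poly_delta, poly_delta, _root_.map_zsmul, _root_.map_zsmul, LinearMap.smul_apply,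
      F.sign_sign]
    rfl

theorem poly_wmul (a b : D.Poly) : F.poly (D.wmul a b) = D'.wmul (F.poly a) (F.poly b) := by
  obtain ⟨N, hN⟩ := D.isKilled a
  obtain ⟨N', hN'⟩ := D'.isKilled (F.poly a)
  rw [D.wmul_eq_of_isKilled _ (hN.mono (le_max_left N N')),
    D'.wmul_eq_of_isKilled _ (hN'.mono (le_max_right N N')), _root_.map_sum]
  exact Finset.sum_congr rfl fun m _ => F.poly_star m a b

theorem poly_euler (p : D.Poly) : F.poly (D.euler p) = D'.euler (F.poly p) := by
  induction p using D.poly_induction with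
  | hC r => simp [poly_C, SymplecticData.euler]
  | hadd p q hp hq => simp only [_root_.map_add, hp, hq]
  | hmul p y hp =>
    simp only [Derivation.leibniz, D.euler_incl, smul_eq_mul, _root_.map_add, _root_.map_mul, hp,
      poly_incl, _root_.map_zsmul, D'.euler_incl]

theorem poly_constantCoeff (p : D.Poly) :
    MvPolynomial.constantCoeff (F.poly p) = F.h (MvPolynomial.constantCoeff p) := by
  have hi : ∀ x, MvPolynomial.constantCoeff (D'.incl x) = 0 := fun x => by
    simp [SymplecticData.incl_apply, MvPolynomial.smul_eq_C_mul]
  have : (MvPolynomial.constantCoeff).comp F.poly =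
      (F.h : R →+* R').comp MvPolynomial.constantCoeff := by
    refine MvPolynomial.ringHom_ext (fun r => ?_) fun i => ?_
    · simp [poly_C]
    · simp [poly, hi]
  exact RingHom.congr_fun this p

theorem poly_quad (Q : L →ₗ[R] L) (Q' : L' →ₗ[R'] L') (hQ : ∀ x, Q' (F.s x) = F.s (Q x)) :
    F.poly (D.quad Q) = D'.quad Q' := by
  have hn : F.h (SymplecticData.negQuarter k R) = SymplecticData.negQuarter k R' := F.h.commutes _
  have hc := F.sum_canonical ((LinearMap.mul R' D'.Poly).compl₁₂ (D'.incl ∘ₗ Q') D'.incl)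
  simp only [LinearMap.compl₁₂_apply, LinearMap.comp_apply, LinearMap.mul_apply'] at hc
  rw [SymplecticData.quad, SymplecticData.quad, poly_smul, hn, _root_.map_sum]
  congr 1
  rw [Finset.sum_congr rfl fun i _ => mul_comm (D'.incl (D'.e' i)) _, ← hc]
  refine Finset.sum_congr rfl fun i _ => ?_
  rw [_root_.map_mul, poly_incl, poly_incl, hQ, mul_comm, smul_mul_smul_comm, F.sign, one_smul]

section CharZero

variable [CharZero k]

theorem map_curv (x y z : L) : D'.curv (F.s x) (F.s y) (F.s z) = F.s (D.curv x y z) := by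
  simp only [SymplecticData.curv_apply, F.map_conn, F.map_br, F.map_sub]

theorem poly_invEuler (c : ℕ) (p : D.Poly) :
    F.poly (D.invEuler c p) = D'.invEuler c (F.poly p) := by
  have hc : F.h ((c : R) + 1) = (c : R') + 1 := by simp
  conv_rhs => rw [← D.euler_invEuler c p, _root_.map_add, poly_smul, poly_euler, hc,
    D'.invEuler_euler]

theorem poly_homotopy (c : ℕ) (Z : L → D.Poly) (Z' : L' →ₗ[R'] D'.Poly)
    (hZ : ∀ x, F.poly (Z x) = Z' (F.s x)) :
    F.poly (D.homotopy c fun i => Z (D.e i)) = F.η • D'.homotopy c fun i => Z' (D'.e i) := by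
  have hc := F.sum_canonical ((LinearMap.mul R' D'.Poly).compl₁₂ (D'.invEuler c ∘ₗ Z') D'.incl)
  simp only [LinearMap.compl₁₂_apply, LinearMap.comp_apply, LinearMap.mul_apply'] at hc
  rw [D.homotopy_apply, D'.homotopy_apply, _root_.map_sum,
    Finset.sum_congr rfl fun i _ => mul_comm (D'.incl (D'.e' i)) _, ← hc, Finset.smul_sum]
  refine Finset.sum_congr rfl fun i _ => ?_
  rw [_root_.map_mul, poly_incl, poly_invEuler, hZ, smul_mul_assoc, mul_comm]

/-- The induced homomorphism of Weyl algebras. -/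
def weyl : D.Weyl →+* D'.Weyl where
  toFun := F.poly
  map_one' := _root_.map_one F.poly
  map_mul' := F.poly_wmul
  map_zero' := _root_.map_zero F.poly
  map_add' := _root_.map_add F.poly

theorem weyl_smul (r : R) (a : D.Weyl) : F.weyl (r • a) = F.h r • F.weyl a := F.poly_smul r a

theorem weyl_wdelta (x : L) (a : D.Weyl) :
    F.weyl (D.wdelta x a) = F.η • D'.wdelta (F.s x) (F.weyl a) := F.poly_delta x a

theorem weyl_wnabla (x : L) (a : D.Weyl) :
    F.weyl (D.wnabla x a) = D'.wnabla (F.s x) (F.weyl a) := F.poly_nabla x a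

theorem weyl_wcurv (x y : L) : F.weyl (D.wcurv x y) = D'.wcurv (F.s x) (F.s y) :=
  F.poly_quad _ _ (F.map_curv x y)

theorem weyl_wconst (a : D.Weyl) : D'.wconst (F.weyl a) = F.h (D.wconst a) :=
  F.poly_constantCoeff a

theorem weyl_whomotopy (c : ℕ) (Z : L → D.Weyl) (Z' : L' → D'.Weyl)
    (hadd : ∀ x y, Z' (x + y) = Z' x + Z' y) (hsmul : ∀ (r : R') x, Z' (r • x) = r • Z' x)
    (hZ : ∀ x, F.weyl (Z x) = Z' (F.s x)) :
    F.weyl (D.whomotopy c fun i => Z (D.e i)) = F.η • D'.whomotopy c fun i => Z' (D'.e i) :=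
  F.poly_homotopy c Z ⟨⟨Z', hadd⟩, hsmul⟩ hZ

/-- The additive map of formal series induced by `g`, which replaces the variable `X` by
`η * X`. -/
def series {A B : Type*} [Ring A] [Ring B] (g : A →+ B) : A⟦X⟧ →+ B⟦X⟧ where
  toFun w := PowerSeries.mk fun d => F.η ^ d • g (coeff d w)
  map_zero' := by ext; simp
  map_add' v w := by ext; simp

theorem coeff_series {A B : Type*} [Ring A] [Ring B] (g : A →+ B) (w : A⟦X⟧) (d : ℕ) :
    coeff d (F.series g w) = F.η ^ d • g (coeff d w) := by
  simp [series]

theorem series_mul {A B : Type*} [Ring A] [Ring B] (g : A →+* B) (v w : A⟦X⟧) :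
    F.series (g : A →+ B) (v * w) = F.series (g : A →+ B) v * F.series (g : A →+ B) w := by
  ext d
  rw [coeff_series, coeff_mul, coeff_mul, _root_.map_sum, Finset.smul_sum]
  refine Finset.sum_congr rfl fun x hx => ?_
  rw [coeff_series, coeff_series, smul_mul_smul_comm, ← pow_add,
    Finset.HasAntidiagonal.mem_antidiagonal.1 hx]
  simp

theorem series_X_mul {A B : Type*} [Ring A] [Ring B] (g : A →+ B) (w : A⟦X⟧) :
    F.series g (X * w) = F.η • (X * F.series g w) := by
  ext d
  rw [coeff_series, _root_.map_zsmul]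
  cases d with
  | zero => simp [coeff_zero_X_mul]
  | succ d => rw [coeff_succ_X_mul, coeff_succ_X_mul, coeff_series, smul_smul, pow_succ']

/-- The induced map on formal series in the Weyl algebra. -/
def ser : D.Weyl⟦X⟧ →+ D'.Weyl⟦X⟧ := F.series (F.weyl : D.Weyl →+ D'.Weyl)

/-- The induced map on formal series of scalars. -/
def base : R⟦X⟧ →+ R'⟦X⟧ := F.series ((F.h : R →+* R') : R →+ R')

theorem ser_mul (v w : D.Weyl⟦X⟧) : F.ser (v * w) = F.ser v * F.ser w := F.series_mul F.weyl v w

theorem ser_X_mul (w : D.Weyl⟦X⟧) : F.ser (X * w) = F.η • (X * F.ser w) := F.series_X_mul _ w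

theorem ser_smul (r : R) (w : D.Weyl⟦X⟧) : F.ser (r • w) = F.h r • F.ser w := by
  ext d
  rw [ser, coeff_series, PowerSeries.coeff_smul, PowerSeries.coeff_smul, coeff_series, smul_comm]
  congr 1
  exact F.weyl_smul _ _

theorem ser_nab (x : L) (w : D.Weyl⟦X⟧) : F.ser (D.nab x w) = D'.nab (F.s x) (F.ser w) := by
  ext d
  simp only [ser, SymplecticData.nab, coeff_series, coeff_coeffwise, _root_.map_zsmul]
  congr 1
  exact F.weyl_wnabla _ _

theorem ser_del (x : L) (w : D.Weyl⟦X⟧) : F.ser (D.del x w) = F.η • D'.del (F.s x) (F.ser w) := by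
  ext d
  simp only [ser, SymplecticData.del, coeff_series, coeff_coeffwise, _root_.map_zsmul]
  rw [smul_comm]
  congr 1
  exact F.weyl_wdelta _ _

theorem ser_crv (x y : L) : F.ser (D.crv x y) = D'.crv (F.s x) (F.s y) := by
  ext d
  simp only [ser, SymplecticData.crv, coeff_series, coeff_C]
  split_ifs with h
  · rw [h, pow_zero, one_smul]
    exact F.weyl_wcurv x y
  · simp

theorem con_ser (w : D.Weyl⟦X⟧) : D'.con (F.ser w) = F.base (D.con w) := by
  ext d
  simp only [ser, base, SymplecticData.con, coeff_series, coeff_coeffwise, _root_.map_zsmul]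
  congr 1
  exact F.weyl_wconst _

theorem ser_hom (c : ℕ) (Z : L → D.Weyl⟦X⟧) (Z' : L' → D'.Weyl⟦X⟧)
    (hadd : ∀ x y, Z' (x + y) = Z' x + Z' y) (hsmul : ∀ (r : R') x, Z' (r • x) = r • Z' x)
    (hZ : ∀ x, F.ser (Z x) = Z' (F.s x)) :
    F.ser (D.hom c fun i => Z (D.e i)) = F.η • D'.hom c fun i => Z' (D'.e i) := by
  ext d
  have h := F.weyl_whomotopy c (fun x => F.η ^ d • coeff d (Z x)) (fun x => coeff d (Z' x))
    (fun x y => by rw [hadd, _root_.map_add]) (fun r x => by rw [hsmul, PowerSeries.coeff_smul])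
    (fun x => by rw [← hZ, ser, coeff_series, _root_.map_zsmul]; rfl)
  rw [_root_.map_zsmul, D'.coeff_hom, ← h, ser, coeff_series, D.coeff_hom]
  refine (_root_.map_zsmul (F.weyl : D.Weyl →+ D'.Weyl) _ _).symm.trans ?_
  change F.weyl _ = F.weyl _
  congr 1
  exact (_root_.map_zsmul (D.whomotopy c) (F.η ^ d) _).symm

theorem ser_quadCurv (ρ : L → D.Weyl⟦X⟧) (ρ' : L' → D'.Weyl⟦X⟧) (h : ∀ x, F.ser (ρ x) = ρ' (F.s x))
    (x y : L) : F.ser (D.quadCurv ρ x y) = D'.quadCurv ρ' (F.s x) (F.s y) := by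
  simp only [SymplecticData.quadCurv, _root_.map_add, _root_.map_sub, ser_mul, ser_nab, ser_crv, h,
    F.map_br]

/-- The connection form is natural: the equation defining it has only one linear solution. -/
theorem ser_rho (x : L) : F.ser (D.rho x) = D'.rho (F.s x) := by
  let ρ : L' → D'.Weyl⟦X⟧ := fun x => ∑ i, D'.form x (F.s (D.e' i)) • F.ser (D.rho (D.e i))
  have hadd : ∀ x y, ρ (x + y) = ρ x + ρ y := fun x y => by
    simp [ρ, add_smul, Finset.sum_add_distrib]
  have hsmul : ∀ (r : R') x, ρ (r • x) = r • ρ x := fun r x => by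
    simp [ρ, mul_smul, Finset.smul_sum]
  have hρ : ∀ x, F.ser (D.rho x) = ρ (F.s x) := fun x => by
    have h : D.rho x = ∑ i, D.form x (D.e' i) • D.rho (D.e i) := by
      refine D.eq_of_eq_e D.rho_add D.rho_smul (g := fun x => ∑ i, D.form x (D.e' i) • D.rho (D.e i))
        (fun x y => by simp [add_smul, Finset.sum_add_distrib])
        (fun r x => by simp [mul_smul, Finset.smul_sum]) (fun j => by simp [D.form_e_e']) x
    rw [h, _root_.map_sum]
    exact Finset.sum_congr rfl fun i _ => by rw [ser_smul, F.map_form]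
  have hfix0 : ∀ x, ρ (F.s x) = X * D'.hom 1 fun i => D'.quadCurv ρ (D'.e i) (F.s x) := fun x => by
    rw [← hρ, D.rho_eq, ser_X_mul, F.ser_hom 1 (fun y => D.quadCurv D.rho y x)
      (fun y => D'.quadCurv ρ y (F.s x)) (fun y y' => D'.quadCurv_add hadd y y' _)
      (fun r y => D'.quadCurv_smul hadd hsmul r y _) (fun y => F.ser_quadCurv _ _ hρ y x),
      mul_smul_comm, F.sign_sign]
  -- Both sides of the equation for `ρ` are linear, so that it suffices to check it on generators.
  have hfix : ∀ x, ρ x = X * D'.hom 1 fun i => D'.quadCurv ρ (D'.e i) x := by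
    have hr : ∀ x y, D'.quadCurv ρ y x = - D'.quadCurv ρ x y := fun x y =>
      D'.quadCurv_skew hadd y x
    let G : L' →ₗ[R'] D'.Weyl⟦X⟧ :=
      { toFun := fun x => X * D'.hom 1 fun i => D'.quadCurv ρ (D'.e i) x
        map_add' := fun x y => by
          rw [← mul_add, ← _root_.map_add]
          refine congrArg (fun v => X * D'.hom 1 v) (funext fun i => ?_)
          rw [hr, D'.quadCurv_add hadd, neg_add, ← hr, ← hr]
          rfl
        map_smul' := fun r x => by
          have e : (fun i => D'.quadCurv ρ (D'.e i) (r • x)) =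
              fun i => r • D'.quadCurv ρ (D'.e i) x := by
            funext i
            rw [hr, D'.quadCurv_smul hadd hsmul, hr x, smul_neg]
          rw [e, D'.hom_smul, mul_smul_comm]
          rfl }
    let H : L' →ₗ[R'] D'.Weyl⟦X⟧ := ⟨⟨ρ, hadd⟩, hsmul⟩
    intro x
    change H x = G x
    rw [← F.generates x, _root_.map_sum, _root_.map_sum]
    refine Finset.sum_congr rfl fun i _ => ?_
    rw [_root_.map_smul, _root_.map_smul]
    exact congrArg _ (hfix0 _)
  have key : ∀ d x, Agree d (ρ x) (D'.rho x) := by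
    intro d
    induction d with
    | zero => exact fun _ i hi => absurd hi (by omega)
    | succ d ih =>
      intro x
      rw [hfix, D'.rho_eq]
      refine Agree.X_mul (D'.agree_hom 1 fun i => ?_)
      exact (Agree.rfl.add ((((ih _).map _).sub ((ih _).map _)).sub (ih _))).add
        (((ih _).mul (ih _)).sub ((ih _).mul (ih _)))
  rw [hρ]
  exact Agree.eq fun d => key d _

theorem ser_cov (x : L) (w : D.Weyl⟦X⟧) : F.ser (D.cov x w) = D'.cov (F.s x) (F.ser w) := by
  simp only [SymplecticData.cov_apply, _root_.map_add, _root_.map_sub, ser_mul, ser_nab, ser_rho]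

theorem isFlat_ser {w : D.Weyl⟦X⟧} (hw : D.IsFlat w) : D'.IsFlat (F.ser w) := by
  have h0 : ∀ x, D'.del (F.s x) (F.ser w) = X * D'.cov (F.s x) (F.ser w) := fun x => by
    have h := congrArg F.ser (hw x)
    rw [ser_del, ser_X_mul, ser_cov] at h
    have h' := congrArg (F.η • ·) h
    simpa only [F.sign_sign] using h'
  let G : L' →ₗ[R'] D'.Weyl⟦X⟧ :=
    { toFun := fun x => X * D'.cov x (F.ser w)
      map_add' := fun x y => by rw [D'.cov_add_left, mul_add]
      map_smul' := fun r x => by rw [D'.cov_smul_left, mul_smul_comm]; rfl }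
  let H : L' →ₗ[R'] D'.Weyl⟦X⟧ :=
    { toFun := fun x => D'.del x (F.ser w)
      map_add' := fun x y => D'.del_add_left x y _
      map_smul' := fun r x => D'.del_smul_left r x _ }
  intro x
  change H x = G x
  rw [← F.generates x, _root_.map_sum, _root_.map_sum]
  refine Finset.sum_congr rfl fun i _ => ?_
  rw [_root_.map_smul, _root_.map_smul]
  exact congrArg _ (h0 _)

theorem flat_base (a : R⟦X⟧) : D'.flat (F.base a) = F.ser (D.flat a) :=
  (D'.isFlat_flat _).ext D' (F.isFlat_ser (D.isFlat_flat a)) (by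
    rw [D'.con_flat, con_ser, D.con_flat])

/-- The product of scalars transported from the product of flat sections is natural. -/
theorem base_con_mul (a b : R⟦X⟧) : F.base (D.con (D.flat a * D.flat b)) =
    D'.con (D'.flat (F.base a) * D'.flat (F.base b)) := by
  rw [flat_base, flat_base, ← ser_mul, con_ser]

end CharZero

end SymplecticHom

end
end SheafQuantization

namespace SheafQuantization
noncomputable section

/-! ### The star product on formal series of scalars -/

namespace SymplecticData

open PowerSeries

variable {k R L : Type*} [Field k] [CommRing R] [Algebra k R] [AddCommGroup L] [Module R L]
  (D : SymplecticData k R L) [CharZero k]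

/-- The product of scalars transported from the product of flat sections, before the substitution
`ħ = X ^ 2`. -/
def flatMul (a b : R⟦X⟧) : R⟦X⟧ := D.con (D.flat a * D.flat b)

theorem flat_flatMul (a b : R⟦X⟧) : D.flat (D.flatMul a b) = D.flat a * D.flat b :=
  D.flat_con ((D.isFlat_flat a).mul (D.isFlat_flat b))

theorem flatMul_assoc (a b c : R⟦X⟧) :
    D.flatMul (D.flatMul a b) c = D.flatMul a (D.flatMul b c) := by
  rw [flatMul, flat_flatMul, flatMul, flat_flatMul, mul_assoc]

theorem flatMul_add (a b c : R⟦X⟧) : D.flatMul a (b + c) = D.flatMul a b + D.flatMul a c := by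
  rw [flatMul, flat_add, mul_add, map_add]
  rfl

theorem add_flatMul (a b c : R⟦X⟧) : D.flatMul (a + b) c = D.flatMul a c + D.flatMul b c := by
  rw [flatMul, flat_add, add_mul, map_add]
  rfl

theorem const_flatMul (c : k⟦X⟧) (a b : R⟦X⟧) :
    D.flatMul (PowerSeries.map (algebraMap k R) c * a) b =
      PowerSeries.map (algebraMap k R) c * D.flatMul a b := by
  rw [flatMul, flat_const_mul, mul_assoc, con_scal_mul]
  rfl

theorem flatMul_const (c : k⟦X⟧) (a b : R⟦X⟧) :
    D.flatMul a (PowerSeries.map (algebraMap k R) c * b) =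
      PowerSeries.map (algebraMap k R) c * D.flatMul a b := by
  rw [flatMul, flat_const_mul, ← mul_assoc, ← scal_commute, mul_assoc, con_scal_mul]
  rfl

theorem one_flatMul (a : R⟦X⟧) : D.flatMul 1 a = a := by
  rw [flatMul, flat_one, one_mul, con_flat]

theorem flatMul_one (a : R⟦X⟧) : D.flatMul a 1 = a := by
  rw [flatMul, flat_one, mul_one, con_flat]

/-! ### Terms of low order -/

theorem coeff_con (w : D.Weyl⟦X⟧) (d : ℕ) : coeff d (D.con w) = D.wconst (coeff d w) :=
  coeff_coeffwise _ w d

theorem coeff_del (x : L) (w : D.Weyl⟦X⟧) (d : ℕ) :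
    coeff d (D.del x w) = D.wdelta x (coeff d w) :=
  coeff_coeffwise _ w d

theorem coeff_nab (x : L) (w : D.Weyl⟦X⟧) (d : ℕ) :
    coeff d (D.nab x w) = D.wnabla x (coeff d w) :=
  coeff_coeffwise _ w d

theorem coeff_flat (a : R⟦X⟧) (d : ℕ) : D.wconst (coeff d (D.flat a)) = coeff d a := by
  rw [← coeff_con, con_flat]

theorem eq_of_wdelta_eq {v w : D.Weyl} (h : ∀ x, D.wdelta x v = D.wdelta x w)
    (h0 : D.wconst v = D.wconst w) : v = w := by
  have h1 := D.whomotopy_delta v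
  have h2 := D.whomotopy_delta w
  rw [funext fun i => h (D.e i), h2, h0] at h1
  exact (sub_left_inj.1 h1).symm

theorem coeff_zero_flat (a : R⟦X⟧) : coeff 0 (D.flat a) = algebraMap R D.Weyl (coeff 0 a) := by
  refine D.eq_of_wdelta_eq (fun x => ?_) (by rw [coeff_flat, wconst_algebraMap])
  have h := congrArg (coeff 0) (D.isFlat_flat a x)
  rwa [coeff_zero_X_mul, coeff_del, ← D.wdelta_algebraMap x (coeff 0 a)] at h

theorem coeff_zero_mul {A : Type*} [Ring A] (v w : A⟦X⟧) :
    coeff 0 (v * w) = coeff 0 v * coeff 0 w := by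
  simp [coeff_mul]

theorem coeff_zero_rho (x : L) : coeff 0 (D.rho x) = 0 := by
  rw [rho_eq, coeff_zero_X_mul]

/-- The flat section through `a` is `a + X * h + …`, where `h` is the Hamiltonian vector of `a`. -/
theorem coeff_one_flat (a : R) (u : L) (hu : ∀ x, D.form x u = D.anchor x a) :
    coeff 1 (D.flat (C a)) = D.wincl u := by
  refine D.eq_of_wdelta_eq (fun x => ?_) (by rw [coeff_flat, wconst_incl, coeff_C, if_neg one_ne_zero])
  have h := congrArg (coeff 1) (D.isFlat_flat (C a) x)
  rw [coeff_del, show (1 : ℕ) = 0 + 1 from rfl, coeff_succ_X_mul, cov_apply, map_sub, map_add,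
    coeff_zero_mul, coeff_zero_mul, coeff_zero_rho, zero_mul, mul_zero, add_zero, sub_zero,
    coeff_nab, coeff_zero_flat, wnabla_algebraMap, coeff_zero_C, zero_add] at h
  rw [h, wdelta_incl, hu]

theorem coeff_zero_flatMul (a b : R⟦X⟧) : coeff 0 (D.flatMul a b) = coeff 0 a * coeff 0 b := by
  rw [flatMul, coeff_con, coeff_zero_mul, coeff_zero_flat, coeff_zero_flat, ← map_mul,
    wconst_algebraMap]

theorem wconst_incl_mul_incl (x y : L) : D.wconst (D.wincl x * D.wincl y) = D.form x y := by
  have h : D.wincl x * D.wincl y = (D.incl x * D.incl y + D.delta x (D.incl y) : D.Poly) :=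
    D.wincl_mul x _
  have h0 : MvPolynomial.constantCoeff (D.incl x) = 0 := D.wconst_incl x
  rw [h]
  change MvPolynomial.constantCoeff (D.incl x * D.incl y + D.delta x (D.incl y)) = _
  rw [map_add, map_mul, h0, zero_mul, zero_add, delta_incl, MvPolynomial.constantCoeff_C]

theorem coeff_two_flatMul (a b : R) (u v : L) (hu : ∀ x, D.form x u = D.anchor x a)
    (hv : ∀ x, D.form x v = D.anchor x b) :
    coeff 2 (D.flatMul (C a) (C b)) = D.form u v := by
  have h2 : ∀ c : R, coeff 2 (C c : R⟦X⟧) = 0 := fun c => by rw [coeff_C, if_neg two_ne_zero]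
  rw [flatMul, coeff_con, coeff_mul, show Finset.HasAntidiagonal.antidiagonal 2 = {(0, 2), (1, 1), (2, 0)} from rfl,
    Finset.sum_insert (by decide), Finset.sum_insert (by decide), Finset.sum_singleton,
    coeff_zero_flat, coeff_zero_flat, D.coeff_one_flat a u hu, D.coeff_one_flat b v hv,
    ← Algebra.commutes, ← Algebra.smul_def, ← Algebra.smul_def, map_add, map_add, map_smul,
    map_smul, coeff_flat, coeff_flat, h2, h2, smul_zero, smul_zero, zero_add, add_zero,
    wconst_incl_mul_incl]

/-! ### Parity -/

/-- The parity automorphism. -/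
def parity : SymplecticHom D D where
  h := AlgHom.id k R
  s := id
  η := -1
  sign := by norm_num
  map_add _ _ := rfl
  map_smul _ _ := rfl
  map_form _ _ := rfl
  map_conn _ _ := rfl
  map_anchor _ _ := rfl
  generates := D.sum_form

theorem coeff_parity_base (a : R⟦X⟧) (d : ℕ) :
    coeff d (D.parity.base a) = (-1 : ℤ) ^ d • coeff d a :=
  SymplecticHom.coeff_series _ _ a d

theorem parity_base_expand (a : R⟦X⟧) :
    D.parity.base (expand 2 two_ne_zero a) = expand 2 two_ne_zero a := by
  ext d
  rw [coeff_parity_base]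
  by_cases hd : 2 ∣ d
  · rw [(even_iff_two_dvd.2 hd).neg_one_pow, one_smul]
  · rw [coeff_expand_of_not_dvd _ _ _ hd, smul_zero]

/-- The product of even series is even. -/
theorem exists_expand_eq (a b : R⟦X⟧) : ∃ c : R⟦X⟧, expand 2 two_ne_zero c =
    D.flatMul (expand 2 two_ne_zero a) (expand 2 two_ne_zero b) := by
  set w := D.flatMul (expand 2 two_ne_zero a) (expand 2 two_ne_zero b) with hw
  have h : D.parity.base w = w := by
    rw [hw, flatMul, SymplecticHom.base_con_mul, parity_base_expand, parity_base_expand]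
  refine ⟨PowerSeries.mk fun d => coeff (2 * d) w, ?_⟩
  ext d
  by_cases hd : 2 ∣ d
  · obtain ⟨m, rfl⟩ := hd
    rw [coeff_expand_mul, coeff_mk]
  · rw [coeff_expand_of_not_dvd _ _ _ hd]
    have hd' := congrArg (coeff d) h
    rw [coeff_parity_base,
      Odd.neg_one_pow (Nat.not_even_iff_odd.1 fun h => hd (even_iff_two_dvd.1 h)), neg_smul,
      one_smul] at hd'
    have h2 := succ_mul_invSucc k R 1
    have h3 : ((1 : ℕ) + 1 : R) * coeff d w = 0 := by
      push_cast
      linear_combination -hd'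
    calc 0 = invSucc k R 1 * (((1 : ℕ) + 1 : R) * coeff d w) := by rw [h3, mul_zero]
      _ = coeff d w := by linear_combination coeff d w * h2

theorem expand_injective : Function.Injective (expand 2 two_ne_zero : R⟦X⟧ → R⟦X⟧) := by
  intro a b h
  ext d
  rw [← coeff_expand_mul 2 two_ne_zero a, h, coeff_expand_mul]

/-- The product of formal series of scalars, with `ħ = X ^ 2`. -/
def prod (a b : R⟦X⟧) : R⟦X⟧ := (D.exists_expand_eq a b).choose

theorem expand_prod (a b : R⟦X⟧) : expand 2 two_ne_zero (D.prod a b) =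
    D.flatMul (expand 2 two_ne_zero a) (expand 2 two_ne_zero b) :=
  (D.exists_expand_eq a b).choose_spec

theorem prod_assoc (a b c : R⟦X⟧) : D.prod (D.prod a b) c = D.prod a (D.prod b c) :=
  expand_injective (by simp only [expand_prod, flatMul_assoc])

theorem one_prod (a : R⟦X⟧) : D.prod 1 a = a :=
  expand_injective (by rw [expand_prod, map_one, one_flatMul])

theorem prod_one (a : R⟦X⟧) : D.prod a 1 = a :=
  expand_injective (by rw [expand_prod, map_one, flatMul_one])

theorem prod_add (a b c : R⟦X⟧) : D.prod a (b + c) = D.prod a b + D.prod a c :=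
  expand_injective (by simp only [expand_prod, map_add, flatMul_add])

theorem add_prod (a b c : R⟦X⟧) : D.prod (a + b) c = D.prod a c + D.prod b c :=
  expand_injective (by simp only [expand_prod, map_add, add_flatMul])

theorem smul_prod (c : k⟦X⟧) (a b : R⟦X⟧) : D.prod (c • a) b = c • D.prod a b :=
  expand_injective (by
    simp only [expand_prod, Algebra.smul_def, algebraMap_apply'', map_mul, ← map_expand,
      const_flatMul])

theorem prod_smul (c : k⟦X⟧) (a b : R⟦X⟧) : D.prod a (c • b) = c • D.prod a b :=
  expand_injective (by
    simp only [expand_prod, Algebra.smul_def, algebraMap_apply'', map_mul, ← map_expand,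
      flatMul_const])

theorem coeff_zero_prod (a b : R⟦X⟧) : coeff 0 (D.prod a b) = coeff 0 a * coeff 0 b := by
  have h : ∀ a : R⟦X⟧, coeff 0 (expand 2 two_ne_zero a) = coeff 0 a := fun a =>
    coeff_expand_mul 2 two_ne_zero a 0
  rw [← h, expand_prod, coeff_zero_flatMul, h, h]

theorem coeff_one_prod (a b : R) (u v : L) (hu : ∀ x, D.form x u = D.anchor x a)
    (hv : ∀ x, D.form x v = D.anchor x b) :
    coeff 1 (D.prod (C a) (C b)) = D.form u v := by
  rw [← D.coeff_two_flatMul a b u v hu hv, ← coeff_expand_mul 2 two_ne_zero, expand_prod, expand_C,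
    expand_C]

end SymplecticData

open PowerSeries in
/-- The star product is natural. -/
theorem SymplecticHom.map_prod {k R L R' L' : Type*} [Field k] [CommRing R] [Algebra k R]
    [AddCommGroup L] [Module R L] [CommRing R'] [Algebra k R'] [AddCommGroup L'] [Module R' L']
    {D : SymplecticData k R L} {D' : SymplecticData k R' L'} [CharZero k] (F : SymplecticHom D D')
    (hF : F.η = 1) (a b : R⟦X⟧) :
    PowerSeries.map F.h.toRingHom (D.prod a b) =
      D'.prod (PowerSeries.map F.h.toRingHom a) (PowerSeries.map F.h.toRingHom b) := by
  have h : ∀ a, F.base a = PowerSeries.map F.h.toRingHom a := fun a => by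
    ext d
    rw [base, coeff_series, hF, one_pow, one_smul]
    rfl
  refine SymplecticData.expand_injective ?_
  rw [← map_expand, D.expand_prod, D'.expand_prod, ← map_expand, ← map_expand, ← h, ← h, ← h]
  exact F.base_con_mul _ _

end
end SheafQuantization

namespace SheafQuantization
noncomputable section

/-! ### The Lie algebra of weak Hamiltonian derivations -/

variable {k : Type u} [Field k] {M : TopCat.{u}} {A : TopCat.Sheaf (CommAlgCat.{u} k) M}

/-- The commutator of derivations of the sheaf `A`. -/
def DerSec.lie {U : Opens M} (D D' : DerSec A U) : DerSec A U where
  app V hV := ⁅D.1 V hV, D'.1 V hV⁆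
  res_app V W hV hW a := by
    simp only [Derivation.commutator_apply, map_sub, D.2 V W hV hW, D'.2 V W hV hW]

theorem DerSec.lie_apply {U : Opens M} (D D' : DerSec A U) {V : Opens M} (hV : V ≤ U) (a : Sec A V) :
    (D.lie D').1 V hV a = D.1 V hV (D'.1 V hV a) - D'.1 V hV (D.1 V hV a) :=
  Derivation.commutator_apply a

namespace PoissonBracket

variable (f : PoissonBracket A)

/-- The action of sections of `E` on functions. -/
def anchor (U : Opens M) : f.E U →ₗ[Sec A U] Derivation k (Sec A U) (Sec A U) where
  toFun x := x.1.1 U le_rfl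
  map_add' _ _ := rfl
  map_smul' a x := Derivation.ext fun b => by
    refine (DerSec.smul_apply a x.1 le_rfl b).trans ?_
    rw [res_self]
    rfl

theorem res_anchor {U V : Opens M} (h : V ≤ U) (x : f.E U) (a : Sec A U) :
    res A h (f.anchor U x a) = f.anchor V (f.resE h x) (res A h a) :=
  x.1.2 U V le_rfl h a

/-- The strong Hamiltonian derivation `f(b, ·)` as a section of `E`. -/
def hamE (U : Opens M) (b : Sec A U) : f.E U := ⟨f.ham U b, f.ham_mem U b⟩

theorem form_hamE (U : Opens M) (x : f.E U) (b : Sec A U) :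
    f.form U x (f.hamE U b) = f.anchor U x b := f.formVal_ham x b

theorem form_skew (U : Opens M) (x y : f.E U) : f.form U x y = - f.form U y x := f.formVal_skew x y

theorem anchor_hamE (U : Opens M) (a b : Sec A U) : f.anchor U (f.hamE U a) b = f.br U a b := by
  rw [← form_hamE]
  exact f.form_ham_ham U a b

/-- A property of sections of `E` which is local and compatible with linear combinations holds for
all sections of `E` if it holds for strong Hamiltonian derivations. -/
theorem e_induction {U : Opens M} (P : ∀ V : Opens M, V ≤ U → f.E V → Prop)
    (hham : ∀ V h b, P V h (f.hamE V b)) (hadd : ∀ V h x y, P V h x → P V h y → P V h (x + y))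
    (hsmul : ∀ V h (a : Sec A V) x, P V h x → P V h (a • x))
    (hloc : ∀ V h x, (∀ p ∈ V, ∃ (W : Opens M) (hW : W ≤ V), p ∈ W ∧
      P W (hW.trans h) (f.resE hW x)) → P V h x) (x : f.E U) : P U le_rfl x := by
  have key : ∀ (V : Opens M) (h : V ≤ U) (D : DerSec A V),
      D ∈ Submodule.span (Sec A V) (Set.range (f.ham V)) → ∃ hD : D ∈ f.E V, P V h ⟨D, hD⟩ := by
    intro V h D hD
    induction hD using Submodule.span_induction with
    | mem x hx =>
      obtain ⟨b, rfl⟩ := hx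
      exact ⟨f.ham_mem V b, hham V h b⟩
    | zero =>
      refine ⟨Submodule.zero_mem _, ?_⟩
      have := hsmul V h 0 _ (hham V h 0)
      rwa [zero_smul] at this
    | add x y _ _ hx hy => exact ⟨Submodule.add_mem _ hx.1 hy.1, hadd V h _ _ hx.2 hy.2⟩
    | smul a x _ hx => exact ⟨Submodule.smul_mem _ _ hx.1, hsmul V h a _ hx.2⟩
  refine hloc U le_rfl x fun p hp => ?_
  obtain ⟨V, hV, hpV, hx⟩ := x.2 p hp
  exact ⟨V, hV, hpV, (key V hV _ hx).2⟩

theorem ham_lie_ham (U : Opens M) (a b : Sec A U) :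
    (f.ham U a).lie (f.ham U b) = f.ham U (f.br U a b) :=
  DerSec.ext' fun V hV c => by
    have h := f.jacobi V (res A hV a) (res A hV b) c
    rw [f.br_skew V _ (res A hV a), f.br_skew V (f.br V c _), f.br_skew V c] at h
    rw [DerSec.lie_apply, ham_apply, ham_apply, ham_apply, ham_apply, ham_apply, f.br_res]
    simp only [map_neg] at h
    linear_combination -h

theorem lie_mem_span {U : Opens M} {D D' : DerSec A U}
    (hD : D ∈ Submodule.span (Sec A U) (Set.range (f.ham U)))
    (hD' : D' ∈ Submodule.span (Sec A U) (Set.range (f.ham U))) :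
    D.lie D' ∈ Submodule.span (Sec A U) (Set.range (f.ham U)) := by
  have hskew : ∀ D D' : DerSec A U, D.lie D' = - D'.lie D := fun D D' =>
    DerSec.ext' fun V hV c => by
      rw [DerSec.neg_apply, DerSec.lie_apply, DerSec.lie_apply, neg_sub]
  have hadd : ∀ D D' D'' : DerSec A U, D.lie (D' + D'') = D.lie D' + D.lie D'' := fun D D' D'' =>
    DerSec.ext' fun V hV c => by
      simp only [DerSec.add_apply, DerSec.lie_apply, map_add]
      ring
  have hsmul : ∀ (a : Sec A U) (D D' : DerSec A U), D.lie (a • D') =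
      D.1 U le_rfl a • D' + a • D.lie D' := fun a D D' =>
    DerSec.ext' fun V hV c => by
      simp only [DerSec.add_apply, DerSec.smul_apply, DerSec.lie_apply, Derivation.leibniz,
        D.2 U V le_rfl hV, smul_eq_mul]
      ring
  have hzero : ∀ D : DerSec A U, D.lie 0 = 0 := fun D => by simpa using hsmul 0 D 0
  induction hD' using Submodule.span_induction with
  | mem y hy =>
    obtain ⟨b, rfl⟩ := hy
    induction hD using Submodule.span_induction with
    | mem x hx =>
      obtain ⟨a, rfl⟩ := hx
      rw [ham_lie_ham]
      exact Submodule.subset_span ⟨_, rfl⟩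
    | zero =>
      rw [hskew, hzero, neg_zero]
      exact Submodule.zero_mem _
    | add x y _ _ hx hy =>
      rw [hskew, hadd, neg_add, ← hskew, ← hskew]
      exact Submodule.add_mem _ hx hy
    | smul a x hx hx' =>
      rw [hskew, hsmul, neg_add, ← smul_neg a, ← hskew]
      exact Submodule.add_mem _ (Submodule.neg_mem _ (Submodule.smul_mem _ _ hx))
        (Submodule.smul_mem _ _ hx')
  | zero => rw [hzero]; exact Submodule.zero_mem _
  | add x y _ _ hx hy =>
    rw [hadd]
    exact Submodule.add_mem _ hx hy
  | smul a x hx hx' =>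
    rw [hsmul]
    exact Submodule.add_mem _ (Submodule.smul_mem _ _ hx) (Submodule.smul_mem _ _ hx')

/-- The Lie bracket on `E`. -/
def lieE {U : Opens M} (x y : f.E U) : f.E U :=
  ⟨x.1.lie y.1, fun p hp => by
    obtain ⟨V, hV, hpV, hx⟩ := x.2 p hp
    obtain ⟨W, hW, hpW, hy⟩ := y.2 p hp
    exact ⟨V ⊓ W, inf_le_left.trans hV, ⟨hpV, hpW⟩, f.lie_mem_span
      (f.restrict_mem_span (inf_le_left : V ⊓ W ≤ V) hx)
      (f.restrict_mem_span (inf_le_right : V ⊓ W ≤ W) hy)⟩⟩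

theorem resE_lieE {U V : Opens M} (h : V ≤ U) (x y : f.E U) :
    f.resE h (f.lieE x y) = f.lieE (f.resE h x) (f.resE h y) := rfl

theorem anchor_lieE {U : Opens M} (x y : f.E U) (a : Sec A U) : f.anchor U (f.lieE x y) a =
    f.anchor U x (f.anchor U y a) - f.anchor U y (f.anchor U x a) :=
  DerSec.lie_apply x.1 y.1 le_rfl a

/-- Sections of `E` acting in the same way on functions are equal. -/
theorem anchor_ext {U : Opens M} {x y : f.E U}
    (h : ∀ V (hV : V ≤ U) a, f.anchor V (f.resE hV x) a = f.anchor V (f.resE hV y) a) : x = y :=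
  Subtype.ext (DerSec.ext' h)

theorem lieE_hamE (U : Opens M) (a b : Sec A U) :
    f.lieE (f.hamE U a) (f.hamE U b) = f.hamE U (f.br U a b) :=
  Subtype.ext (f.ham_lie_ham U a b)

theorem lieE_skew {U : Opens M} (x y : f.E U) : f.lieE x y = - f.lieE y x :=
  f.anchor_ext fun V hV a => by
    simp only [map_neg, resE_lieE, Derivation.neg_apply, anchor_lieE]
    ring

theorem lieE_add {U : Opens M} (x y z : f.E U) : f.lieE x (y + z) = f.lieE x y + f.lieE x z :=
  f.anchor_ext fun V hV a => by
    simp only [map_add, resE_lieE, Derivation.add_apply, anchor_lieE]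
    ring

theorem lieE_smul {U : Opens M} (a : Sec A U) (x y : f.E U) :
    f.lieE x (a • y) = f.anchor U x a • y + a • f.lieE x y :=
  f.anchor_ext fun V hV b => by
    simp only [map_add, resE_lieE, Derivation.add_apply, anchor_lieE, map_smulₛₗ, res_anchor,
      Derivation.smul_apply, Derivation.leibniz, smul_eq_mul, RingHom.coe_coe, RingHom.id_apply]
    ring

theorem lieE_jacobi {U : Opens M} (x y z : f.E U) :
    f.lieE (f.lieE x y) z + f.lieE (f.lieE y z) x + f.lieE (f.lieE z x) y = 0 :=
  f.anchor_ext fun V hV a => by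
    simp only [map_add, resE_lieE, Derivation.add_apply, anchor_lieE, map_sub, map_zero,
      Derivation.zero_apply]
    ring

/-- The form `φ` is closed. It suffices to check this when two of the three arguments are strong
Hamiltonian derivations. -/
theorem form_closed {U : Opens M} (x y z : f.E U) :
    f.anchor U x (f.form U y z) + f.anchor U y (f.form U z x) + f.anchor U z (f.form U x y) =
      f.form U (f.lieE x y) z + f.form U (f.lieE y z) x + f.form U (f.lieE z x) y := by
  let T : ∀ {V : Opens M}, f.E V → f.E V → f.E V → Sec A V := fun {V} x y z =>
    f.anchor V x (f.form V y z) + f.anchor V y (f.form V z x) + f.anchor V z (f.form V x y) -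
      (f.form V (f.lieE x y) z + f.form V (f.lieE y z) x + f.form V (f.lieE z x) y)
  have hres : ∀ {V W : Opens M} (h : W ≤ V) (x y z : f.E V),
      res A h (T x y z) = T (f.resE h x) (f.resE h y) (f.resE h z) := fun h x y z => by
    simp only [T, map_add, map_sub, res_anchor, res_form, resE_lieE]
  have hcyc : ∀ {V : Opens M} (x y z : f.E V), T x y z = T y z x := fun x y z => by
    simp only [T]
    ring
  have hadd : ∀ {V : Opens M} (x y z z' : f.E V), T x y (z + z') = T x y z + T x y z' :=
    fun {V} x y z z' => by
      simp only [T, map_add, LinearMap.add_apply, lieE_add, f.lieE_skew _ x, Derivation.add_apply,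
        neg_add]
      ring
  have hsmul : ∀ {V : Opens M} (a : Sec A V) (x y z : f.E V), T x y (a • z) = a * T x y z :=
    fun {V} a x y z => by
      simp only [T, map_add, map_smul, map_neg, LinearMap.add_apply, LinearMap.smul_apply,
        LinearMap.neg_apply, lieE_smul, f.lieE_skew _ x, Derivation.smul_apply,
        Derivation.leibniz, smul_eq_mul]
      rw [f.form_skew V z y]
      ring
  have hloc : ∀ {V : Opens M} (x y z : f.E V), (∀ p ∈ V, ∃ (W : Opens M) (hW : W ≤ V), p ∈ W ∧
      T (f.resE hW x) (f.resE hW y) (f.resE hW z) = 0) → T x y z = 0 := fun {V} x y z h => by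
    choose W hW hp hT using fun p : V => h p.1 p.2
    refine sec_ext A hW (fun p hpV => Opens.mem_iSup.2 ⟨⟨p, hpV⟩, hp _⟩) fun p => ?_
    rw [hres, hT, map_zero]
  have h1 : ∀ {V : Opens M} (x : f.E V) (b c : Sec A V), T x (f.hamE V b) (f.hamE V c) = 0 :=
    fun {V} x b c => by
      simp only [T, lieE_hamE, form_hamE, f.form_skew V (f.hamE V c) x,
        f.form_skew V (f.hamE V (f.br V b c)) x, anchor_lieE, map_neg, anchor_hamE]
      rw [f.br_skew V c b]
      simp only [map_neg]
      ring
  have h2 : ∀ {V : Opens M} (x y : f.E V) (b : Sec A V), T x (f.hamE V b) y = 0 :=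
    fun {V} x y b => f.e_induction (fun W h y => T (f.resE h x) (f.resE h (f.hamE V b)) y = 0)
      (fun W h c => by
        have : f.resE h (f.hamE V b) = f.hamE W (res A h b) := Subtype.ext (f.restrict_ham h b)
        rw [this, h1])
      (fun W h y y' hy hy' => by rw [hadd, hy, hy', add_zero])
      (fun W h a y hy => by rw [hsmul, hy, mul_zero])
      (fun W h y hy => hloc _ _ _ hy) y
  have h3 : T y z x = 0 → T x y z = 0 := fun h => (hcyc _ _ _).trans h
  refine sub_eq_zero.1 (?_ : T x y z = 0)
  rw [hcyc, hcyc]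
  exact f.e_induction (fun W h y => T (f.resE h z) (f.resE h x) y = 0)
    (fun W h c => by rw [hcyc, hcyc, hcyc, hcyc, h2])
    (fun W h y y' hy hy' => by rw [hadd, hy, hy', add_zero])
    (fun W h a y hy => by rw [hsmul, hy, mul_zero])
    (fun W h y hy => hloc _ _ _ hy) y

end PoissonBracket
end
end SheafQuantization

namespace SheafQuantization
noncomputable section

/-! ### Vanishing of cohomology and lifting of global sections -/

section Cohomology

variable {M : TopCat.{u}} {T G B : Sheaf (Opens.grothendieckTopology M) AddCommGrpCat.{u}}

theorem exists_lift_section (i : T ⟶ G) {Z : Sheaf (Opens.grothendieckTopology M) AddCommGrpCat.{u}}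
    (m : Z ⟶ G) (hi : ∀ U, Function.Injective (i.hom.app U))
    (hm : ∀ U (z : Z.obj.obj U), ∃ t, i.hom.app U t = m.hom.app U z) :
    ∃ l : Z ⟶ T, l ≫ i = m := by
  choose g hg using hm
  refine ⟨⟨{ app := fun U => AddCommGrpCat.ofHom (AddMonoidHom.mk' (g U) fun z z' => hi U (by
      rw [map_add, hg, hg, hg, map_add])), naturality := fun U V h => ?_ }⟩, ?_⟩
  · ext z
    refine hi V ?_
    change i.hom.app V (g V (Z.obj.map h z)) = i.hom.app V (T.obj.map h (g U z))
    rw [hg, NatTrans.naturality_apply, NatTrans.naturality_apply, hg]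
  · ext U z
    exact hg U z

/-- If the kernel of a locally surjective morphism of abelian sheaves has no first cohomology, then
global sections can be lifted along the morphism. -/
theorem exists_global_lift (i : T ⟶ G) (p : G ⟶ B) (hi : ∀ U, Function.Injective (i.hom.app U))
    (hip : i ≫ p = 0)
    (hex : ∀ U (s : G.obj.obj U), p.hom.app U s = 0 → ∃ t, i.hom.app U t = s)
    (hp : TopCat.Presheaf.IsLocallySurjective p.hom) (hT : Subsingleton (Sheaf.H T 1))
    (b : B.obj.obj (op ⊤)) : ∃ s : G.obj.obj (op ⊤), p.hom.app (op ⊤) s = b := by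
  have hmono : Mono i := ⟨fun {Z} l l' h => by
    ext U z
    refine hi U ?_
    exact congrArg (fun m : Z ⟶ G => m.hom.app U z) h⟩
  have hepi : Epi p := (TopCat.Sheaf.isLocallySurjective_iff_epi p).1 hp
  have hS : (ShortComplex.mk i p hip).ShortExact :=
    { exact := by
        refine ShortComplex.exact_of_f_is_kernel _ (Limits.KernelFork.IsLimit.ofι' _ _ ?_)
        intro Z m hm
        have := exists_lift_section i m hi fun U z => hex U _
          (congrArg (fun m : Z ⟶ B => m.hom.app U z) hm)
        exact ⟨this.choose, this.choose_spec⟩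
      mono_f := hmono
      epi_g := hepi }
  have ht : Limits.IsTerminal (⊤ : Opens M) := Limits.isTerminalTop
  obtain ⟨x, hx⟩ := Abelian.Ext.covariant_sequence_exact₃ _ hS ((Sheaf.H.equiv₀ B ht).symm b)
    (zero_add 1) (Subsingleton.elim (α := Sheaf.H T 1) _ _)
  refine ⟨Sheaf.H.equiv₀ G ht x, ?_⟩
  rw [Sheaf.H.equiv₀_naturality, Sheaf.H.map_apply]
  exact (congrArg (Sheaf.H.equiv₀ B ht) hx).trans (AddEquiv.apply_symm_apply _ _)

end Cohomology

end
end SheafQuantization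

namespace SheafQuantization
noncomputable section

/-! ### The sheaf of symplectic connections -/

variable {k : Type u} [Field k] {M : TopCat.{u}} {A : TopCat.Sheaf (CommAlgCat.{u} k) M}

namespace PoissonBracket

variable (f : PoissonBracket A)

section Sharp

variable {f} (hns : f.IsNonsingular)

include hns

theorem IsNonsingular.ext {U : Opens M} {x y : f.E U} (h : ∀ V (hV : V ≤ U) z,
    f.form V (f.resE hV x) z = f.form V (f.resE hV y) z) : x = y :=
  (hns U).1 (DualSec.ext (funext fun V => funext fun hV => LinearMap.ext (h V hV)))

/-- Trilinear forms correspond under `φ` to bilinear operations. -/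
theorem IsNonsingular.exists_sharp {U : Opens M}
    (B : ∀ V, V ≤ U → f.E V → f.E V → f.E V → Sec A V)
    (hres : ∀ V W (hV : V ≤ U) (hW : W ≤ V) x y z, res A hW (B V hV x y z) =
      B W (hW.trans hV) (f.resE hW x) (f.resE hW y) (f.resE hW z))
    (hadd₁ : ∀ V hV x x' y z, B V hV (x + x') y z = B V hV x y z + B V hV x' y z)
    (hsmul₁ : ∀ V hV (a : Sec A V) x y z, B V hV (a • x) y z = a * B V hV x y z)
    (hadd₂ : ∀ V hV x y y' z, B V hV x (y + y') z = B V hV x y z + B V hV x y' z)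
    (hsmul₂ : ∀ V hV x (a : Sec A V) y z, B V hV x (a • y) z = a * B V hV x y z)
    (hadd₃ : ∀ V hV x y z z', B V hV x y (z + z') = B V hV x y z + B V hV x y z')
    (hsmul₃ : ∀ V hV x y (a : Sec A V) z, B V hV x y (a • z) = a * B V hV x y z) :
    ∃ S : ∀ V, V ≤ U → f.E V →ₗ[Sec A V] f.E V →ₗ[Sec A V] f.E V,
      (∀ V hV x y z, f.form V (S V hV x y) z = B V hV x y z) ∧
      ∀ V W (hV : V ≤ U) (hW : W ≤ V) x y,
        f.resE hW (S V hV x y) = S W (hW.trans hV) (f.resE hW x) (f.resE hW y) := by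
  have key : ∀ V (hV : V ≤ U) x y, ∃ s : f.E V, ∀ W (hW : W ≤ V) z, f.form W (f.resE hW s) z =
      B W (hW.trans hV) (f.resE hW x) (f.resE hW y) z := by
    intro V hV x y
    obtain ⟨s, hs⟩ := (hns V).2
      { toFun := fun W hW =>
          { toFun := B W (hW.trans hV) (f.resE hW x) (f.resE hW y)
            map_add' := hadd₃ _ _ _ _
            map_smul' := hsmul₃ _ _ _ _ }
        res_toFun := fun W W' hW hW' z => hres W W' (hW.trans hV) hW' _ _ z }
    exact ⟨s, fun W hW z => congrArg (fun θ : f.DualSec V => θ.toFun W hW z) hs⟩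
  choose S hS using key
  refine ⟨fun V hV => LinearMap.mk₂ (Sec A V) (S V hV)
    (fun x x' y => hns.ext fun W hW z => ?_) (fun a x y => hns.ext fun W hW z => ?_)
    (fun x y y' => hns.ext fun W hW z => ?_) (fun a x y => hns.ext fun W hW z => ?_),
    fun V hV x y z => hS V hV x y V le_rfl z, fun V W hV hW x y => hns.ext fun W' hW' z => ?_⟩
  · rw [map_add, map_add, LinearMap.add_apply, hS, hS, hS, map_add, hadd₁]
  · rw [map_smulₛₗ, map_smul, LinearMap.smul_apply, hS, hS, map_smulₛₗ, hsmul₁, smul_eq_mul]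
  · rw [map_add, map_add, LinearMap.add_apply, hS, hS, hS, map_add, hadd₂]
  · rw [map_smulₛₗ, map_smul, LinearMap.smul_apply, hS, hS, map_smulₛₗ, hsmul₂, smul_eq_mul]
  · rw [LinearMap.mk₂_apply, LinearMap.mk₂_apply, resE_resE, hS, hS]
    rfl

end Sharp

/-- Families of operations `E × E → E` over the open subsets of `U`. -/
abbrev OpFam (U : Opens M) : Type u := ∀ V : {V : Opens M // V ≤ U}, f.E V.1 → f.E V.1 → f.E V.1

/-- `N` is a `c`-connection on `E` over `U` preserving `φ`, that is, a symplectic connection in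
which the derivative of functions along `x` is multiplied by `c`. For `c = 1` these are the
symplectic connections, for `c = 0` the `sp(E)`-valued 1-forms. -/
structure IsConn {U : Opens M} (c : Sec A U) (N : ∀ V : Opens M, V ≤ U → f.E V → f.E V → f.E V) : Prop where
  res_app : ∀ V W (hV : V ≤ U) (hW : W ≤ V) x y,
    f.resE hW (N V hV x y) = N W (hW.trans hV) (f.resE hW x) (f.resE hW y)
  add_left : ∀ V hV x x' y, N V hV (x + x') y = N V hV x y + N V hV x' y
  smul_left : ∀ V hV (a : Sec A V) x y, N V hV (a • x) y = a • N V hV x y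
  add_right : ∀ V hV x y y', N V hV x (y + y') = N V hV x y + N V hV x y'
  leibniz : ∀ V hV (a : Sec A V) x y, N V hV x (a • y) =
    (res A hV c * f.anchor V x a) • y + a • N V hV x y
  form : ∀ V hV x y z, res A hV c * f.anchor V x (f.form V y z) =
    f.form V (N V hV x y) z + f.form V y (N V hV x z)

variable {f} in
theorem IsConn.restrict {U V : Opens M} (h : V ≤ U) {c : Sec A U} {N : ∀ V : Opens M, V ≤ U → f.E V → f.E V → f.E V}
    (hN : f.IsConn c N) : f.IsConn (res A h c) (fun W hW => N W (hW.trans h)) where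
  res_app W W' hW hW' := hN.res_app W W' (hW.trans h) hW'
  add_left W hW := hN.add_left W (hW.trans h)
  smul_left W hW := hN.smul_left W (hW.trans h)
  add_right W hW := hN.add_right W (hW.trans h)
  leibniz W hW a x y := by rw [hN.leibniz, res_res]
  form W hW x y z := by rw [← hN.form, res_res]

/-- The group of pairs of a function `c` on `U` and a symplectic `c`-connection over `U`. -/
def connGroup (U : Opens M) : AddSubgroup (Sec A U × f.OpFam U) where
  carrier := {p | f.IsConn p.1 fun V hV => p.2 ⟨V, hV⟩}
  zero_mem' :=
    { res_app := fun V W hV hW x y => map_zero _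
      add_left := fun V hV x x' y => (add_zero 0).symm
      smul_left := fun V hV a x y => (smul_zero a).symm
      add_right := fun V hV x x' y => (add_zero 0).symm
      leibniz := fun V hV a x y => by
        change 0 = (res A hV 0 * _) • y + a • 0
        rw [map_zero, zero_mul, zero_smul, smul_zero, add_zero]
      form := fun V hV x y z => by
        change res A hV 0 * _ = f.form V 0 z + f.form V y 0
        simp }
  add_mem' := fun {p q} hp hq =>
    { res_app := fun V W hV hW x y => by
        change f.resE hW (p.2 ⟨V, hV⟩ x y + q.2 ⟨V, hV⟩ x y) = _
        rw [map_add, hp.res_app, hq.res_app]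
        rfl
      add_left := fun V hV x x' y => by
        change p.2 ⟨V, hV⟩ _ y + q.2 ⟨V, hV⟩ _ y = (p.2 ⟨V, hV⟩ _ y + q.2 ⟨V, hV⟩ _ y) + (p.2 ⟨V, hV⟩ _ y + q.2 ⟨V, hV⟩ _ y)
        rw [hp.add_left, hq.add_left]
        abel
      smul_left := fun V hV a x y => by
        change p.2 ⟨V, hV⟩ _ y + q.2 ⟨V, hV⟩ _ y = a • (p.2 ⟨V, hV⟩ _ y + q.2 ⟨V, hV⟩ _ y)
        rw [hp.smul_left, hq.smul_left, smul_add]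
      add_right := fun V hV x y y' => by
        change p.2 ⟨V, hV⟩ x _ + q.2 ⟨V, hV⟩ x _ = (p.2 ⟨V, hV⟩ x _ + q.2 ⟨V, hV⟩ x _) + (p.2 ⟨V, hV⟩ x _ + q.2 ⟨V, hV⟩ x _)
        rw [hp.add_right, hq.add_right]
        abel
      leibniz := fun V hV a x y => by
        change p.2 ⟨V, hV⟩ x _ + q.2 ⟨V, hV⟩ x _ = (res A hV (p.1 + q.1) * _) • y + a • (p.2 ⟨V, hV⟩ x _ + q.2 ⟨V, hV⟩ x _)
        rw [hp.leibniz, hq.leibniz, map_add]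
        module
      form := fun V hV x y z => by
        change res A hV (p.1 + q.1) * _ = f.form V (p.2 ⟨V, hV⟩ x y + q.2 ⟨V, hV⟩ x y) z +
          f.form V y (p.2 ⟨V, hV⟩ x z + q.2 ⟨V, hV⟩ x z)
        rw [map_add, add_mul, hp.form, hq.form, map_add, map_add, LinearMap.add_apply]
        ring }
  neg_mem' := fun {p} hp =>
    { res_app := fun V W hV hW x y => by
        change f.resE hW (-p.2 ⟨V, hV⟩ x y) = _
        rw [map_neg, hp.res_app]
        rfl
      add_left := fun V hV x x' y => by
        change -p.2 ⟨V, hV⟩ _ y = -p.2 ⟨V, hV⟩ _ y + -p.2 ⟨V, hV⟩ _ y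
        rw [hp.add_left, neg_add]
      smul_left := fun V hV a x y => by
        change -p.2 ⟨V, hV⟩ _ y = a • -p.2 ⟨V, hV⟩ _ y
        rw [hp.smul_left, smul_neg]
      add_right := fun V hV x y y' => by
        change -p.2 ⟨V, hV⟩ x _ = -p.2 ⟨V, hV⟩ x _ + -p.2 ⟨V, hV⟩ x _
        rw [hp.add_right, neg_add]
      leibniz := fun V hV a x y => by
        change -p.2 ⟨V, hV⟩ x _ = (res A hV (-p.1) * _) • y + a • -p.2 ⟨V, hV⟩ x _
        rw [hp.leibniz, map_neg]
        module
      form := fun V hV x y z => by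
        change res A hV (-p.1) * _ = f.form V (-p.2 ⟨V, hV⟩ x y) z + f.form V y (-p.2 ⟨V, hV⟩ x z)
        rw [map_neg, neg_mul, hp.form, map_neg, map_neg, LinearMap.neg_apply, neg_add] }

/-- Restriction of symplectic `c`-connections. -/
def resConn {U V : Opens M} (h : V ≤ U) : f.connGroup U →+ f.connGroup V where
  toFun p := ⟨(res A h p.1.1, fun W => p.1.2 ⟨W.1, W.2.trans h⟩), IsConn.restrict h p.2⟩
  map_zero' := Subtype.ext (Prod.ext (map_zero _) rfl)
  map_add' _ _ := Subtype.ext (Prod.ext (map_add _ _ _) rfl)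

theorem connGroup_hasGluing : HasGluing (fun U => f.connGroup U) (fun _ _ h => f.resConn h) := by
  intro V ι U hU hc s hs
  obtain ⟨c, hcs, hcu⟩ := sec_hasGluing A V ι U hU hc (fun i => (s i).1.1)
    (fun i j => congrArg (fun p : f.connGroup (U i ⊓ U j) => p.1.1) (hs i j))
  obtain ⟨t, tn, ti⟩ := HasGluing.glueHom (X := fun W => f.E W × f.E W) (Y := fun W => f.E W)
    (rX := fun _ _ h x => (f.resE h x.1, f.resE h x.2)) (rY := fun _ _ h => f.resE h)
    (fun _ _ _ h h' x => f.resE_pair h h' x)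
    (fun _ _ _ h h' x => f.resE_resE h h' x) f.e_hasGluing hU hc
    (fun i W h x => (s i).1.2 ⟨W, h⟩ x.1 x.2)
    (fun i W W' h h' x => (s i).2.res_app W W' h h' x.1 x.2)
    (fun i j W hi hj x => congrArg (fun p : f.connGroup (U i ⊓ U j) =>
      p.1.2 ⟨W, le_inf hi hj⟩ x.1 x.2) (hs i j))
  have loc : ∀ (W : Opens M) (hW : W ≤ V) (i : ι) (x y : f.E W),
      f.resE (inf_le_left : W ⊓ U i ≤ W) (t W hW (x, y)) =
        (s i).1.2 ⟨W ⊓ U i, inf_le_right⟩ (f.resE inf_le_left x) (f.resE inf_le_left y) :=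
    fun W hW i x y => (tn W (W ⊓ U i) hW inf_le_left (x, y)).trans (ti i _ inf_le_right _)
  have ext : ∀ (W : Opens M) (_ : W ≤ V) (a b : f.E W),
      (∀ i, f.resE (inf_le_left : W ⊓ U i ≤ W) a = f.resE inf_le_left b) → a = b :=
    fun W hW a b h => f.e_ext (fun i => inf_le_left) (inf_le_iSup_inf hW hc) h
  have extA : ∀ (W : Opens M) (_ : W ≤ V) (a b : Sec A W),
      (∀ i, res A (inf_le_left : W ⊓ U i ≤ W) a = res A inf_le_left b) → a = b :=
    fun W hW a b h => sec_ext A (fun i => inf_le_left) (inf_le_iSup_inf hW hc) h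
  have hcr : ∀ (W : Opens M) (hW : W ≤ V) (i : ι), res A (inf_le_left : W ⊓ U i ≤ W) (res A hW c) =
      res A inf_le_right (s i).1.1 := fun W hW i => by
    rw [← hcs i, res_res, res_res]
  have ht : f.IsConn c (fun W hW x y => t W hW (x, y)) :=
    { res_app := fun W W' hW hW' x y => tn W W' hW hW' (x, y)
      add_left := fun W hW x x' y => ext W hW _ _ fun i => by
        simp only [map_add, loc, (s i).2.add_left]
      smul_left := fun W hW a x y => ext W hW _ _ fun i => by
        rw [map_smulₛₗ, loc, loc, map_smulₛₗ, (s i).2.smul_left]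
      add_right := fun W hW x y y' => ext W hW _ _ fun i => by
        simp only [map_add, loc, (s i).2.add_right]
      leibniz := fun W hW a x y => ext W hW _ _ fun i => by
        rw [map_add, map_smulₛₗ, map_smulₛₗ, loc, loc, map_smulₛₗ, (s i).2.leibniz]
        simp only [RingHom.coe_coe, map_mul, hcr, res_anchor]
      form := fun W hW x y z => extA W hW _ _ fun i => by
        rw [map_mul, hcr, map_add, res_anchor, res_form, res_form, res_form, loc, loc,
          (s i).2.form] }
  refine ⟨⟨(c, fun W x y => t W.1 W.2 (x, y)), ht⟩, fun i => ?_, fun q hq => ?_⟩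
  · refine Subtype.ext (Prod.ext (hcs i) ?_)
    funext ⟨W, hW⟩ x y
    exact ti i W hW (x, y)
  · refine Subtype.ext (Prod.ext (hcu _ fun i => congrArg (fun p : f.connGroup (U i) => p.1.1) (hq i)) ?_)
    funext ⟨W, hW⟩ x y
    refine ext W hW _ _ fun i => ?_
    refine (q.2.res_app W (W ⊓ U i) hW inf_le_left x y).trans (Eq.trans ?_ (loc W hW i x y).symm)
    exact congrArg (fun p : f.connGroup (U i) =>
      p.1.2 ⟨W ⊓ U i, inf_le_right⟩ (f.resE inf_le_left x) (f.resE inf_le_left y)) (hq i)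

/-- The sheaf of symplectic `c`-connections with arbitrary `c`. -/
def connSheaf : Sheaf (Opens.grothendieckTopology M) AddCommGrpCat.{u} :=
  ⟨{ obj := fun U => AddCommGrpCat.of (f.connGroup U.unop)
     map := fun h => AddCommGrpCat.ofHom (f.resConn h.unop.le)
     map_id := fun U => AddCommGrpCat.hom_ext (AddMonoidHom.ext fun p =>
      Subtype.ext (Prod.ext (res_self A p.1.1) rfl))
     map_comp := fun h h' => AddCommGrpCat.hom_ext (AddMonoidHom.ext fun p =>
      Subtype.ext (Prod.ext (res_res A h.unop.le h'.unop.le p.1.1).symm rfl)) }, by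
    refine (TopCat.Presheaf.isSheaf_iff_isSheafUniqueGluing _).2 ?_
    intro ι U s hs
    exact f.connGroup_hasGluing (iSup U) ι U (fun i => le_iSup U i) le_rfl s hs⟩

variable (A) in
/-- The sheaf of abelian groups underlying `A`. -/
def addSheaf : Sheaf (Opens.grothendieckTopology M) AddCommGrpCat.{u} :=
  ⟨{ obj := fun U => AddCommGrpCat.of (Sec A U.unop)
     map := fun h => AddCommGrpCat.ofHom (res A h.unop.le : Sec A _ →+* Sec A _).toAddMonoidHom
     map_id := fun U => by
      ext a
      exact res_self A a
     map_comp := fun h h' => by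
      ext a
      exact (res_res A h.unop.le h'.unop.le a).symm }, by
    refine (TopCat.Presheaf.isSheaf_iff_isSheafUniqueGluing _).2 ?_
    intro ι U s hs
    exact sec_hasGluing A (iSup U) ι U (fun i => le_iSup U i) le_rfl s hs⟩

variable {f} in
theorem ClosedSpSec.isConn {U : Opens M} (s : f.ClosedSpSec U) :
    f.IsConn 0 (fun V hV x y => s.1 V hV x y) where
  res_app := s.2
  add_left V hV x x' y := by rw [map_add, LinearMap.add_apply]
  smul_left V hV a x y := by rw [map_smul, LinearMap.smul_apply]
  add_right V hV x y y' := map_add _ _ _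
  leibniz V hV a x y := by rw [map_zero, zero_mul, zero_smul, zero_add, map_smul]
  form V hV x y z := by rw [map_zero, zero_mul, s.3]

/-- The inclusion of the closed `sp(E)`-valued 1-forms into the symplectic `c`-connections. -/
def closedSpToConn : f.closedSp ⟶ f.connSheaf :=
  ⟨{ app := fun _ => AddCommGrpCat.ofHom
      { toFun := fun s => ⟨(0, fun V x y => s.1 V.1 V.2 x y), s.isConn⟩
        map_zero' := rfl
        map_add' := fun _ _ => Subtype.ext (Prod.ext (add_zero 0).symm rfl) }
     naturality := fun _ _ h => AddCommGrpCat.hom_ext (AddMonoidHom.ext fun _ =>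
      Subtype.ext (Prod.ext (map_zero (res A h.unop.le)).symm rfl)) }⟩

/-- The morphism sending a `c`-connection to `c`. -/
def connToAdd : f.connSheaf ⟶ addSheaf A :=
  ⟨{ app := fun U => AddCommGrpCat.ofHom
      ((AddMonoidHom.fst _ _).comp (f.connGroup U.unop).subtype)
     naturality := fun _ _ _ => rfl }⟩

/-- Any `sp(E)`-valued 1-form is closed, since `φ(s_x y, z)` is symmetric in `y` and `z`; hence the
kernel of `c` consists of the closed `sp(E)`-valued 1-forms. -/
theorem exists_closedSp {U : Opens M} {N : ∀ V : Opens M, V ≤ U → f.E V → f.E V → f.E V}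
    (hN : f.IsConn 0 N) :
    ∃ s : f.ClosedSpSec U, ∀ V hV x y, s.1 V hV x y = N V hV x y := by
  have hs : ∀ V (hV : V ≤ U) x y z,
      f.form V (N V hV x y) z + f.form V y (N V hV x z) = 0 := fun V hV x y z => by
    rw [← hN.form, map_zero, zero_mul]
  refine ⟨⟨fun V hV => LinearMap.mk₂ (Sec A V) (N V hV) (hN.add_left V hV) (hN.smul_left V hV)
    (hN.add_right V hV) (fun a x y => by
      rw [hN.leibniz, map_zero, zero_mul, zero_smul, zero_add]), hN.res_app, fun V hV x y z => hs V hV x y z,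
    fun V hV x y z => ?_⟩, fun V hV x y => rfl⟩
  have h1 := hs V hV x y z
  have h2 := hs V hV y z x
  have h3 := hs V hV z x y
  rw [f.form_skew V y] at h1
  rw [f.form_skew V z] at h2
  rw [f.form_skew V x] at h3
  simp only [LinearMap.mk₂_apply, map_sub, LinearMap.sub_apply]
  linear_combination h1 + h2 + h3

end PoissonBracket
end
end SheafQuantization

namespace SheafQuantization
noncomputable section

/-! ### Existence of a torsion-free symplectic connection -/

variable {k : Type u} [Field k] {M : TopCat.{u}} {A : TopCat.Sheaf (CommAlgCat.{u} k) M}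

namespace PoissonBracket

variable {f : PoissonBracket A}

/-- A local basis of `E` over `U`. -/
def IsFrame {U : Opens M} {n : ℕ} (e : Fin n → f.E U) : Prop :=
  ∀ (V : Opens M) (h : V ≤ U),
    Function.Bijective fun c : Fin n → Sec A V => ∑ i, c i • f.resE h (e i)

theorem IsConn.smul {U : Opens M} {N : ∀ V : Opens M, V ≤ U → f.E V → f.E V → f.E V}
    (hN : f.IsConn 1 N) (c : Sec A U) : f.IsConn c (fun V hV x y => res A hV c • N V hV x y) where
  res_app V W hV hW x y := by
    rw [map_smulₛₗ, hN.res_app]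
    simp only [RingHom.coe_coe, res_res]
  add_left V hV x x' y := by rw [hN.add_left, smul_add]
  smul_left V hV a x y := by rw [hN.smul_left, smul_comm]
  add_right V hV x y y' := by rw [hN.add_right, smul_add]
  leibniz V hV a x y := by
    rw [hN.leibniz, map_one, one_mul, smul_add, smul_smul, smul_comm a]
  form V hV x y z := by
    have h := hN.form V hV x y z
    rw [map_one, one_mul] at h
    rw [h, map_smul, map_smul, LinearMap.smul_apply, smul_eq_mul, smul_eq_mul, mul_add]

theorem IsFrame.exists_coord {U : Opens M} {n : ℕ} {e : Fin n → f.E U} (he : IsFrame e) :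
    ∃ g : ∀ V : Opens M, V ≤ U → f.E V →ₗ[Sec A V] (Fin n → Sec A V),
      (∀ V h x, ∑ i, g V h x i • f.resE h (e i) = x) ∧
      (∀ V h i, g V h (f.resE h (e i)) = Pi.single i 1) ∧
      ∀ V W (h : V ≤ U) (hW : W ≤ V) x i,
        g W (hW.trans h) (f.resE hW x) i = res A hW (g V h x i) := by
  choose g hg using fun V h => (he V h).2
  have hg' : ∀ V h (x : f.E V), ∑ i, g V h x i • f.resE h (e i) = x := hg
  have uniq : ∀ V h (x : f.E V) (c : Fin n → Sec A V), ∑ i, c i • f.resE h (e i) = x → g V h x = c :=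
    fun V h x c hc => (he V h).1 ((hg V h x).trans hc.symm)
  refine ⟨fun V h => ⟨⟨g V h, fun x y => uniq V h _ _ ?_⟩, fun a x => uniq V h _ _ ?_⟩, hg',
    fun V h i => uniq V h _ _ ?_, fun V W h hW x i => congrFun (uniq W _ _ (fun i =>
      res A hW (g V h x i)) ?_) i⟩
  · simp only [Pi.add_apply, add_smul, Finset.sum_add_distrib, hg']
  · simp only [Pi.smul_apply, smul_eq_mul, mul_smul, ← Finset.smul_sum, hg', RingHom.id_apply]
  · simp [Pi.single_apply]
  · conv_rhs => rw [← hg' V h x]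
    rw [map_sum]
    refine Finset.sum_congr rfl fun i _ => ?_
    rw [map_smulₛₗ]
    rfl

/-- The flat connection of a local frame. -/
theorem IsFrame.exists_flat {U : Opens M} {n : ℕ} {e : Fin n → f.E U} (he : IsFrame e) :
    ∃ D : ∀ V : Opens M, V ≤ U → f.E V → f.E V → f.E V,
      (∀ V W (hV : V ≤ U) (hW : W ≤ V) x y,
        f.resE hW (D V hV x y) = D W (hW.trans hV) (f.resE hW x) (f.resE hW y)) ∧
      (∀ V hV x x' y, D V hV (x + x') y = D V hV x y + D V hV x' y) ∧
      (∀ V hV (a : Sec A V) x y, D V hV (a • x) y = a • D V hV x y) ∧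
      (∀ V hV x y y', D V hV x (y + y') = D V hV x y + D V hV x y') ∧
      ∀ V hV (a : Sec A V) x y, D V hV x (a • y) = f.anchor V x a • y + a • D V hV x y := by
  obtain ⟨g, hg', -, gres⟩ := he.exists_coord
  refine ⟨fun V h x y => ∑ i, f.anchor V x (g V h y i) • f.resE h (e i), ?_, ?_, ?_, ?_, ?_⟩
  · intro V W hV hW x y
    rw [map_sum]
    refine Finset.sum_congr rfl fun i _ => ?_
    rw [map_smulₛₗ, gres]
    simp only [RingHom.coe_coe, res_anchor]
    rfl
  · intro V hV x x' y
    simp only [map_add, Derivation.add_apply, add_smul, Finset.sum_add_distrib]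
  · intro V hV a x y
    simp only [map_smul, Derivation.smul_apply, smul_eq_mul, mul_smul, Finset.smul_sum]
  · intro V hV x y y'
    simp only [map_add, Pi.add_apply, add_smul, Finset.sum_add_distrib]
  · intro V hV a x y
    have h : f.anchor V x a • y = ∑ i, f.anchor V x a • g V hV y i • f.resE hV (e i) := by
      rw [← Finset.smul_sum, hg']
    rw [h, Finset.smul_sum, ← Finset.sum_add_distrib]
    refine Finset.sum_congr rfl fun i _ => ?_
    rw [map_smul, Pi.smul_apply, smul_eq_mul, Derivation.leibniz, smul_eq_mul, smul_eq_mul]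
    module

/-- By nonsingularity, the coordinate functions of a frame are represented by a dual frame. -/
theorem IsFrame.exists_dual (hns : f.IsNonsingular) {U : Opens M} {n : ℕ} {e : Fin n → f.E U}
    (he : IsFrame e) : ∃ e' : Fin n → f.E U, ∀ V (h : V ≤ U),
      (∀ i j, f.form V (f.resE h (e i)) (f.resE h (e' j)) = if i = j then 1 else 0) ∧
      ∀ x, ∑ i, f.form V x (f.resE h (e' i)) • f.resE h (e i) = x := by
  obtain ⟨g, hg, hge, gres⟩ := he.exists_coord
  choose s hs using fun j => (hns U).2
    { toFun := fun W hW => LinearMap.proj j ∘ₗ g W hW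
      res_toFun := fun V W hV hW x => (gres V W hV hW x j).symm }
  have hs' : ∀ V (h : V ≤ U) x j, f.form V x (f.resE h (-s j)) = g V h x j := fun V h x j => by
    rw [f.form_skew, map_neg, map_neg, LinearMap.neg_apply, neg_neg]
    exact congrArg (fun θ : f.DualSec U => θ.toFun V h x) (hs j)
  refine ⟨fun j => -s j, fun V h => ⟨fun i j => ?_, fun x => ?_⟩⟩
  · rw [hs', hge, Pi.single_apply]
    exact if_congr eq_comm rfl rfl
  · simp only [hs', hg]

theorem two_mul_half [CharZero k] (V : Opens M) :
    2 * algebraMap k (Sec A V) 2⁻¹ = 1 := by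
  rw [← map_ofNat (algebraMap k (Sec A V)) 2, ← map_mul, mul_inv_cancel₀ two_ne_zero, map_one]

theorem three_mul_third [CharZero k] (V : Opens M) :
    3 * algebraMap k (Sec A V) 3⁻¹ = 1 := by
  rw [← map_ofNat (algebraMap k (Sec A V)) 3, ← map_mul, mul_inv_cancel₀ three_ne_zero, map_one]

/-- Symplectic connections exist locally: the flat connection of a frame is corrected by half of
the derivative of `φ`. -/
theorem IsFrame.exists_isConn [CharZero k] (hns : f.IsNonsingular) {U : Opens M} {n : ℕ}
    {e : Fin n → f.E U} (he : IsFrame e) :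
    ∃ N : ∀ V : Opens M, V ≤ U → f.E V → f.E V → f.E V, f.IsConn 1 N := by
  obtain ⟨D, Dres, Dadd, Dsmul, Dadd', Dleib⟩ := he.exists_flat
  obtain ⟨S, hS, Sres⟩ := hns.exists_sharp (U := U)
    (fun V hV x y z => algebraMap k (Sec A V) 2⁻¹ *
      (f.anchor V x (f.form V y z) - f.form V (D V hV x y) z - f.form V y (D V hV x z)))
    (fun V W hV hW x y z => by
      simp only [map_mul, map_sub, AlgHom.commutes, res_anchor, res_form, Dres])
    (fun V hV x x' y z => by
      simp only [map_add, Derivation.add_apply, Dadd, LinearMap.add_apply]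
      ring)
    (fun V hV a x y z => by
      simp only [map_smul, Derivation.smul_apply, Dsmul, LinearMap.smul_apply, smul_eq_mul]
      ring)
    (fun V hV x y y' z => by
      simp only [map_add, Dadd', LinearMap.add_apply]
      ring)
    (fun V hV x a y z => by
      simp only [map_add, map_smul, Dleib, LinearMap.smul_apply, LinearMap.add_apply,
        Derivation.leibniz, smul_eq_mul]
      ring)
    (fun V hV x y z z' => by
      simp only [map_add, Dadd']
      ring)
    (fun V hV x y a z => by
      simp only [map_add, map_smul, Dleib, Derivation.leibniz, smul_eq_mul]
      ring)
  refine ⟨fun V hV x y => D V hV x y + S V hV x y, ?_, ?_, ?_, ?_, ?_, ?_⟩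
  · intro V W hV hW x y
    rw [map_add, Dres, Sres]
  · intro V hV x x' y
    simp only [Dadd, map_add, LinearMap.add_apply]
    abel
  · intro V hV a x y
    simp only [Dsmul, map_smul, LinearMap.smul_apply, smul_add]
  · intro V hV x y y'
    simp only [Dadd', map_add]
    abel
  · intro V hV a x y
    rw [Dleib, map_smul, map_one, one_mul, smul_add, add_assoc]
  · intro V hV x y z
    have h2 := two_mul_half (A := A) V
    rw [map_one, one_mul, map_add, map_add, LinearMap.add_apply, hS, f.form_skew V y (S V hV x z),
      hS, f.form_skew V z y, map_neg, f.form_skew V (D V hV x z) y, f.form_skew V z (D V hV x y)]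
    linear_combination - (f.anchor V x (f.form V y z) - f.form V (D V hV x y) z -
      f.form V y (D V hV x z)) * h2

/-- The obstruction to the existence of a global symplectic connection lies in `H¹(M, 𝒯)`. -/
theorem exists_symplectic_connection [CharZero k] (hfree : f.IsLocallyFree)
    (hns : f.IsNonsingular) (hT : Subsingleton (Sheaf.H f.closedSp 1)) :
    ∃ N : ∀ V : Opens M, V ≤ ⊤ → f.E V → f.E V → f.E V, f.IsConn (U := ⊤) 1 N := by
  obtain ⟨s, hs⟩ := exists_global_lift f.closedSpToConn f.connToAdd
    (fun U s t h => ClosedSpSec.ext' fun V hV x y => by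
      have h' := congrArg (fun p : f.connGroup U.unop => p.1.2 ⟨V, hV⟩ x y) h
      exact h')
    rfl
    (fun U p hp => by
      obtain ⟨⟨c, N⟩, hN⟩ := p
      obtain rfl : c = 0 := hp
      obtain ⟨s, hs⟩ := f.exists_closedSp hN
      refine ⟨s, Subtype.ext (Prod.ext rfl ?_)⟩
      funext V x y
      exact hs V.1 V.2 x y)
    ((TopCat.Presheaf.isLocallySurjective_iff _).2 fun U c p hp => by
      obtain ⟨W, n, e, hpW, he⟩ := hfree p
      obtain ⟨N, hN⟩ := IsFrame.exists_isConn hns (e := e) he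
      have hN' := (IsConn.restrict (inf_le_right : U ⊓ W ≤ W) hN)
      rw [map_one] at hN'
      have hc := hN'.smul (res A (inf_le_left : U ⊓ W ≤ U) c)
      exact ⟨U ⊓ W, inf_le_left, ⟨⟨(_, fun V x y => res A V.2 (res A inf_le_left c) • N V.1 (V.2.trans inf_le_right) x y), hc⟩,
        rfl⟩, ⟨hp, hpW⟩⟩)
    hT (1 : Sec A ⊤)
  obtain ⟨⟨c, N⟩, hN⟩ := s
  obtain rfl : c = 1 := hs
  exact ⟨_, hN⟩

/-- A symplectic connection can be made torsion-free by subtracting a third of its torsion,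
symmetrized in the last two arguments. -/
theorem exists_torsionFree [CharZero k] (hns : f.IsNonsingular) {U : Opens M}
    {N : ∀ V : Opens M, V ≤ U → f.E V → f.E V → f.E V} (hN : f.IsConn 1 N) :
    ∃ N' : ∀ V : Opens M, V ≤ U → f.E V → f.E V → f.E V, f.IsConn 1 N' ∧
      ∀ V hV x y, N' V hV x y - N' V hV y x = f.lieE x y := by
  let τ : ∀ V : Opens M, V ≤ U → f.E V → f.E V → f.E V → Sec A V := fun V hV x y z =>
    f.form V (N V hV x y - N V hV y x - f.lieE x y) z
  have hleib : ∀ V hV (a : Sec A V) x y, N V hV x (a • y) = f.anchor V x a • y + a • N V hV x y :=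
    fun V hV a x y => by rw [hN.leibniz, map_one, one_mul]
  have τskew : ∀ V hV x y z, τ V hV y x z = - τ V hV x y z := fun V hV x y z => by
    simp only [τ]
    rw [f.lieE_skew, ← LinearMap.neg_apply, ← map_neg]
    congr 2
    abel
  have τadd : ∀ V hV x y y' z, τ V hV x (y + y') z = τ V hV x y z + τ V hV x y' z :=
    fun V hV x y y' z => by
      simp only [τ, hN.add_left, hN.add_right, lieE_add, map_sub, map_add, LinearMap.sub_apply,
        LinearMap.add_apply]
      ring
  have τsmul : ∀ V hV x (a : Sec A V) y z, τ V hV x (a • y) z = a * τ V hV x y z :=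
    fun V hV x a y z => by
      simp only [τ, hN.smul_left, hleib, lieE_smul, map_sub, map_add, map_smul,
        LinearMap.sub_apply, LinearMap.add_apply, LinearMap.smul_apply, smul_eq_mul]
      ring
  have τadd' : ∀ V hV x y z z', τ V hV x y (z + z') = τ V hV x y z + τ V hV x y z' :=
    fun V hV x y z z' => map_add _ _ _
  have τsmul' : ∀ V hV x y (a : Sec A V) z, τ V hV x y (a • z) = a * τ V hV x y z :=
    fun V hV x y a z => map_smul _ _ _
  have τres : ∀ V W (hV : V ≤ U) (hW : W ≤ V) x y z, res A hW (τ V hV x y z) =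
      τ W (hW.trans hV) (f.resE hW x) (f.resE hW y) (f.resE hW z) := fun V W hV hW x y z => by
    simp only [τ]
    rw [res_form]
    simp only [map_sub, hN.res_app, resE_lieE]
  -- The cyclic sum of the torsion is the exterior derivative of `φ`.
  have τcyc : ∀ V hV x y z, τ V hV x y z + τ V hV y z x + τ V hV z x y = 0 := fun V hV x y z => by
    have h := f.form_closed x y z
    have h' : ∀ x y z, f.anchor V x (f.form V y z) =
        f.form V (N V hV x y) z + f.form V y (N V hV x z) := fun x y z => by
      rw [← hN.form, map_one, one_mul]
    rw [h', h', h', f.form_skew V y, f.form_skew V z, f.form_skew V x] at h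
    simp only [τ, map_sub, LinearMap.sub_apply]
    linear_combination h
  obtain ⟨S, hS, Sres⟩ := hns.exists_sharp (U := U)
    (fun V hV x y z => - algebraMap k (Sec A V) 3⁻¹ * (τ V hV x y z + τ V hV x z y))
    (fun V W hV hW x y z => by
      simp only [map_mul, map_neg, map_add, AlgHom.commutes, τres])
    (fun V hV x x' y z => by
      simp only [τskew V hV _ (x + x'), τskew V hV _ x, τskew V hV _ x', τadd]
      ring)
    (fun V hV a x y z => by
      rw [τskew V hV y, τskew V hV z, τsmul, τsmul, τskew V hV x y, τskew V hV x z]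
      ring)
    (fun V hV x y y' z => by
      rw [τadd, τadd']
      ring)
    (fun V hV x a y z => by
      rw [τsmul, τsmul']
      ring)
    (fun V hV x y z z' => by
      rw [τadd, τadd']
      ring)
    (fun V hV x y a z => by
      rw [τsmul, τsmul']
      ring)
  refine ⟨fun V hV x y => N V hV x y + S V hV x y, ⟨?_, ?_, ?_, ?_, ?_, ?_⟩, fun V hV x y => ?_⟩
  · intro V W hV hW x y
    rw [map_add, hN.res_app, Sres]
  · intro V hV x x' y
    simp only [hN.add_left, map_add, LinearMap.add_apply]
    abel
  · intro V hV a x y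
    simp only [hN.smul_left, map_smul, LinearMap.smul_apply, smul_add]
  · intro V hV x y y'
    simp only [hN.add_right, map_add]
    abel
  · intro V hV a x y
    rw [hN.leibniz, map_smul, smul_add, add_assoc]
  · intro V hV x y z
    rw [hN.form, map_add, map_add, LinearMap.add_apply, hS, f.form_skew V y (S V hV x z), hS]
    ring
  · refine hns.ext fun W hW z => ?_
    have h3 := three_mul_third (A := A) W
    have h1 := τcyc W (hW.trans hV) (f.resE hW x) (f.resE hW y) z
    have h2 := τskew W (hW.trans hV) (f.resE hW x) (f.resE hW y) z
    have h4 := τskew W (hW.trans hV) z (f.resE hW x) (f.resE hW y)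
    have h5 : τ W (hW.trans hV) (f.resE hW x) (f.resE hW y) z = f.form W
      (N W (hW.trans hV) (f.resE hW x) (f.resE hW y) - N W (hW.trans hV) (f.resE hW y) (f.resE hW x) -
        f.lieE (f.resE hW x) (f.resE hW y)) z := rfl
    simp only [map_sub, LinearMap.sub_apply] at h5
    simp only [map_sub, map_add, hN.res_app, Sres, resE_lieE, LinearMap.sub_apply,
      LinearMap.add_apply, hS]
    set t := algebraMap k (Sec A W) 3⁻¹
    linear_combination -h5 + t * h2 - t * h4 + t * h1 -
      τ W (hW.trans hV) (f.resE hW x) (f.resE hW y) z * h3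

end PoissonBracket
end
end SheafQuantization

namespace SheafQuantization
noncomputable section

/-! ### The star product on small open subsets -/

variable {k : Type u} [Field k] {M : TopCat.{u}} {A : TopCat.Sheaf (CommAlgCat.{u} k) M}

namespace PoissonBracket

variable {f : PoissonBracket A}

variable (f) in
/-- An open subset is small if `E` has a basis over it. -/
def IsSmall (U : Opens M) : Prop := ∃ (n : ℕ) (e : Fin n → f.E U), IsFrame e

theorem IsSmall.mono {U V : Opens M} (hU : f.IsSmall U) (h : V ≤ U) : f.IsSmall V := by
  obtain ⟨n, e, he⟩ := hU
  exact ⟨n, fun i => f.resE h (e i), fun W hW => he W (hW.trans h)⟩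

theorem IsLocallyFree.exists_isSmall (hfree : f.IsLocallyFree) (p : M) :
    ∃ U : Opens M, p ∈ U ∧ f.IsSmall U := by
  obtain ⟨U, n, e, hp, he⟩ := hfree p
  exact ⟨U, hp, n, e, he⟩

variable (f) in
/-- `N` is a torsion-free symplectic connection on `E`. -/
def IsTorsionFree (N : ∀ V : Opens M, V ≤ ⊤ → f.E V → f.E V → f.E V) : Prop :=
  f.IsConn (U := ⊤) 1 N ∧ ∀ V hV x y, N V hV x y - N V hV y x = f.lieE x y

theorem IsSmall.exists_dual (hns : f.IsNonsingular) {V : Opens M} (hV : f.IsSmall V) :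
    ∃ (n : ℕ) (e e' : Fin n → f.E V), ∀ W (h : W ≤ V),
      (∀ i j, f.form W (f.resE h (e i)) (f.resE h (e' j)) = if i = j then 1 else 0) ∧
      ∀ x, ∑ i, f.form W x (f.resE h (e' i)) • f.resE h (e i) = x := by
  obtain ⟨n, e, he⟩ := hV
  exact ⟨n, e, he.exists_dual hns⟩

variable (hns : f.IsNonsingular) {N : ∀ V : Opens M, V ≤ ⊤ → f.E V → f.E V → f.E V}
  (hN : f.IsTorsionFree N)

/-- The sections of `A` and `E` over a small open subset as a symplectic Lie–Rinehart algebra with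
connection. -/
def localData {V : Opens M} (hV : f.IsSmall V) : SymplecticData k (Sec A V) (f.E V) where
  n := (hV.exists_dual hns).choose
  e := (hV.exists_dual hns).choose_spec.choose
  e' := (hV.exists_dual hns).choose_spec.choose_spec.choose
  form := f.form V
  form_skew := f.form_skew V
  form_e_e' := ((hV.exists_dual hns).choose_spec.choose_spec.choose_spec V le_rfl).1
  sum_form := ((hV.exists_dual hns).choose_spec.choose_spec.choose_spec V le_rfl).2
  anchor := f.anchor V
  conn := N V le_top
  conn_add_left := hN.1.add_left V le_top
  conn_smul_left := hN.1.smul_left V le_top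
  conn_add_right := hN.1.add_right V le_top
  conn_leibniz a x y := by rw [hN.1.leibniz, map_one, one_mul]
  conn_form x y z := by rw [← hN.1.form, map_one, one_mul]
  anchor_bracket x y a := by rw [hN.2, anchor_lieE]
  jacobi x y z := by simp only [hN.2, lieE_jacobi]

/-- Restriction as a morphism of symplectic Lie–Rinehart algebras. -/
def localHom {V W : Opens M} (hV : f.IsSmall V) (hW : f.IsSmall W) (h : W ≤ V) :
    SymplecticHom (localData hns hN hV) (localData hns hN hW) where
  h := res A h
  s := f.resE h
  η := 1
  sign := one_mul 1
  map_add := map_add _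
  map_smul := map_smulₛₗ _
  map_form x y := (f.res_form h x y).symm
  map_conn x y := (hN.1.res_app V W le_top h x y).symm
  map_anchor x a := (f.res_anchor h x a).symm
  generates := ((hV.exists_dual hns).choose_spec.choose_spec.choose_spec W h).2

/-! ### Gluing of the star products -/

open PowerSeries

variable (A) in
/-- Coefficientwise restriction of formal series of sections. -/
def resSeries {U V : Opens M} (h : V ≤ U) : (Sec A U)⟦X⟧ →+* (Sec A V)⟦X⟧ :=
  PowerSeries.map (res A h).toRingHom

theorem coeff_resSeries {U V : Opens M} (h : V ≤ U) (a : (Sec A U)⟦X⟧) (d : ℕ) :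
    coeff d (resSeries A h a) = res A h (coeff d a) :=
  PowerSeries.coeff_map _ _ _

theorem resSeries_resSeries {U V W : Opens M} (h : V ≤ U) (h' : W ≤ V) (a : (Sec A U)⟦X⟧) :
    resSeries A h' (resSeries A h a) = resSeries A (h'.trans h) a := by
  ext d
  rw [coeff_resSeries, coeff_resSeries, coeff_resSeries, res_res]

theorem resSeries_C {U V : Opens M} (h : V ≤ U) (a : Sec A U) :
    resSeries A h (C a) = C (res A h a) :=
  PowerSeries.map_C _ _

theorem resSeries_smul {U V : Opens M} (h : V ≤ U) (c : k⟦X⟧) (a : (Sec A U)⟦X⟧) :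
    resSeries A h (c • a) = c • resSeries A h a := by
  have hc : resSeries A h (PowerSeries.map (algebraMap k _) c) =
      PowerSeries.map (algebraMap k _) c := by
    ext d
    rw [coeff_resSeries, PowerSeries.coeff_map, PowerSeries.coeff_map, AlgHom.commutes]
  rw [Algebra.smul_def, Algebra.smul_def, algebraMap_apply'', algebraMap_apply'', map_mul, hc]

variable (A) in
theorem series_hasGluing : HasGluing (fun U => (Sec A U)⟦X⟧) (fun _ _ h => resSeries A h) := by
  intro V ι U hU hc s hs
  choose t ht htu using fun d => sec_hasGluing A V ι U hU hc (fun i => coeff d (s i))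
    (fun i j => by
      have := congrArg (coeff d) (hs i j)
      rwa [coeff_resSeries, coeff_resSeries] at this)
  refine ⟨PowerSeries.mk t, fun i => ?_, fun a ha => ?_⟩
  · ext d
    rw [coeff_resSeries, coeff_mk]
    exact ht d i
  · ext d
    rw [coeff_mk]
    exact htu d _ fun i => by
      change res A _ _ = _
      rw [← coeff_resSeries]
      exact congrArg (coeff d) (ha i)

/-- The star products over small open subsets are compatible with restriction, and hence glue to a
star product on the sheaf `A`. -/
theorem exists_quantization [CharZero k] (hfree : f.IsLocallyFree) (hns : f.IsNonsingular)
    {N : ∀ V : Opens M, V ≤ ⊤ → f.E V → f.E V → f.E V} (hN : f.IsTorsionFree N) :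
    Nonempty (Quantization f) := by
  have hc : (⊤ : Opens M) ≤ iSup (fun i : {V : Opens M // f.IsSmall V} => i.1) := fun p _ => by
    obtain ⟨U, hp, hU⟩ := hfree.exists_isSmall p
    exact Opens.mem_iSup.2 ⟨⟨U, hU⟩, hp⟩
  have hr : ∀ (U V W : Opens M) (h : V ≤ U) (h' : W ≤ V) (x : (Sec A U)⟦X⟧),
      resSeries A h' (resSeries A h x) = resSeries A (h'.trans h) x := fun _ _ _ h h' x =>
    resSeries_resSeries h h' x
  -- The product over a small open subset does not depend on the member of the cover containing it.
  obtain ⟨t, tn, ti⟩ := HasGluing.glueHom (X := fun W => (Sec A W)⟦X⟧ × (Sec A W)⟦X⟧)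
    (Y := fun W => (Sec A W)⟦X⟧) (rX := fun _ _ h x => (resSeries A h x.1, resSeries A h x.2))
    (rY := fun _ _ h => resSeries A h)
    (fun _ _ _ h h' x => Prod.ext (hr _ _ _ h h' x.1) (hr _ _ _ h h' x.2)) hr
    (series_hasGluing A) (fun i => le_top) hc
    (fun i W h x => (localData hns hN (i.2.mono h)).prod x.1 x.2)
    (fun i W W' h h' x => (localHom hns hN (i.2.mono h) (i.2.mono (h'.trans h)) h').map_prod rfl _ _)
    (fun i j W hi hj x => rfl)
  have small : ∀ (W : Opens M) (i : {V : Opens M // f.IsSmall V}), f.IsSmall (W ⊓ i.1) :=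
    fun W i => i.2.mono inf_le_right
  have loc : ∀ (W : Opens M) (i : {V : Opens M // f.IsSmall V}) (a b : (Sec A W)⟦X⟧),
      resSeries A (inf_le_left : W ⊓ i.1 ≤ W) (t W le_top (a, b)) =
        (localData hns hN (small W i)).prod (resSeries A inf_le_left a) (resSeries A inf_le_left b) :=
    fun W i a b => (tn W (W ⊓ i.1) le_top inf_le_left (a, b)).trans (ti i _ inf_le_right _)
  have ext : ∀ (W : Opens M) (a b : (Sec A W)⟦X⟧), (∀ i : {V : Opens M // f.IsSmall V},
      resSeries A (inf_le_left : W ⊓ i.1 ≤ W) a = resSeries A inf_le_left b) → a = b :=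
    fun W a b h => (series_hasGluing A).ext hr (fun i => inf_le_left)
      (inf_le_iSup_inf le_top hc) h
  have extA : ∀ (W : Opens M) (a b : Sec A W), (∀ i : {V : Opens M // f.IsSmall V},
      res A (inf_le_left : W ⊓ i.1 ≤ W) a = res A inf_le_left b) → a = b :=
    fun W a b h => sec_ext A (fun i => inf_le_left) (inf_le_iSup_inf le_top hc) h
  refine ⟨⟨fun U => LinearMap.mk₂ k⟦X⟧ (fun a b => t U le_top (a, b)) ?_ ?_ ?_ ?_, ?_, ?_, ?_, ?_,
    ?_, ?_⟩⟩
  · intro a a' b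
    refine ext U _ _ fun i => ?_
    simp only [map_add, loc, SymplecticData.add_prod]
  · intro c a b
    refine ext U _ _ fun i => ?_
    simp only [resSeries_smul, loc, SymplecticData.smul_prod]
  · intro a b b'
    refine ext U _ _ fun i => ?_
    simp only [map_add, loc, SymplecticData.prod_add]
  · intro c a b
    refine ext U _ _ fun i => ?_
    simp only [resSeries_smul, loc, SymplecticData.prod_smul]
  · intro U V h a b
    exact tn U V le_top h (a, b)
  · intro U a b c
    refine ext U _ _ fun i => ?_
    simp only [LinearMap.mk₂_apply, loc, SymplecticData.prod_assoc]
  · intro U a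
    refine ext U _ _ fun i => ?_
    simp only [LinearMap.mk₂_apply, loc, map_one, SymplecticData.one_prod]
  · intro U a
    refine ext U _ _ fun i => ?_
    simp only [LinearMap.mk₂_apply, loc, map_one, SymplecticData.prod_one]
  · intro U a b
    refine extA U _ _ fun i => ?_
    rw [LinearMap.mk₂_apply, map_mul, ← coeff_resSeries, loc, SymplecticData.coeff_zero_prod,
      coeff_resSeries, coeff_resSeries]
  · intro U a b
    refine extA U _ _ fun i => ?_
    have h : ∀ c, ∀ x, (localData hns hN (small U i)).form x (f.hamE _ c) =
        (localData hns hN (small U i)).anchor x c := fun c x => f.form_hamE _ x c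
    rw [LinearMap.mk₂_apply, ← coeff_resSeries, loc, resSeries_C, resSeries_C,
      SymplecticData.coeff_one_prod _ _ _ _ _ (h _) (h _), h, f.br_res]
    exact f.anchor_hamE _ _ _

end PoissonBracket
end
end SheafQuantization


theorem mainTheorem1 {k : Type u} [Field k] [CharZero k] {M : TopCat.{u}}
    (A : TopCat.Sheaf (CommAlgCat.{u} k) M) (f : SheafQuantization.PoissonBracket A)
    (hfree : f.IsLocallyFree) (hnonsing : f.IsNonsingular)
    (hT : Subsingleton (Sheaf.H f.closedSp 1)) :
    Nonempty (SheafQuantization.Quantization f) := by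
  obtain ⟨N, hN⟩ := SheafQuantization.PoissonBracket.exists_symplectic_connection hfree hnonsing hT
  obtain ⟨N', hN'⟩ := SheafQuantization.PoissonBracket.exists_torsionFree hnonsing hN
  exact SheafQuantization.PoissonBracket.exists_quantization hfree hnonsing hN'
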